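/- **Conventions.** $S_n$ is the group of permutations of $[n]=\{1,\dots,n\}$, $\sigma\in S_n$ is written as the vector $[\sigma(1),\dots,\sigma(n)]$, and $d_\infty(\sigma,\tau)=\max_{j}|\sigma(j)-\tau(j)|$. For $1\le i<j\le n$ let $t_{i\uparrow j}:S_n\to S_n$ move the $j$th entry of the vector to index $i$ and shift the entries at indices $i,\dots,j-1$ one place to the right; $t_{\uparrow j}=t_{1\uparrow j}$. A $G_{\uparrow}(n,M)$ is a sequence of $M$ distinct permutations $c_1,\dots,c_M\in S_n$ such that for every $r$ there is $j_r\in\{2,\dots,n\}$ with $c_{(r\bmod M)+1}=t_{\uparrow j_r}(c_r)$; it is generated by the transition sequence $t_{\uparrow j_1},\dots,t_{\uparrow j_M}$. It is a $G_{\uparrow}(n,M,d)$ if moreover $d_\infty(\sigma,\tau)\ge d$ for all distinct members $\sigma,\tau$. It is a $G^{\mathrm{aux}}_{\uparrow}(n,M)$ if for each member $\sigma$ and each $q\in[n-1]$ the permutation $(q,n)\circ\sigma$ is not a member. For $k\ge3$ put $$\tilde M_k=\begin{cases}8&k=4,\\57&k=5,\\178&k=6,\\ k!/2&k\ne5\text{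 odd},\\ (k-3)\left(\frac{(k-1)!}{2}+2\right)+1&k>6\text{ even}\end{cases}$$ (in the last case $\tilde M_k=\rho_k\,k!/2$ with $\rho_k>\frac{k-3}{k}$). An *auxiliary sequence* for $k$ is a transition sequence $t_{\uparrow k},t_{\uparrow i_2},\dots,t_{\uparrow i_{\tilde M_k}}$ that generates a $G^{\mathrm{aux}}_{\uparrow}(k,\tilde M_k)$ starting at the identity; a *complete sequence* for $k$ is a transition sequence that generates a $G_\uparrow(k,k!)$. **Recursion.** Split $[n]$ into consecutive blocks of $s_1,\dots,s_d$ indices and let $o_m=s_1+\dots+s_{m-1}$. Given the transition sequence of $C_{m+1}$, the one of $C_m$ arises by replacing each transition $t_{o_{m+1}+1\uparrow j}$ with $t_{o_m+1\uparrow j}$ followed by $t_{o_m+1\uparrow o_m+i_2},\,t_{o_m+1\uparrow o_m+i_3},\dots,t_{o_m+1\uparrow o_m+i_M}$, where $t_{\uparrow s_m+1},t_{\uparrow i_2},\dots,t_{\uparrow i_M}$, $M=\tilde M_{s_m+1}$, is any auxiliary sequence for $s_m+1$. All $C_m$ start at the same $\sigma_0\in S_n$. Unless stated otherwise the recursion begins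 with $C_d$, whose transition sequence is $t_{o_d+1\uparrow o_d+r_1},t_{o_d+1\uparrow o_d+r_2},\dots$ for any complete sequence $t_{\uparrow r_1},t_{\uparrow r_2},\dots$ for $s_d$. **Theorem.** 1. Let $n=kd$ with $k\ge2$, $d\ge1$. Let $s_m=k$ for all $m$, and $\sigma_0(j)=d\,(j\bmod k)+\lceil j/k\rceil$ for $j\in[n]$. Then a code $C_1$ as above exists, and each such $C_1$ is a $G_\uparrow\!\left(n,\tilde M_{k+1}^{\,d-1}\cdot k!,\,d\right)$. 2. Let $d\ge1$ and $n\ge2d$. Let $\mathcal R_m$ be the class of $m$ modulo $d$ in $[n]$, $s_m=|\mathcal R_m|$ for $m\in[d]$, and $\sigma_0=[\mathcal R_1|\mathcal R_2|\cdots|\mathcal R_d]$ a concatenation of these classes, each in an arbitrary order. Then a code $C_1$ as above exists, and each such $C_1$ is a $$G_\uparrow\!\left(n,\ \tilde M_{\lceil n/d\rceil+1}^{\,n\bmod d}\cdot\tilde M_{\lfloor n/d\rfloor+1}^{\,d-(n\bmod d)-1}\cdot\lfloor n/d\rfloor!,\ d\right).$$ 3. Let $d<n<2d$, let $s_m$ and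 $\sigma_0$ be as in 2, put $m=n\bmod d$, and let the recursion begin instead with $C_m=(\sigma_0,\ t_{2m-1\uparrow2m+1}\sigma_0,\ t_{2m-1\uparrow2m+1}^2\sigma_0)$, with transition sequence $t_{2m-1\uparrow2m+1}$ three times. Then a code $C_1$ exists, and each such $C_1$ is a $G_\uparrow(n,3^{\,n\bmod d},d)$. -/

import Mathlib

open Equiv
open scoped Nat

/-! Permutations of `[n] = {1, …, n}` are elements of `Perm (Fin n)`: the element `p : Fin n`
stands for `p + 1 ∈ [n]`, and `σ` stands for the vector `[σ(1), …, σ(n)]`. The indices `i`, `j` of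
transitions, the numbers of congruence classes and the levels of the construction are natural
numbers that count from `1`. -/

/-- The cycle `(j, j-1, …, i)` on `[n]`, for `1 ≤ i < j ≤ n` (and the identity for all other
indices, which never occur as transitions). -/
def pushCycle (n i j : ℕ) : Perm (Fin n) :=
  if h : 1 ≤ i ∧ i < j ∧ j ≤ n then
    (Fin.cycleIcc (⟨i - 1, by omega⟩ : Fin n) (⟨j - 1, by omega⟩ : Fin n))⁻¹
  else 1

/-- The transition `t_{i↑j}`, "push to the `i`th index": it moves the `j`th entry of the vector
`σ` to index `i` and shifts the entries at indices `i, …, j - 1` by one to the right. -/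
def push {n : ℕ} (i j : ℕ) (σ : Perm (Fin n)) : Perm (Fin n) := σ * pushCycle n i j

/-- The transition `t_{i↑j}` in vector notation. -/
theorem push_apply {n i j : ℕ} (hi : 1 ≤ i) (hij : i < j) (hj : j ≤ n) (σ : Perm (Fin n))
    (p : Fin n) :
    push i j σ p =
      if (p : ℕ) + 1 = i then σ ⟨j - 1, by omega⟩
      else if i < (p : ℕ) + 1 ∧ (p : ℕ) + 1 ≤ j then σ ⟨(p : ℕ) - 1, by omega⟩
      else σ p := by
  have : NeZero n := ⟨by omega⟩
  have hle : (⟨i - 1, by omega⟩ : Fin n) ≤ ⟨j - 1, by omega⟩ := by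
    simp only [Fin.mk_le_mk]; omega
  simp only [push, pushCycle, dif_pos (And.intro hi (And.intro hij hj)), Perm.mul_apply]
  split_ifs with h1 h2
  · congr 1
    rw [Perm.inv_eq_iff_eq, Fin.cycleIcc_of_last hle]
    ext; simp only; omega
  · congr 1
    rw [Perm.inv_eq_iff_eq, Fin.cycleIcc_of_ge_of_lt]
    · have h3 : (p : ℕ) - 1 + 1 < n := by have := p.2; omega
      ext
      rw [Fin.val_add_one_of_lt' h3]
      simp only; omega
    · simp only [Fin.mk_le_mk]; omega
    · simp only [Fin.mk_lt_mk]; omega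
  · congr 1
    rw [Perm.inv_eq_iff_eq]
    rcases Nat.lt_or_ge ((p : ℕ) + 1) i with h3 | h3
    · rw [Fin.cycleIcc_of_lt]
      rw [Fin.lt_def]; simp only; omega
    · rw [Fin.cycleIcc_of_gt]
      rw [Fin.lt_def]; simp only; omega

/-! ### Gray codes -/

/-- `C` is a `T`-Gray code over `S`: its members are distinct, and each one is followed by its
image under a transition of `T`. -/
def IsGrayCode {S : Type*} (T : Set (S → S)) (C : List S) : Prop :=
  C.Nodup ∧ ∀ (r : ℕ) (h : r + 1 < C.length), ∃ t ∈ T, C[r + 1] = t C[r]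

/-- A nonempty `T`-Gray code is cyclic if some transition of `T` leads from its last member to its
first. -/
def IsCyclicGrayCode {S : Type*} (T : Set (S → S)) (C : List S) : Prop :=
  IsGrayCode T C ∧ ∃ h : C ≠ [], ∃ t ∈ T, C.head h = t (C.getLast h)

/-- `C` is a `G_{i↑}(n, M)`. -/
def IsPushGrayCode (i n M : ℕ) (C : List (Perm (Fin n))) : Prop :=
  IsCyclicGrayCode {t | ∃ j, i < j ∧ j ≤ n ∧ t = push i j} C ∧ C.length = M

/-- The metric `d_∞(σ, τ) = max_j |σ(j) - τ(j)|` on `S_n`. -/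
def distInf {n : ℕ} (σ τ : Perm (Fin n)) : ℕ :=
  Finset.univ.sup fun j => ((σ j : ℤ) - (τ j : ℤ)).natAbs

/-- The set `C` is an `(n, M, d)`-LMRM code: it has `M` elements and minimal `ℓ_∞`-distance `d`. -/
def IsLMRM (n M d : ℕ) (C : Set (Perm (Fin n))) : Prop :=
  C.ncard = M ∧ ∀ σ ∈ C, ∀ τ ∈ C, σ ≠ τ → d ≤ distInf σ τ

/-- `C` is a `G_{i↑}(n, M, d)`. -/
def IsPushGrayLMRM (i n M d : ℕ) (C : List (Perm (Fin n))) : Prop :=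
  IsPushGrayCode i n M C ∧ IsLMRM n M d {σ | σ ∈ C}

/-- `C` is a `G^aux_↑(k, M)`: a `G_↑(k, M)` such that `σ ∈ C` implies `(q, k) ∘ σ ∉ C` for all
`q ∈ [k - 1]`. -/
def IsAuxCode (k M : ℕ) (C : List (Perm (Fin k))) : Prop :=
  IsPushGrayCode 1 k M C ∧
    ∀ σ ∈ C, ∀ q l : Fin k, (l : ℕ) + 1 = k → q < l → swap q l * σ ∉ C

/-! ### Transition sequences -/

/-- The sequence `σ, t_{i↑j₁}(σ), t_{i↑j₂}(t_{i↑j₁}(σ)), …` that arises from `σ` through the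
transition sequence `t_{i↑j₁}, t_{i↑j₂}, …, t_{i↑j_M}`; the result of the last transition is left
out, so that the sequence has `M` members. -/
def walk {n : ℕ} (i : ℕ) : Perm (Fin n) → List ℕ → List (Perm (Fin n))
  | _, [] => []
  | σ, j :: js => σ :: walk i (push i j σ) js

/-- The transition sequence `t_{i↑j₁}, …, t_{i↑j_M}`, where `js = [j₁, …, j_M]`, generates the
cyclic code `C`; its last transition leads from the last member of `C` back to the first. -/
def Generates {n : ℕ} (i : ℕ) (js : List ℕ) (C : List (Perm (Fin n))) : Prop :=
  (∀ j ∈ js, i < j ∧ j ≤ n) ∧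
    ∃ σ, C = walk i σ js ∧ js.foldl (fun τ j => push i j τ) σ = σ

/-- `js` is a transition sequence that generates a complete cyclic code, a `G_↑(k, k!)`. -/
def IsCompleteSeq (k : ℕ) (js : List ℕ) : Prop :=
  ∃ C : List (Perm (Fin k)), IsPushGrayCode 1 k (k !) C ∧ Generates 1 js C

/-- The sizes `M̃_k`, `k ≥ 3`, of the auxiliary codes. For even `k > 6` the value is
`M̃_k = ρ_k · k! / 2` with `ρ_k > (k - 3) / k`. -/
def auxSize (k : ℕ) : ℕ :=
  if k = 4 then 8
  else if k = 5 then 57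
  else if k = 6 then 178
  else if k % 2 = 1 then k ! / 2
  else (k - 3) * ((k - 1)! / 2 + 2) + 1

/-- `js` is a transition sequence `t_{↑k}, t_{↑i₂}, …` that generates a `G^aux_↑(k, M̃_k)` which
starts with the identity. -/
def IsAuxSeq (k : ℕ) (js : List ℕ) : Prop :=
  js.head? = some k ∧
    ∃ C : List (Perm (Fin k)), C.head? = some 1 ∧ IsAuxCode k (auxSize k) C ∧ Generates 1 js C

/-! ### The construction

The vector of the starting permutation is split into consecutive blocks, the `m`th one having
`s m` entries (`m = 1, 2, …`). -/

/-- The number of indices that precede the `m`th block. -/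
def offset (s : ℕ → ℕ) (m : ℕ) : ℕ := ∑ i ∈ Finset.Ico 1 m, s i

/-- `Stage s b T₀ m T`: the recursion that begins with the transition sequence `T₀` of the code
`C_b` can give the transition sequence `T` for the code `C_m`. The entry `j` of the sequence of
`C_m` stands for the transition `t_{offset s m + 1 ↑ j}`. In the step from `C_{m+1}` to `C_m` each
transition `t_{offset s (m+1) + 1 ↑ j}` is replaced by `t_{offset s m + 1 ↑ j}`, followed by
`t_{offset s m + 1 ↑ offset s m + i_r}` for `r = 2, 3, …`, where `t_{↑ s m + 1}, t_{↑i₂}, …` is the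
sequence of an auxiliary code in `S_{s m + 1}`. -/
inductive Stage (s : ℕ → ℕ) (b : ℕ) (T₀ : List ℕ) : ℕ → List ℕ → Prop
  | base : Stage s b T₀ b T₀
  | step (m : ℕ) (T aux : List ℕ) : 1 ≤ m → Stage s b T₀ (m + 1) T → IsAuxSeq (s m + 1) aux →
      Stage s b T₀ m (T.flatMap fun j => j :: aux.tail.map fun x => offset s m + x)

/-- `C` is a code `C_1` obtained from the starting permutation `σ₀` by the recursion that begins
with a code `C_d` which permutes the `d`th block by the transition sequence of a complete code. -/
def IsRecursiveCode {n : ℕ} (s : ℕ → ℕ) (d : ℕ) (σ₀ : Perm (Fin n)) (C : List (Perm (Fin n))) :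
    Prop :=
  ∃ r T : List ℕ, IsCompleteSeq (s d) r ∧ Stage s d (r.map fun x => offset s d + x) 1 T ∧
    C = walk 1 σ₀ T

/-- `C` is a code `C_1` obtained from `σ₀` by the recursion that begins with the code
`C_m = {σ₀, t_{2m-1↑2m+1} σ₀, t_{2m-1↑2m+1}² σ₀}`. -/
def IsRecursiveCodeSmall {n : ℕ} (s : ℕ → ℕ) (m : ℕ) (σ₀ : Perm (Fin n))
    (C : List (Perm (Fin n))) : Prop :=
  ∃ T : List ℕ, Stage s m [2 * m + 1, 2 * m + 1, 2 * m + 1] 1 T ∧ C = walk 1 σ₀ T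

/-- `σ₀` is the starting permutation for `n = kd`:
`σ₀(j) = d (j mod k) + ⌈j / k⌉` for all `j ∈ [n]`. -/
def IsStartPerm (k d : ℕ) (σ₀ : Perm (Fin (k * d))) : Prop :=
  ∀ p : Fin (k * d), (σ₀ p : ℕ) + 1 = d * (((p : ℕ) + 1) % k) + ((p : ℕ) + 1) ⌈/⌉ k

/-- The code `C` in `S_{kd}` is a code `C_1` of the main construction for `n = kd`. -/
def IsMainCode (k d : ℕ) (C : List (Perm (Fin (k * d)))) : Prop :=
  ∃ σ₀, IsStartPerm k d σ₀ ∧ IsRecursiveCode (fun _ => k) d σ₀ C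

/-- The congruence class of `i` modulo `d` in `[n]`. -/
def congClass (n d i : ℕ) : Finset ℕ := (Finset.Icc 1 n).filter fun x => x ≡ i [MOD d]

/-- The cardinality of the congruence class of `i` modulo `d` in `[n]`. -/
def classSize (n d i : ℕ) : ℕ := (congClass n d i).card

/-- `σ₀ = [R_1 | R_2 | … | R_d]` is a concatenation of the congruence classes modulo `d` of `[n]`,
each of them in an arbitrary order. -/
def IsConcatPerm (n d : ℕ) (σ₀ : Perm (Fin n)) : Prop :=
  ∀ m ∈ Finset.Icc 1 d, ∀ p : Fin n,
    offset (classSize n d) m < (p : ℕ) + 1 → (p : ℕ) + 1 ≤ offset (classSize n d) (m + 1) →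
      (σ₀ p : ℕ) + 1 ∈ congClass n d m

/-- `C` is a code `C_1` of the construction amended for general `n ≥ 2d`. -/
def IsGeneralCode (n d : ℕ) (C : List (Perm (Fin n))) : Prop :=
  ∃ σ₀, IsConcatPerm n d σ₀ ∧ IsRecursiveCode (classSize n d) d σ₀ C

/-- `C` is a code `C_1` of the construction amended for `d < n < 2d`. -/
def IsSmallCode (n d : ℕ) (C : List (Perm (Fin n))) : Prop :=
  ∃ σ₀, IsConcatPerm n d σ₀ ∧ IsRecursiveCodeSmall (classSize n d) (n % d) σ₀ C

/-!
The statement has two parts, which are independent of each other.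

*Distance.* Two different permutations have distance at least `d` as soon as there is a position
in which they have different entries that are congruent modulo `d` (`le_distInf`). Each block of
the starting permutation consists of entries that are congruent modulo `d`. Suppose that at level
`m + 1` the recursion has produced permutations of mutual distance at least `d`, which keep the
blocks `1, …, m` in place. At level `m` each such `τ` is replaced by all the `τ * w`, where `w`
runs through an auxiliary code on the positions of the block `m` and the position after it
(`trail_flatMap`, which rests on the fact that `t_{i↑j}` is `t_{k↑j}` followed by `t_{i↑k}`). If
`τ * w` and `τ' * w'` have distance less than `d`, then no position has two different entries of
block `m`, so that `w` and `w'` agree or differ by an exchange of the foreign entry with an entry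
of the block; the latter is what the auxiliary property forbids (`eq_of_distInf_lt`). Hence
`w = w'`, and the distance is that of `τ` and `τ'` (`IsSpreadWalk.step`).

*Existence.* The recursion can be carried out because complete sequences exist for all `k ≥ 2`
(`exists_isCompleteSeq`) and auxiliary sequences for all `k ≥ 3` (`exists_isAuxSeq`). Both are
obtained from circuits by joining cosets of a smaller symmetric or alternating group: if circuits
through several cosets contain edges `t_{↑a}` at suitable vectors, these edges can be replaced by
edges `t_{↑b}` with `b > a` that lead from one coset to the next and round again.

* Complete codes: the cosets of `S_k` in `S_{k+1}` are given by the last entry, and two of them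
  are joined at a vector `[…, p, q]` of the one and the vector `[…, q, p]` of the other.
* For odd `k` all pushes from odd indices are even permutations, so that a Hamiltonian circuit of
  the alternating group is an auxiliary code. Such a circuit for `k + 2` arises from one for `k`
  (`IsOddCircuit.exists_add_two`): the cosets are given by the pairs of the last two entries, six
  of them are joined at first, and then the cosets of `(q, r)`, `(p, q)`, `(r, p)` are joined at
  `[…, p, q, r]` and its rotations. The induction starts from an explicit circuit for `k = 7`. For
  `k = 5` there is an explicit circuit of `57` even permutations.
* For even `k = m + 1 ≥ 6` the circuit for `m` is copied into the cosets of vectors that are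
  permuted cyclically by `shift m`, and these copies are linked by single odd permutations
  (`exists_shift_path`). For `k = 4` a circuit of eight permutations is checked directly.
-/

/-! ### Pushes and block permutations -/

theorem pushCycle_apply {n i j : ℕ} (hi : 1 ≤ i) (hij : i < j) (hj : j ≤ n) (p : Fin n) :
    (pushCycle n i j p : ℕ) =
      if (p : ℕ) + 1 = i then j - 1
      else if i < (p : ℕ) + 1 ∧ (p : ℕ) + 1 ≤ j then (p : ℕ) - 1 else p := by
  have := push_apply hi hij hj 1 p
  simp only [push, one_mul] at this
  rw [this]
  split_ifs <;> rfl

/-- Pushing the entry with index `k` to index `i` may be done in two steps: first to an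
intermediate index `j`, then from there to `i`. -/
theorem pushCycle_mul_pushCycle {n i j k : ℕ} (hi : 1 ≤ i) (hij : i < j) (hjk : j < k)
    (hk : k ≤ n) : pushCycle n j k * pushCycle n i j = pushCycle n i k := by
  ext p
  have hp := p.2
  rw [Perm.mul_apply, pushCycle_apply (by omega) hjk hk, pushCycle_apply hi hij (by omega),
    pushCycle_apply hi (by omega) hk]
  split_ifs <;> omega

theorem push_push {n i j k : ℕ} (hi : 1 ≤ i) (hij : i < j) (hjk : j < k) (hk : k ≤ n)
    (σ : Perm (Fin n)) : push i j (push j k σ) = push i k σ := by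
  rw [push, push, push, mul_assoc, pushCycle_mul_pushCycle hi hij hjk hk]

theorem push_mul {n : ℕ} (i j : ℕ) (σ τ : Perm (Fin n)) : push i j (σ * τ) = σ * push i j τ :=
  mul_assoc _ _ _

/-- The `k` consecutive positions of a vector of length `n` that follow the first `o` ones. -/
def windowEquiv {n k o : ℕ} (h : o + k ≤ n) :
    Fin k ≃ {p : Fin n // o ≤ (p : ℕ) ∧ (p : ℕ) < o + k} where
  toFun p := ⟨⟨o + p, by omega⟩, by simp⟩
  invFun p := ⟨(p.1 : ℕ) - o, by have := p.2; omega⟩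
  left_inv p := by ext; simp
  right_inv p := by ext; have := p.2; simp; omega

/-- The permutations of `k` consecutive positions `o + 1, …, o + k`, as permutations of all the
positions `1, …, n`. -/
def window {n k o : ℕ} (h : o + k ≤ n) : Perm (Fin k) →* Perm (Fin n) :=
  Perm.extendDomainHom (windowEquiv h)

/-- The position in the whole vector of the `p`th position of a window. -/
def windowPos {n k o : ℕ} (h : o + k ≤ n) (p : Fin k) : Fin n := ⟨o + p, by omega⟩

@[simp]
theorem val_windowPos {n k o : ℕ} (h : o + k ≤ n) (p : Fin k) :
    (windowPos h p : ℕ) = o + p := rfl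

theorem windowPos_injective {n k o : ℕ} (h : o + k ≤ n) : Function.Injective (windowPos h) :=
  fun p q hpq => by simpa [windowPos, Fin.ext_iff] using hpq

theorem exists_windowPos {n k o : ℕ} (h : o + k ≤ n) {p : Fin n} (hp : o ≤ (p : ℕ))
    (hp' : (p : ℕ) < o + k) : ∃ q : Fin k, p = windowPos h q :=
  ⟨⟨p - o, by omega⟩, by ext; simp; omega⟩

@[simp]
theorem window_apply {n k o : ℕ} (h : o + k ≤ n) (w : Perm (Fin k)) (p : Fin k) :
    window h w (windowPos h p) = windowPos h (w p) :=
  Perm.extendDomain_apply_image w (windowEquiv h) p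

theorem window_apply_of_lt {n k o : ℕ} (h : o + k ≤ n) (w : Perm (Fin k)) {p : Fin n}
    (hp : (p : ℕ) < o) : window h w p = p :=
  Perm.extendDomain_apply_not_subtype w (windowEquiv h) (by omega)

theorem window_apply_of_ge {n k o : ℕ} (h : o + k ≤ n) (w : Perm (Fin k)) {p : Fin n}
    (hp : o + k ≤ (p : ℕ)) : window h w p = p :=
  Perm.extendDomain_apply_not_subtype w (windowEquiv h) (by omega)

theorem sign_window {n k o : ℕ} (h : o + k ≤ n) (w : Perm (Fin k)) :
    Perm.sign (window h w) = Perm.sign w :=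
  Perm.sign_extendDomain w (windowEquiv h)

theorem window_injective {n k o : ℕ} (h : o + k ≤ n) :
    Function.Injective (window (n := n) (k := k) (o := o) h) :=
  Perm.extendDomainHom_injective (windowEquiv h)

theorem window_pushCycle {n k o i j : ℕ} (h : o + k ≤ n) (hi : 1 ≤ i) (hij : i < j) (hj : j ≤ k) :
    window h (pushCycle k i j) = pushCycle n (o + i) (o + j) := by
  ext p
  rw [pushCycle_apply (by omega) (by omega) (by omega)]
  rcases Nat.lt_or_ge (p : ℕ) o with hp | hp
  · rw [window_apply_of_lt h _ hp]; split_ifs <;> omega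
  rcases Nat.lt_or_ge (p : ℕ) (o + k) with hp' | hp'
  · obtain ⟨q, rfl⟩ := exists_windowPos h hp hp'
    rw [window_apply h]
    have h1 : o + (q : ℕ) + 1 = o + i ↔ (q : ℕ) + 1 = i := by omega
    have h2 : o + i < o + (q : ℕ) + 1 ∧ o + (q : ℕ) + 1 ≤ o + j ↔
      i < (q : ℕ) + 1 ∧ (q : ℕ) + 1 ≤ j := by omega
    simp only [val_windowPos, pushCycle_apply hi hij hj, h1, h2]
    split_ifs <;> omega
  · rw [window_apply_of_ge h _ hp']; split_ifs <;> omega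

/-- Pushes inside a window are pushes of the vector of the entries in that window. -/
theorem push_mul_window {n k o i j : ℕ} (h : o + k ≤ n) (hi : 1 ≤ i) (hij : i < j) (hj : j ≤ k)
    (σ : Perm (Fin n)) (w : Perm (Fin k)) :
    push (o + i) (o + j) (σ * window h w) = σ * window h (push i j w) := by
  rw [push, push, map_mul, window_pushCycle h hi hij hj, mul_assoc]

theorem sign_pushCycle {n i j : ℕ} (hi : 1 ≤ i) (hij : i < j) (hj : j ≤ n) :
    Perm.sign (pushCycle n i j) = (-1) ^ (j - i) := by
  have : NeZero n := ⟨by omega⟩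
  rw [pushCycle, dif_pos ⟨hi, hij, hj⟩, Perm.sign_inv, Fin.sign_cycleIcc_of_le]
  · congr 1; simp only; omega
  · simp only [Fin.mk_le_mk]; omega

/-! ### Walks -/

/-- The permutations that a walk passes through after its start `σ`: the successors of the members
of `walk i σ js`. -/
def trail {n : ℕ} (i : ℕ) : Perm (Fin n) → List ℕ → List (Perm (Fin n))
  | _, [] => []
  | σ, j :: js => push i j σ :: trail i (push i j σ) js

/-- The permutation at which a walk ends. -/
def walkEnd {n : ℕ} (i : ℕ) (σ : Perm (Fin n)) (js : List ℕ) : Perm (Fin n) :=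
  js.foldl (fun τ j => push i j τ) σ

theorem walkEnd_cons {n : ℕ} (i : ℕ) (σ : Perm (Fin n)) (j : ℕ) (js : List ℕ) :
    walkEnd i σ (j :: js) = walkEnd i (push i j σ) js := rfl

theorem walkEnd_append {n : ℕ} (i : ℕ) (σ : Perm (Fin n)) (js ks : List ℕ) :
    walkEnd i σ (js ++ ks) = walkEnd i (walkEnd i σ js) ks := List.foldl_append

theorem trail_append {n : ℕ} (i : ℕ) (σ : Perm (Fin n)) (js ks : List ℕ) :
    trail i σ (js ++ ks) = trail i σ js ++ trail i (walkEnd i σ js) ks := by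
  induction js generalizing σ with
  | nil => rfl
  | cons j js ih => simp [trail, ih, walkEnd_cons]

theorem length_walk {n : ℕ} (i : ℕ) (σ : Perm (Fin n)) (js : List ℕ) :
    (walk i σ js).length = js.length := by
  induction js generalizing σ with
  | nil => rfl
  | cons j js ih => simp [walk, ih]

theorem walk_append_walkEnd {n : ℕ} (i : ℕ) (σ : Perm (Fin n)) (js : List ℕ) :
    walk i σ js ++ [walkEnd i σ js] = σ :: trail i σ js := by
  induction js generalizing σ with
  | nil => rfl
  | cons j js ih => simp [walk, trail, ← ih, walkEnd_cons]

theorem trail_perm_walk {n i : ℕ} {σ : Perm (Fin n)} {js : List ℕ} (h : walkEnd i σ js = σ) :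
    (trail i σ js).Perm (walk i σ js) := by
  have h1 := walk_append_walkEnd i σ js
  rw [h] at h1
  have h2 : (σ :: walk i σ js).Perm (σ :: trail i σ js) := by
    rw [← h1]; exact (List.perm_append_singleton _ _).symm
  exact (List.perm_cons _).1 h2.symm

theorem walk_mul {n : ℕ} (i : ℕ) (τ σ : Perm (Fin n)) (js : List ℕ) :
    walk i (τ * σ) js = (walk i σ js).map (τ * ·) := by
  induction js generalizing σ with
  | nil => rfl
  | cons j js ih => simp [walk, push_mul, ih]

theorem walkEnd_mul {n : ℕ} (i : ℕ) (τ σ : Perm (Fin n)) (js : List ℕ) :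
    walkEnd i (τ * σ) js = τ * walkEnd i σ js := by
  induction js generalizing σ with
  | nil => rfl
  | cons j js ih => rw [walkEnd_cons, walkEnd_cons, push_mul, ih]

theorem trail_mul_window {n k o : ℕ} (h : o + k ≤ n) (σ : Perm (Fin n)) (w : Perm (Fin k))
    {js : List ℕ} (hjs : ∀ j ∈ js, 1 < j ∧ j ≤ k) :
    trail (o + 1) (σ * window h w) (js.map fun x => o + x) =
      (trail 1 w js).map fun v => σ * window h v := by
  induction js generalizing w with
  | nil => rfl
  | cons j js ih =>
    have hj := hjs j (by simp)
    simp only [List.map_cons, trail, push_mul_window h le_rfl hj.1 hj.2,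
      ih _ fun x hx => hjs x (List.mem_cons_of_mem _ hx)]

theorem walkEnd_mul_window {n k o : ℕ} (h : o + k ≤ n) (σ : Perm (Fin n)) (w : Perm (Fin k))
    {js : List ℕ} (hjs : ∀ j ∈ js, 1 < j ∧ j ≤ k) :
    walkEnd (o + 1) (σ * window h w) (js.map fun x => o + x) = σ * window h (walkEnd 1 w js) := by
  induction js generalizing w with
  | nil => rfl
  | cons j js ih =>
    have hj := hjs j (by simp)
    simp only [List.map_cons, walkEnd_cons, push_mul_window h le_rfl hj.1 hj.2,
      ih _ fun x hx => hjs x (List.mem_cons_of_mem _ hx)]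

theorem walk_getElem_succ {n i : ℕ} (σ : Perm (Fin n)) (js : List ℕ) (r : ℕ)
    (h : r + 1 < (walk i σ js).length) :
    (walk i σ js)[r + 1] = push i (js[r]'(by rw [length_walk] at h; omega)) (walk i σ js)[r] := by
  induction js generalizing σ r with
  | nil => simp [walk] at h
  | cons j js ih =>
    cases r with
    | zero =>
      cases js with
      | nil => simp [walk] at h
      | cons j' js => simp [walk]
    | succ r => simpa [walk] using ih (push i j σ) r (by simpa [walk] using h)

theorem push_getLast_walk {n i : ℕ} (σ : Perm (Fin n)) (j : ℕ) (js : List ℕ)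
    (h : walk i σ (j :: js) ≠ []) :
    push i ((j :: js).getLast (by simp)) ((walk i σ (j :: js)).getLast h) =
      walkEnd i σ (j :: js) := by
  induction js generalizing σ j with
  | nil => simp [walk, walkEnd]
  | cons j' js ih =>
    rw [walkEnd_cons, ← ih (push i j σ) j' (by simp [walk])]
    simp [walk]

/-- A closed walk through distinct permutations is a cyclic code. -/
theorem isPushGrayCode_walk {n i : ℕ} {σ : Perm (Fin n)} {js : List ℕ} (hne : js ≠ [])
    (hjs : ∀ j ∈ js, i < j ∧ j ≤ n) (hend : walkEnd i σ js = σ) (hnd : (walk i σ js).Nodup) :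
    IsPushGrayCode i n js.length (walk i σ js) := by
  refine ⟨⟨⟨hnd, fun r h => ?_⟩, ?_⟩, length_walk _ _ _⟩
  · have hr : r < js.length := by rw [length_walk] at h; omega
    exact ⟨_, ⟨js[r], (hjs _ (List.getElem_mem hr)).1, (hjs _ (List.getElem_mem hr)).2, rfl⟩,
      walk_getElem_succ σ js r h⟩
  · cases js with
    | nil => exact absurd rfl hne
    | cons j js =>
      have hw : walk i σ (j :: js) ≠ [] := by simp [walk]
      have hm := hjs _ (List.getLast_mem (l := j :: js) (by simp))
      refine ⟨hw, _, ⟨_, hm.1, hm.2, rfl⟩, ?_⟩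
      rw [push_getLast_walk σ j js hw, hend]
      simp [walk]

/-! ### Distances -/

theorem distInf_comm {n : ℕ} (σ τ : Perm (Fin n)) : distInf σ τ = distInf τ σ := by
  unfold distInf
  congr 1
  funext j
  rw [← Int.natAbs_neg, neg_sub]

theorem distInf_self {n : ℕ} (σ : Perm (Fin n)) : distInf σ σ = 0 := by
  simp [distInf]

theorem le_distInf {n d : ℕ} {σ τ : Perm (Fin n)} {p : Fin n}
    (h : (σ p : ℕ) ≡ τ p [MOD d]) (hne : σ p ≠ τ p) : d ≤ distInf σ τ := by
  refine le_trans ?_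
    (Finset.le_sup (f := fun j => ((σ j : ℤ) - (τ j : ℤ)).natAbs) (Finset.mem_univ p))
  have hdvd : (d : ℤ) ∣ (σ p : ℤ) - τ p := (Nat.modEq_iff_dvd.1 h.symm)
  have h0 : (σ p : ℤ) - τ p ≠ 0 := by
    intro h0
    exact hne (Fin.ext (by omega))
  exact Nat.le_of_dvd (Int.natAbs_pos.2 h0) (Int.natCast_dvd.1 hdvd)

/-- Suppose that `τ` and `τ'` agree on a block, whose entries are congruent modulo `d`. If two
members of an auxiliary code, applied to that block and the entry after it, take `τ` and `τ'` to
vectors of distance less than `d`, then these two members are equal. Indeed all the entries of the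
block have the same place in both vectors unless they meet the foreign entry there; so either `w`
and `w'` agree, or they differ by the exchange of the foreign entry with an entry of the block. -/
theorem eq_of_distInf_lt {n s o d : ℕ} (h : o + (s + 1) ≤ n) {A : List (Perm (Fin (s + 1)))}
    (hA : ∀ σ ∈ A, ∀ q l : Fin (s + 1), (l : ℕ) + 1 = s + 1 → q < l → swap q l * σ ∉ A)
    {τ τ' : Perm (Fin n)} (hτ : ∀ p : Fin n, o ≤ (p : ℕ) → (p : ℕ) < o + s → τ p = τ' p)
    (hmod : ∀ p q : Fin n, o ≤ (p : ℕ) → (p : ℕ) < o + s → o ≤ (q : ℕ) → (q : ℕ) < o + s →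
      (τ p : ℕ) ≡ τ q [MOD d])
    {w w' : Perm (Fin (s + 1))} (hw : w ∈ A) (hw' : w' ∈ A)
    (hd : distInf (τ * window h w) (τ' * window h w') < d) : w = w' := by
  have hlt : ∀ p : Fin (s + 1), p ≠ Fin.last s → (p : ℕ) < s := fun p hp => by
    have : (p : ℕ) ≠ s := fun h => hp (Fin.ext h)
    omega
  have key : ∀ p, w p ≠ Fin.last s → w' p ≠ Fin.last s → w p = w' p := by
    intro p h1 h2
    by_contra hne
    have h1' := hlt _ h1
    have h2' := hlt _ h2
    have hp1 : (τ * window h w) (windowPos h p) = τ (windowPos h (w p)) := by simp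
    have hp2 : (τ' * window h w') (windowPos h p) = τ (windowPos h (w' p)) := by
      rw [hτ _ (by simp) (by simpa using h2')]; simp
    refine absurd hd (not_lt.2 (le_distInf (p := windowPos h p) ?_ ?_))
    · rw [hp1, hp2]
      exact hmod _ _ (by simp) (by simpa using h1') (by simp) (by simpa using h2')
    · rw [hp1, hp2]
      exact fun he => hne (windowPos_injective h (τ.injective he))
  obtain ⟨p, hp⟩ := w.surjective (Fin.last s)
  by_cases hp' : w' p = Fin.last s
  · ext x
    by_cases hx : x = p
    · rw [hx, hp, hp']
    · rw [key x (fun he => hx (w.injective (he.trans hp.symm)))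
        fun he => hx (w'.injective (he.trans hp'.symm))]
  · refine absurd ?_ (hA w hw (w' p) (Fin.last s) (by simp) (Fin.lt_last_iff_ne_last.2 hp'))
    convert hw' using 1
    ext x
    rw [Perm.mul_apply]
    congr 1
    by_cases hx : x = p
    · rw [hx, hp, swap_apply_right]
    have hwx : w x ≠ Fin.last s := fun he => hx (w.injective (he.trans hp.symm))
    by_cases hx' : w' x = Fin.last s
    · -- the entry of the block that `w'` puts where `w` has the foreign one
      obtain ⟨y, hy⟩ := w.surjective (w' p)
      have hyp : y ≠ p := by rintro rfl; exact hp' (hy.symm.trans hp)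
      have hyx : y = x := by
        by_contra hyx
        have hy' : w' y ≠ Fin.last s := fun he => hyx (w'.injective (he.trans hx'.symm))
        exact hyp (w'.injective ((key y (by rw [hy]; exact hp') hy').symm.trans hy))
      rw [← hyx, hy, swap_apply_left, hyx, hx']
    · rw [key x hwx hx', swap_apply_of_ne_of_ne (fun he => hx (w'.injective he)) hx']

/-- A closed walk from `σ₀` by pushes to the index `o + 1` which passes through permutations of
mutual distance at least `d`. -/
structure IsSpreadWalk {n : ℕ} (d o : ℕ) (σ₀ : Perm (Fin n)) (T : List ℕ) : Prop where
  index : ∀ j ∈ T, o + 1 < j ∧ j ≤ n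
  walkEnd_eq : walkEnd (o + 1) σ₀ T = σ₀
  pairwise : (trail (o + 1) σ₀ T).Pairwise fun σ τ => d ≤ distInf σ τ

theorem apply_of_mem_trail {n o : ℕ} {σ : Perm (Fin n)} {js : List ℕ}
    (hjs : ∀ j ∈ js, o + 1 < j ∧ j ≤ n) {p : Fin n} (hp : (p : ℕ) < o) :
    ∀ τ ∈ trail (o + 1) σ js, τ p = σ p := by
  induction js generalizing σ with
  | nil => simp [trail]
  | cons j js ih =>
    have hj := hjs j (by simp)
    have h1 : push (o + 1) j σ p = σ p := by
      rw [push_apply (by omega) hj.1 hj.2, if_neg (by omega), if_neg (by omega)]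
    intro τ hτ
    rcases List.mem_cons.1 hτ with rfl | hτ
    · exact h1
    · rw [ih (fun x hx => hjs x (List.mem_cons_of_mem _ hx)) τ hτ, h1]

/-- In the step of the recursion each member `τ` that the walk passes is replaced by all the
`τ * w`, where `w` runs through the auxiliary code. -/
theorem trail_flatMap {n o s : ℕ} (h : o + (s + 1) ≤ n) {T rest : List ℕ}
    (hT : ∀ j ∈ T, o + s + 1 < j ∧ j ≤ n)
    (haux : ∀ j ∈ (s + 1) :: rest, 1 < j ∧ j ≤ s + 1)
    (hend : walkEnd 1 (1 : Perm (Fin (s + 1))) ((s + 1) :: rest) = 1) (σ : Perm (Fin n)) :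
    trail (o + 1) σ (T.flatMap fun j => j :: rest.map fun x => o + x) =
        (trail (o + s + 1) σ T).flatMap (fun τ =>
          (trail 1 1 ((s + 1) :: rest)).map fun w => τ * window h w) ∧
      walkEnd (o + 1) σ (T.flatMap fun j => j :: rest.map fun x => o + x) =
        walkEnd (o + s + 1) σ T := by
  induction T generalizing σ with
  | nil => exact ⟨rfl, rfl⟩
  | cons j T ih =>
    have hj := hT j (by simp)
    have hs := haux (s + 1) (by simp)
    obtain ⟨ih1, ih2⟩ := ih (fun x hx => hT x (List.mem_cons_of_mem _ hx)) (push (o + s + 1) j σ)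
    have hpush : push (o + 1) j σ = push (o + 1) (o + s + 1) (push (o + s + 1) j σ) :=
      (push_push (by omega) (by omega) hj.1 hj.2 σ).symm
    have h1 : trail (o + 1) σ (j :: rest.map fun x => o + x) =
        (trail 1 1 ((s + 1) :: rest)).map fun w => push (o + s + 1) j σ * window h w := by
      rw [← trail_mul_window h _ _ haux, map_one, mul_one, List.map_cons, trail, trail, hpush,
        add_assoc]
    have h2 : walkEnd (o + 1) σ (j :: rest.map fun x => o + x) = push (o + s + 1) j σ := by
      have := walkEnd_mul_window h (push (o + s + 1) j σ) 1 haux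
      rw [map_one, mul_one, hend, map_one, mul_one, List.map_cons, walkEnd_cons, ← add_assoc,
        ← hpush] at this
      rw [walkEnd_cons, this]
    rw [List.flatMap_cons, trail_append, walkEnd_append, h1, h2, ih1, ih2]
    exact ⟨rfl, rfl⟩

theorem IsAuxSeq.exists_eq {k : ℕ} {aux : List ℕ} (h : IsAuxSeq k aux) :
    ∃ rest, aux = k :: rest ∧ aux.length = auxSize k ∧ (∀ j ∈ aux, 1 < j ∧ j ≤ k) ∧
      walkEnd 1 (1 : Perm (Fin k)) aux = 1 ∧ IsAuxCode k (auxSize k) (walk 1 1 aux) := by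
  obtain ⟨hk, C, hC, hcode, hjs, σ, rfl, hend⟩ := h
  cases aux with
  | nil => simp at hk
  | cons j rest =>
    obtain rfl : j = k := by simpa using hk
    obtain rfl : σ = 1 := by simpa [walk] using hC
    exact ⟨rest, rfl, by rw [← hcode.1.2, length_walk], hjs, hend, hcode⟩

theorem IsSpreadWalk.step {n d o s : ℕ} {σ₀ : Perm (Fin n)} {T aux : List ℕ}
    (hT : IsSpreadWalk d (o + s) σ₀ T) (h : o + (s + 1) ≤ n) (haux : IsAuxSeq (s + 1) aux)
    (hmod : ∀ p q : Fin n, o ≤ (p : ℕ) → (p : ℕ) < o + s → o ≤ (q : ℕ) → (q : ℕ) < o + s →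
      (σ₀ p : ℕ) ≡ σ₀ q [MOD d]) :
    IsSpreadWalk d o σ₀ (T.flatMap fun j => j :: aux.tail.map fun x => o + x) := by
  obtain ⟨rest, rfl, -, hjs, hend, hcode⟩ := haux.exists_eq
  obtain ⟨h1, h2⟩ := trail_flatMap h hT.index hjs hend σ₀
  have hperm := trail_perm_walk hend
  have hclose : ∀ τ ∈ trail (o + s + 1) σ₀ T, ∀ τ' ∈ trail (o + s + 1) σ₀ T,
      ∀ w ∈ trail 1 1 ((s + 1) :: rest), ∀ w' ∈ trail 1 1 ((s + 1) :: rest),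
      distInf (τ * window h w) (τ' * window h w') < d → w = w' := by
    intro τ hτ τ' hτ' w hw w' hw' hd
    have e := fun p hp => apply_of_mem_trail hT.index (p := p) hp τ hτ
    have e' := fun p hp => apply_of_mem_trail hT.index (p := p) hp τ' hτ'
    refine eq_of_distInf_lt h hcode.2 (fun p _ hp => (e p hp).trans (e' p hp).symm)
      (fun p q hp hp' hq hq' => ?_) (hperm.mem_iff.1 hw) (hperm.mem_iff.1 hw') hd
    rw [e p hp', e q hq']
    exact hmod p q hp hp' hq hq'
  refine ⟨?_, h2.trans hT.walkEnd_eq, ?_⟩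
  · intro j hj
    simp only [List.tail_cons, List.mem_flatMap, List.mem_cons, List.mem_map] at hj
    obtain ⟨i, hi, rfl | ⟨x, hx, rfl⟩⟩ := hj
    · have := hT.index j hi; omega
    · have := hjs x (List.mem_cons_of_mem _ hx); omega
  · rw [List.tail_cons, h1, List.pairwise_flatMap]
    constructor
    · intro τ hτ
      rw [List.pairwise_map]
      have hnd : (trail 1 1 ((s + 1) :: rest) : List (Perm (Fin (s + 1)))).Nodup :=
        hperm.nodup_iff.2 hcode.1.1.1.1
      refine hnd.imp_of_mem fun {w w'} hw hw' hne => ?_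
      by_contra hlt
      exact hne (hclose τ hτ τ hτ w hw w' hw' (not_le.1 hlt))
    · refine hT.pairwise.imp_of_mem fun {τ τ'} hτ hτ' hd x hx y hy => ?_
      obtain ⟨w, hw, rfl⟩ := List.mem_map.1 hx
      obtain ⟨w', hw', rfl⟩ := List.mem_map.1 hy
      by_contra hlt
      obtain rfl := hclose τ hτ τ' hτ' w hw w' hw' (not_le.1 hlt)
      refine hlt (hd.trans ?_)
      refine Finset.sup_le fun p _ => ?_
      refine le_trans (le_of_eq ?_) (Finset.le_sup (f := fun j =>
        (((τ * window h w) j : ℤ) - ((τ' * window h w) j : ℤ)).natAbs)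
        (Finset.mem_univ ((window h w)⁻¹ p)))
      simp

theorem offset_succ (s : ℕ → ℕ) {m : ℕ} (hm : 1 ≤ m) : offset s (m + 1) = offset s m + s m :=
  Finset.sum_Ico_succ_top hm s

theorem offset_one (s : ℕ → ℕ) : offset s 1 = 0 := by simp [offset]

theorem offset_mono (s : ℕ → ℕ) : Monotone (offset s) := fun _ _ h =>
  Finset.sum_le_sum_of_subset (Finset.Ico_subset_Ico le_rfl h)

theorem Stage.isSpreadWalk {n d b : ℕ} {s : ℕ → ℕ} {σ₀ : Perm (Fin n)} {T₀ : List ℕ}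
    (hb : offset s b < n)
    (hmod : ∀ m, 1 ≤ m → m < b → ∀ p q : Fin n, offset s m ≤ (p : ℕ) →
      (p : ℕ) < offset s (m + 1) → offset s m ≤ (q : ℕ) → (q : ℕ) < offset s (m + 1) →
      (σ₀ p : ℕ) ≡ σ₀ q [MOD d])
    (h₀ : IsSpreadWalk d (offset s b) σ₀ T₀) {m : ℕ} {T : List ℕ} (hT : Stage s b T₀ m T) :
    m ≤ b ∧ IsSpreadWalk d (offset s m) σ₀ T ∧
      T.length = T₀.length * ∏ i ∈ Finset.Ico m b, auxSize (s i + 1) := by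
  induction hT with
  | base => simpa using h₀
  | step m T aux hm _ haux ih =>
    obtain ⟨hmb, hw, hl⟩ := ih
    have ho := offset_succ s hm
    have hle := offset_mono s hmb
    refine ⟨by omega, ?_, ?_⟩
    · rw [ho] at hw
      refine hw.step (by omega) haux fun p q hp hp' hq hq' => ?_
      exact hmod m hm (by omega) p q hp (by omega) hq (by omega)
    · obtain ⟨rest, rfl, hlen, -⟩ := haux.exists_eq
      rw [Finset.prod_eq_prod_Ico_succ_bot (by omega : m < b), ← hlen]
      simp only [List.length_flatMap, List.tail_cons, List.length_cons, List.length_map,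
        List.map_const', List.sum_replicate, smul_eq_mul, hl]
      ring

/-- The codes `C_1` of the recursion have the distance and the size that is claimed, provided that
the recursion begins with a code of distance `d` and size `M`. -/
theorem Stage.isPushGrayLMRM {n d b : ℕ} {s : ℕ → ℕ} {σ₀ : Perm (Fin n)} {T₀ : List ℕ}
    (hd : 1 ≤ d) (hb : offset s b < n)
    (hmod : ∀ m, 1 ≤ m → m < b → ∀ p q : Fin n, offset s m ≤ (p : ℕ) →
      (p : ℕ) < offset s (m + 1) → offset s m ≤ (q : ℕ) → (q : ℕ) < offset s (m + 1) →
      (σ₀ p : ℕ) ≡ σ₀ q [MOD d])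
    (h₀ : IsSpreadWalk d (offset s b) σ₀ T₀) {T : List ℕ} (hT : Stage s b T₀ 1 T)
    (hne : 0 < T.length) :
    IsPushGrayLMRM 1 n (T₀.length * ∏ i ∈ Finset.Ico 1 b, auxSize (s i + 1)) d (walk 1 σ₀ T) := by
  obtain ⟨-, hw, hl⟩ := hT.isSpreadWalk hb hmod h₀
  rw [offset_one] at hw
  have hpw : (walk 1 σ₀ T).Pairwise fun σ τ => d ≤ distInf σ τ :=
    ((trail_perm_walk hw.walkEnd_eq).pairwise_iff
      (fun {σ τ} h => by rwa [distInf_comm])).1 hw.pairwise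
  have hnd : (walk 1 σ₀ T).Nodup := hpw.imp fun {σ τ} h he => by
    subst he; rw [distInf_self] at h; omega
  rw [← hl]
  refine ⟨isPushGrayCode_walk (List.ne_nil_of_length_pos hne) (by simpa using hw.index)
    hw.walkEnd_eq hnd, ?_, ?_⟩
  · have : {σ | σ ∈ walk 1 σ₀ T} = ((walk 1 σ₀ T).toFinset : Set (Perm (Fin n))) := by
      ext; simp
    rw [this, Set.ncard_coe_finset, List.toFinset_card_of_nodup hnd, length_walk]
  · intro σ hσ τ hτ hne
    have : Std.Symm fun σ τ : Perm (Fin n) => d ≤ distInf σ τ :=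
      ⟨fun σ τ h => by rwa [distInf_comm]⟩
    exact hpw.forall hσ hτ hne

/-- A complete code on the last block, which consists of entries that are congruent modulo `d`. -/
theorem IsCompleteSeq.isSpreadWalk {n d o k : ℕ} {σ₀ : Perm (Fin n)} {r : List ℕ}
    (hr : IsCompleteSeq k r) (h : o + k ≤ n)
    (hmod : ∀ p q : Fin n, o ≤ (p : ℕ) → (p : ℕ) < o + k → o ≤ (q : ℕ) → (q : ℕ) < o + k →
      (σ₀ p : ℕ) ≡ σ₀ q [MOD d]) :
    IsSpreadWalk d o σ₀ (r.map fun x => o + x) ∧ r.length = k ! := by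
  obtain ⟨C, hC, hjs, σ, rfl, hend⟩ := hr
  have hend1 : walkEnd 1 (1 : Perm (Fin k)) r = 1 := by
    have := walkEnd_mul 1 σ 1 r
    rw [mul_one] at this
    exact mul_left_cancel (a := σ) (by rw [← this, mul_one]; exact hend)
  have hnd : (trail 1 (1 : Perm (Fin k)) r).Nodup := by
    rw [(trail_perm_walk hend1).nodup_iff]
    have := hC.1.1.1
    rw [← mul_one σ, walk_mul] at this
    exact this.of_map _
  have h1 := trail_mul_window h σ₀ 1 hjs
  have h2 := walkEnd_mul_window h σ₀ 1 hjs
  rw [map_one, mul_one] at h1 h2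
  rw [hend1, map_one, mul_one] at h2
  refine ⟨⟨?_, h2, ?_⟩, by rw [← hC.2, length_walk]⟩
  · intro j hj
    obtain ⟨x, hx, rfl⟩ := List.mem_map.1 hj
    have := hjs x hx
    omega
  · rw [h1, List.pairwise_map]
    refine hnd.imp fun {w w'} hne => ?_
    obtain ⟨p, hp⟩ : ∃ p, w p ≠ w' p := by
      by_contra hall
      push Not at hall
      exact hne (Equiv.ext hall)
    refine le_distInf (p := windowPos h p) ?_ ?_
    · simp only [Perm.mul_apply, window_apply]
      exact hmod _ _ (by simp) (by simp) (by simp) (by simp)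
    · simp only [Perm.mul_apply, window_apply]
      exact fun he => hp (windowPos_injective h (σ₀.injective he))

/-! ### Paths and circuits -/

/-- `L` is a path of the relation `r` from `y` to `x` through distinct elements. -/
structure IsPath {α : Type*} (r : α → α → Prop) (L : List α) (y x : α) : Prop where
  head : L.head? = some y
  last : L.getLast? = some x
  chain : L.IsChain r
  nodup : L.Nodup

/-- `L` is a circuit of the relation `r` through distinct elements. -/
def IsCircuit {α : Type*} (r : α → α → Prop) (L : List α) : Prop :=
  ∃ y x, IsPath r L y x ∧ r x y

/-- In the cyclic list `L` the element `v` comes next after `u`. -/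
def HasEdge {α : Type*} (L : List α) (u v : α) : Prop :=
  ∃ L', L ~r L' ∧ L'.head? = some v ∧ L'.getLast? = some u

theorem IsPath.append {α : Type*} {r : α → α → Prop} {A B : List α} {y x y' x' : α}
    (hA : IsPath r A y x) (hB : IsPath r B y' x') (h : r x y') (hd : ∀ z ∈ A, z ∉ B) :
    IsPath r (A ++ B) y x' where
  head := by simp [hA.head]
  last := by simp [hB.last]
  chain := List.isChain_append.2 ⟨hA.chain, hB.chain, by simp [hA.last, hB.head, h]⟩
  nodup := List.nodup_append'.2 ⟨hA.nodup, hB.nodup, fun z hz hz' => hd z hz hz'⟩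

theorem IsPath.mono {α : Type*} {r r' : α → α → Prop} {L : List α} {y x : α}
    (h : IsPath r L y x) (hr : ∀ u v, r u v → r' u v) : IsPath r' L y x :=
  ⟨h.head, h.last, h.chain.imp hr, h.nodup⟩

theorem IsPath.map {α β : Type*} {r : α → α → Prop} {r' : β → β → Prop} {L : List α} {y x : α}
    (h : IsPath r L y x) {f : α → β} (hf : Function.Injective f)
    (hr : ∀ u v, r u v → r' (f u) (f v)) : IsPath r' (L.map f) (f y) (f x) where
  head := by simp [h.head]
  last := by simp [h.last]
  chain := (List.isChain_map f).2 (h.chain.imp hr)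
  nodup := h.nodup.map hf

theorem IsCircuit.nodup {α : Type*} {r : α → α → Prop} {L : List α} (h : IsCircuit r L) :
    L.Nodup := by
  obtain ⟨y, x, h, -⟩ := h
  exact h.nodup

theorem isRotated_iff_append {α : Type*} {L L' : List α} :
    L ~r L' ↔ ∃ A B, L = A ++ B ∧ L' = B ++ A := by
  constructor
  · rw [List.isRotated_iff_mod]
    rintro ⟨n, hn, rfl⟩
    exact ⟨L.take n, L.drop n, (List.take_append_drop n L).symm,
      List.rotate_eq_drop_append_take hn⟩
  · rintro ⟨A, B, rfl, rfl⟩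
    exact List.isRotated_append

theorem IsCircuit.isRotated {α : Type*} {r : α → α → Prop} {L L' : List α} (h : IsCircuit r L)
    (hL : L ~r L') : IsCircuit r L' := by
  obtain ⟨y, x, hp, hr⟩ := h
  obtain ⟨A, B, rfl, rfl⟩ := isRotated_iff_append.1 hL
  rcases eq_or_ne A [] with rfl | hA
  · exact ⟨y, x, by simpa using hp, hr⟩
  rcases eq_or_ne B [] with rfl | hB
  · exact ⟨y, x, by simpa using hp, hr⟩
  obtain ⟨h1, h2, h3⟩ := List.isChain_append.1 hp.chain
  have e1 := hp.head
  have e2 := hp.last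
  rw [List.head?_append_of_ne_nil _ hA] at e1
  rw [List.getLast?_append_of_ne_nil _ hB] at e2
  have e3 := List.getLast?_eq_some_getLast hA
  have e4 := List.head?_eq_some_head hB
  refine ⟨B.head hB, A.getLast hA, ⟨?_, ?_, List.isChain_append.2 ⟨h2, h1, ?_⟩, ?_⟩, ?_⟩
  · rw [List.head?_append_of_ne_nil _ hB, e4]
  · rw [List.getLast?_append_of_ne_nil _ hA, e3]
  · rw [e1, e2]
    intro u hu v hv
    obtain rfl : x = u := by simpa using hu
    obtain rfl : y = v := by simpa using hv
    exact hr
  · exact (List.perm_append_comm.nodup_iff).1 hp.nodup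
  · exact h3 _ e3 _ e4

/-- A circuit may be cut open at each of its edges. -/
theorem IsCircuit.exists_isPath {α : Type*} {r : α → α → Prop} {L : List α} (h : IsCircuit r L)
    {u v : α} (huv : HasEdge L u v) : r u v ∧ ∃ L', L ~r L' ∧ IsPath r L' v u := by
  obtain ⟨L', hL, h1, h2⟩ := huv
  obtain ⟨y, x, hp, hr⟩ := h.isRotated hL
  obtain rfl : y = v := by have := hp.head; rw [h1] at this; simpa using this.symm
  obtain rfl : x = u := by have := hp.last; rw [h2] at this; simpa using this.symm
  exact ⟨hr, L', hL, hp⟩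

theorem HasEdge.isRotated {α : Type*} {L L' : List α} {u v : α} (h : HasEdge L u v)
    (hL : L ~r L') : HasEdge L' u v := by
  obtain ⟨M, hM, h1⟩ := h
  exact ⟨M, hL.symm.trans hM, h1⟩

theorem hasEdge_of_infix {α : Type*} {L : List α} {u v : α} (h : [u, v] <:+: L) :
    HasEdge L u v := by
  obtain ⟨A, B, rfl⟩ := h
  refine ⟨([v] ++ B) ++ (A ++ [u]), ?_, by simp, by rw [List.getLast?_append]; simp⟩
  rw [isRotated_iff_append]
  exact ⟨A ++ [u], [v] ++ B, by simp, rfl⟩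

theorem HasEdge.mem_left {α : Type*} {L : List α} {u v : α} (h : HasEdge L u v) : u ∈ L := by
  obtain ⟨M, hM, -, h2⟩ := h
  exact hM.mem_iff.2 (List.mem_of_getLast? h2)

theorem HasEdge.infix {α : Type*} {r : α → α → Prop} {L : List α} {y x u v : α}
    (hp : IsPath r L y x) (h : HasEdge L u v) (hne : u ≠ x) : [u, v] <:+: L := by
  obtain ⟨M, hM, h1, h2⟩ := h
  obtain ⟨A, B, rfl, rfl⟩ := isRotated_iff_append.1 hM
  rcases List.eq_nil_or_concat A with rfl | ⟨A, a, rfl⟩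
  · have := hp.last
    simp only [List.append_nil, List.nil_append] at h2 this
    rw [h2] at this
    exact absurd (by simpa using this) hne
  rcases B with _ | ⟨b, B⟩
  · have := hp.last
    simp only [List.append_nil, List.nil_append] at h2 this
    rw [h2] at this
    exact absurd (by simpa using this) hne
  obtain rfl : b = v := by simpa using h1
  obtain rfl : a = u := by rw [List.getLast?_append] at h2; simpa using h2
  exact ⟨A, B, by simp⟩

theorem exists_infix_of_not {α : Type*} (Q : α → Prop) {L : List α} {x : α}
    (hx : L.head? = some x) (hQ : Q x) (h : ∃ y ∈ L, ¬ Q y) :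
    ∃ u v, [u, v] <:+: L ∧ Q u ∧ ¬ Q v := by
  induction L generalizing x with
  | nil => simp at hx
  | cons a L ih =>
    obtain rfl : a = x := by simpa using hx
    obtain ⟨y, hy, hyQ⟩ := h
    rcases List.mem_cons.1 hy with rfl | hy
    · exact absurd hQ hyQ
    cases L with
    | nil => simp at hy
    | cons b L =>
      by_cases hb : Q b
      · obtain ⟨u, v, huv, h1⟩ := ih (x := b) (by simp) hb ⟨y, hy, hyQ⟩
        exact ⟨u, v, huv.trans (List.infix_cons List.infix_rfl), h1⟩
      · exact ⟨a, b, ⟨[], L, by simp⟩, hQ, hb⟩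

/-- A circuit on which the property `Q` is not constant leaves `Q` through some edge. -/
theorem exists_hasEdge_of_not {α : Type*} (Q : α → Prop) {L : List α} {x y : α}
    (hx : x ∈ L) (hy : y ∈ L) (hQ : Q x) (hQ' : ¬ Q y) : ∃ u v, HasEdge L u v ∧ Q u ∧ ¬ Q v := by
  obtain ⟨A, B, rfl⟩ := List.append_of_mem hx
  have hrot : (A ++ x :: B) ~r ((x :: B) ++ A) := List.isRotated_append
  obtain ⟨u, v, huv, h⟩ := exists_infix_of_not Q (L := (x :: B) ++ A) (by simp) hQ
    ⟨y, hrot.mem_iff.1 hy, hQ'⟩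
  exact ⟨u, v, (hasEdge_of_infix huv).isRotated hrot.symm, h⟩

/-! ### Circuits of pushes -/

/-- `τ` is obtained from `σ` by a push to the first index, `t_{↑j}`, with `j` in `J`. -/
def IsPush {n : ℕ} (J : Set ℕ) (σ τ : Perm (Fin n)) : Prop :=
  ∃ j ∈ J, 1 < j ∧ j ≤ n ∧ τ = push 1 j σ

theorem isPush_push {n j : ℕ} {J : Set ℕ} (hj : j ∈ J) (h1 : 1 < j) (hn : j ≤ n)
    (σ : Perm (Fin n)) : IsPush J σ (push 1 j σ) := ⟨j, hj, h1, hn, rfl⟩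

theorem IsPush.mono {n : ℕ} {J J' : Set ℕ} (h : J ⊆ J') {σ τ : Perm (Fin n)}
    (hp : IsPush J σ τ) : IsPush J' σ τ := by
  obtain ⟨j, hj, h1⟩ := hp
  exact ⟨j, h hj, h1⟩

theorem push_mul_window_zero {m n j : ℕ} (h : 0 + m ≤ n) (h1 : 1 < j) (hj : j ≤ m)
    (σ : Perm (Fin n)) (w : Perm (Fin m)) :
    push 1 j (σ * window h w) = σ * window h (push 1 j w) := by
  have := push_mul_window h le_rfl h1 hj σ w
  rwa [zero_add, zero_add] at this

theorem IsPush.mul_window {m n : ℕ} (h : 0 + m ≤ n) {J : Set ℕ} (g : Perm (Fin n))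
    {v w : Perm (Fin m)} (hp : IsPush J v w) : IsPush J (g * window h v) (g * window h w) := by
  obtain ⟨j, hj, h1, h2, rfl⟩ := hp
  exact ⟨j, hj, h1, by omega, (push_mul_window_zero h h1 h2 g v).symm⟩

/-- A circuit `H` in `S_m` gives a path through the vectors of length `n` whose first `m` entries
are permuted by `H`. It is cut open at `x`, which corresponds to the member `w₀` of `H`. -/
theorem exists_coset_path {m n j : ℕ} (h : 0 + m ≤ n) {J : Set ℕ} {H : List (Perm (Fin m))}
    (hH : IsCircuit (IsPush J) H) {w₀ : Perm (Fin m)} (h1 : 1 < j) (hj : j ≤ m)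
    (hw₀ : HasEdge H w₀ (push 1 j w₀)) (x : Perm (Fin n)) :
    ∃ L, IsPath (IsPush J) L (push 1 j x) x ∧ L.length = H.length ∧
      (∀ σ, σ ∈ L ↔ ∃ w ∈ H, σ = x * window h (w₀⁻¹ * w)) ∧
      ∀ w i, 1 < i → i ≤ m → w ≠ w₀ → HasEdge H w (push 1 i w) →
        [x * window h (w₀⁻¹ * w), push 1 i (x * window h (w₀⁻¹ * w))] <:+: L := by
  obtain ⟨-, H', hrot, hpath⟩ := hH.exists_isPath hw₀
  have hf : ∀ w, x * window h (w₀⁻¹ * w) = (x * window h w₀⁻¹) * window h w := fun w => by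
    rw [map_mul, mul_assoc]
  have hinj : Function.Injective fun w => x * window h (w₀⁻¹ * w) := fun v w hvw =>
    mul_left_cancel (window_injective h (mul_left_cancel hvw))
  refine ⟨H'.map fun w => x * window h (w₀⁻¹ * w), ?_, ?_, ?_, ?_⟩
  · have := hpath.map (r' := IsPush J) hinj fun u v huv => by
      simp only [hf]; exact huv.mul_window h _
    convert this using 1
    · rw [← push_mul, ← push_mul_window_zero h h1 hj, inv_mul_cancel, map_one, mul_one]
    · simp
  · rw [List.length_map]; exact hrot.perm.length_eq.symm
  · intro σ
    simp only [List.mem_map, hrot.mem_iff, eq_comm]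
  · intro w i hi hi' hne hw
    have := ((hw.isRotated hrot).infix hpath hne).map fun w => x * window h (w₀⁻¹ * w)
    rwa [List.map_cons, List.map_cons, List.map_nil, ← push_mul,
      ← push_mul_window_zero h hi hi'] at this

theorem push_apply_last {m j : ℕ} (h1 : 1 < j) (hj : j < m) (σ : Perm (Fin m)) {p : Fin m}
    (hp : (p : ℕ) + 1 = m) : push 1 j σ p = σ p := by
  rw [push_apply le_rfl h1 hj.le, if_neg (by omega), if_neg (by omega)]

/-- An entry gets away from the last position only through the transition `t_{↑m}`. -/
theorem exists_hasEdge_last {m : ℕ} {J : Set ℕ} {H : List (Perm (Fin m))}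
    (hH : IsCircuit (IsPush J) H) {l : Fin m} (hl : (l : ℕ) + 1 = m) {σ τ : Perm (Fin m)}
    (hσ : σ ∈ H) (hτ : τ ∈ H) (hne : τ l ≠ σ l) :
    ∃ w, HasEdge H w (push 1 m w) ∧ w l = σ l := by
  obtain ⟨u, v, huv, hu, hv⟩ := exists_hasEdge_of_not (fun w : Perm (Fin m) => w l = σ l)
    hσ hτ rfl hne
  obtain ⟨j, -, h1, hj, rfl⟩ := (hH.exists_isPath huv).1
  rcases hj.lt_or_eq with hlt | rfl
  · rw [push_apply_last h1 hlt u hl] at hv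
    exact absurd hu hv
  · exact ⟨u, huv, hu⟩

/-- A path of pushes is a walk. -/
theorem IsPath.exists_walk {n : ℕ} {J : Set ℕ} {L : List (Perm (Fin n))} {y x z : Perm (Fin n)}
    (hp : IsPath (IsPush J) L y x) (hz : IsPush J x z) :
    ∃ js : List ℕ, L = walk 1 y js ∧ walkEnd 1 y js = z ∧ ∀ j ∈ js, 1 < j ∧ j ≤ n := by
  induction L generalizing y with
  | nil => have := hp.head; simp at this
  | cons a L ih =>
    obtain rfl : a = y := by have := hp.head; simpa using this
    cases L with
    | nil =>
      obtain rfl : a = x := by have := hp.last; simpa using this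
      obtain ⟨j, -, h1, h2, rfl⟩ := hz
      exact ⟨[j], rfl, rfl, by simp [h1, h2]⟩
    | cons b L =>
      obtain ⟨h1, h2⟩ := List.isChain_cons_cons.1 hp.chain
      obtain ⟨js, hjs, hend, hmem⟩ := ih (y := b) ⟨by simp, by simpa using hp.last, h2,
        (List.nodup_cons.1 hp.nodup).2⟩
      obtain ⟨j, -, hj1, hj2, rfl⟩ := h1
      refine ⟨j :: js, by rw [walk, hjs], by rw [walkEnd_cons, hend], ?_⟩
      simp only [List.mem_cons, forall_eq_or_imp]
      exact ⟨⟨hj1, hj2⟩, hmem⟩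

/-- A circuit with an edge `t_{↑j}` is, up to its start and a relabelling of the symbols, generated
by a transition sequence that begins with `t_{↑j}` at the identity. -/
theorem IsCircuit.exists_generates {n j : ℕ} {J : Set ℕ} {L : List (Perm (Fin n))}
    (hL : IsCircuit (IsPush J) L) (h1 : 1 < j) (hj : j ≤ n) {x : Perm (Fin n)}
    (hx : HasEdge L x (push 1 j x)) :
    ∃ js, js.length = L.length ∧ js.head? = some j ∧ (∀ i ∈ js, 1 < i ∧ i ≤ n) ∧
      walkEnd 1 (1 : Perm (Fin n)) js = 1 ∧ (walk 1 (1 : Perm (Fin n)) js).Nodup ∧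
      ∀ w ∈ walk 1 (1 : Perm (Fin n)) js, x * w ∈ L := by
  obtain ⟨-, L', hrot, hp⟩ := hL.exists_isPath hx
  suffices ∃ js : List ℕ, js.head? = some j ∧ (∀ i ∈ js, 1 < i ∧ i ≤ n) ∧ walkEnd 1 x js = x ∧
      (walk 1 x js).Perm L' by
    obtain ⟨js, hjs, hmem, hend, hperm⟩ := this
    have hperm' := hperm.trans hrot.symm.perm
    have hw := walk_mul 1 x 1 js
    rw [mul_one] at hw
    refine ⟨js, by rw [← hperm'.length_eq, length_walk], hjs, hmem, ?_, ?_, ?_⟩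
    · have := walkEnd_mul 1 x 1 js
      rw [mul_one, hend] at this
      exact mul_left_cancel (a := x) (by rw [← this, mul_one])
    · have := hperm.nodup_iff.2 hp.nodup
      rw [hw] at this
      exact this.of_map _
    · intro w hwm
      rw [← hperm'.mem_iff, hw]
      exact List.mem_map_of_mem hwm
  rcases List.eq_nil_or_concat L' with rfl | ⟨A, a, rfl⟩
  · have := hp.head; simp at this
  rw [List.concat_eq_append] at hp ⊢
  obtain rfl : a = x := by have := hp.last; simpa using this
  rcases eq_or_ne A [] with rfl | hA
  · have : a = push 1 j a := by have := hp.head; simpa using this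
    exact ⟨[j], rfl, by simp [h1, hj], this.symm, by simp [walk]⟩
  · have e1 := hp.head
    rw [List.head?_append_of_ne_nil _ hA] at e1
    obtain ⟨h2, -, h3⟩ := List.isChain_append.1 hp.chain
    have e3 := List.getLast?_eq_some_getLast hA
    obtain ⟨js, hjs, hend, hmem⟩ := IsPath.exists_walk (z := a)
      ⟨e1, e3, h2, (List.nodup_append'.1 hp.nodup).1⟩ (h3 _ e3 a (by simp))
    refine ⟨j :: js, rfl, ?_, by rw [walkEnd_cons, hend], ?_⟩
    · simp only [List.mem_cons, forall_eq_or_imp]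
      exact ⟨⟨h1, hj⟩, hmem⟩
    · rw [walk, ← hjs]
      exact (List.perm_append_singleton _ _).symm

/-- A permutation that fixes all positions outside a window comes from that window. -/
theorem exists_window_eq {n k o : ℕ} (h : o + k ≤ n) {σ : Perm (Fin n)}
    (h1 : ∀ p : Fin n, (p : ℕ) < o → σ p = p) (h2 : ∀ p : Fin n, o + k ≤ (p : ℕ) → σ p = p) :
    ∃ w, window h w = σ := by
  have hfix : ∀ p : Fin n, σ p ≠ p → o ≤ (p : ℕ) ∧ (p : ℕ) < o + k := by
    intro p hp
    by_contra hc
    rcases Nat.lt_or_ge (p : ℕ) o with h3 | h3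
    · exact hp (h1 p h3)
    · exact hp (h2 p (by omega))
  have hiff : ∀ p : Fin n,
      (o ≤ (σ p : ℕ) ∧ (σ p : ℕ) < o + k) ↔ (o ≤ (p : ℕ) ∧ (p : ℕ) < o + k) := by
    intro p
    by_cases hp : σ p = p
    · rw [hp]
    · exact iff_of_true (hfix _ fun he => hp (σ.injective he)) (hfix _ hp)
  refine ⟨(windowEquiv h).permCongr.symm (σ.subtypePerm hiff), ?_⟩
  have : window h ((windowEquiv h).permCongr.symm (σ.subtypePerm hiff)) =
      Perm.ofSubtype ((windowEquiv h).permCongr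
        ((windowEquiv h).permCongr.symm (σ.subtypePerm hiff))) := rfl
  rw [this, Equiv.apply_symm_apply, Perm.ofSubtype_subtypePerm]
  exact fun p hp => hfix p hp

theorem exists_mul_window_eq_iff {m n : ℕ} (h : 0 + m ≤ n) {σ x : Perm (Fin n)} :
    (∃ w, σ = x * window h w) ↔ ∀ p : Fin n, m ≤ (p : ℕ) → σ p = x p := by
  constructor
  · rintro ⟨w, rfl⟩ p hp
    rw [Perm.mul_apply, window_apply_of_ge h w (by omega)]
  · intro hσ
    obtain ⟨w, hw⟩ := exists_window_eq h (σ := x⁻¹ * σ) (fun p hp => absurd hp (by omega))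
      fun p hp => by rw [Perm.mul_apply, hσ p (by omega), Perm.inv_def, symm_apply_apply]
    exact ⟨w, by rw [hw, mul_inv_cancel_left]⟩

/-! ### Complete codes -/

theorem push_push_adjacent {n k : ℕ} (hk : 1 ≤ k) (hn : k + 1 ≤ n) (σ : Perm (Fin n)) :
    push k (k + 1) (push k (k + 1) σ) = σ := by
  ext p
  rw [push_apply hk (by omega) hn, push_apply hk (by omega) hn, push_apply hk (by omega) hn,
    push_apply hk (by omega) hn]
  simp only
  split_ifs <;> first | omega | (congr 2; ext; simp only; omega)

/-- The coset of the vectors with the last entry of `y`, cut open at `y`. Each entry other than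
the one that `y` pushes is pushed by some edge `t_{↑k}` that remains. -/
theorem exists_last_coset_path {k : ℕ} (hk : 2 ≤ k) {H : List (Perm (Fin k))}
    (hH : IsCircuit (IsPush Set.univ) H) (hall : ∀ w, w ∈ H) (y : Perm (Fin (k + 1))) :
    ∃ L, IsPath (IsPush Set.univ) L (push 1 k y) y ∧
      (∀ σ, σ ∈ L ↔ σ (Fin.last k) = y (Fin.last k)) ∧
      ∀ v, v ≠ y (Fin.last k) → v ≠ y ⟨k - 1, by omega⟩ →
        ∃ x, [x, push 1 k x] <:+: L ∧ x (Fin.last k) = y (Fin.last k) ∧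
          x ⟨k - 1, by omega⟩ = v := by
  have h : 0 + k ≤ k + 1 := by omega
  -- the last position in `S_k`
  let l : Fin k := ⟨k - 1, by omega⟩
  have hl : windowPos h l = ⟨k - 1, by omega⟩ := by ext; simp [l]
  have hedge : ∀ p : Fin k, ∃ w, HasEdge H w (push 1 k w) ∧ w l = p := by
    intro p
    obtain ⟨q, hq⟩ : ∃ q : Fin k, q ≠ p := by
      have : Nontrivial (Fin k) := Fin.nontrivial_iff_two_le.2 hk
      exact exists_ne p
    obtain ⟨w, hw, hwl⟩ := exists_hasEdge_last hH (l := l) (by simp [l]; omega)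
      (hall (swap l p)) (hall (swap l q)) (by simpa using hq)
    exact ⟨w, hw, by simpa using hwl⟩
  obtain ⟨w₀, hw₀, -⟩ := hedge l
  obtain ⟨L, hL, -, hmem, hinf⟩ := exists_coset_path h hH (by omega) le_rfl hw₀ y
  refine ⟨L, hL, fun σ => ?_, fun v hv hv' => ?_⟩
  · rw [hmem]
    have h1 : (∃ w ∈ H, σ = y * window h (w₀⁻¹ * w)) ↔ ∃ w, σ = y * window h w :=
      ⟨fun ⟨w, _, hw⟩ => ⟨_, hw⟩, fun ⟨w, hw⟩ => ⟨w₀ * w, hall _, by simpa using hw⟩⟩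
    rw [h1, exists_mul_window_eq_iff]
    refine ⟨fun h2 => h2 _ (by simp), fun h2 p hp => ?_⟩
    obtain rfl : p = Fin.last k := Fin.ext (by simp; omega)
    exact h2
  · have hpos : ((y⁻¹ v : Fin (k + 1)) : ℕ) < 0 + k := by
      have : y⁻¹ v ≠ Fin.last k := fun he => hv (by rw [← he, Perm.inv_def, apply_symm_apply])
      have h2 : ((y⁻¹ v : Fin (k + 1)) : ℕ) ≠ k := fun he => this (Fin.ext he)
      omega
    obtain ⟨p, hp⟩ := exists_windowPos h (Nat.zero_le _) hpos
    obtain ⟨w, hw, hwl⟩ := hedge (w₀ p)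
    have hxl : (y * window h (w₀⁻¹ * w)) ⟨k - 1, by omega⟩ = v := by
      rw [← hl, Perm.mul_apply, window_apply, Perm.mul_apply, hwl, Perm.inv_def,
        symm_apply_apply, ← hp, Perm.inv_def, apply_symm_apply]
    refine ⟨_, hinf w k (by omega) le_rfl ?_ hw, ?_, hxl⟩
    · rintro rfl
      rw [inv_mul_cancel, map_one, mul_one] at hxl
      exact hv' hxl.symm
    · rw [Perm.mul_apply, window_apply_of_ge h _ (by simp)]

/-- One more last entry is added to a circuit through the vectors whose last entry is at most
`m + 1`. The cosets of the vectors `[…, m + 1, m]` and `[…, m, m + 1]` are joined by replacing one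
edge `t_{↑k}` in each of them by `t_{↑k+1}`. -/
theorem exists_circuit_last_le {k : ℕ} (hk : 2 ≤ k) {H : List (Perm (Fin k))}
    (hH : IsCircuit (IsPush Set.univ) H) (hall : ∀ w, w ∈ H) (m : ℕ) (hm : m ≤ k) :
    ∃ L : List (Perm (Fin (k + 1))), IsCircuit (IsPush Set.univ) L ∧
      (∀ σ, σ ∈ L ↔ (σ (Fin.last k) : ℕ) ≤ m) ∧
      (m < k → ∃ x, HasEdge L x (push 1 k x) ∧ (x (Fin.last k) : ℕ) = m ∧
        (x ⟨k - 1, by omega⟩ : ℕ) = m + 1) := by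
  have hcoset := exists_last_coset_path hk hH hall
  induction m with
  | zero =>
    obtain ⟨y, hy⟩ : ∃ y : Perm (Fin (k + 1)), y (Fin.last k) = 0 ∧ y ⟨k - 1, by omega⟩ ≠ 1 := by
      refine ⟨finRotate (k + 1), finRotate_last, ?_⟩
      rw [finRotate_of_lt (by omega : k - 1 < k), Ne, Fin.ext_iff, Fin.val_one',
        Nat.mod_eq_of_lt (by omega : 1 < k + 1)]
      simp only
      omega
    obtain ⟨L, hL, hmem, hinf⟩ := hcoset y
    refine ⟨L, ⟨_, _, hL, isPush_push (Set.mem_univ _) (by omega) (by omega) y⟩, fun σ => ?_,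
      fun hm => ?_⟩
    · rw [hmem, hy.1, Fin.ext_iff]; simp
    · obtain ⟨x, hx, hx1, hx2⟩ := hinf 1 (by rw [hy.1]; simp [Fin.ext_iff]; omega) hy.2.symm
      refine ⟨x, hasEdge_of_infix hx, by rw [hx1, hy.1]; simp, ?_⟩
      rw [hx2]; simp [Nat.mod_eq_of_lt (by omega : 1 < k + 1)]
  | succ m ih =>
    obtain ⟨L, hL, hmem, hx⟩ := ih (by omega)
    obtain ⟨x, hx, hx1, hx2⟩ := hx (show m < k by omega)
    obtain ⟨-, L₁, hrot, hL₁⟩ := hL.exists_isPath hx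
    set y := push k (k + 1) x with hy
    have hy1 : y (Fin.last k) = x ⟨k - 1, by omega⟩ := by
      rw [hy, push_apply (by omega) (by omega) le_rfl, if_neg (by simp), if_pos (by simp)]
      rfl
    have hy2 : y ⟨k - 1, by omega⟩ = x (Fin.last k) := by
      rw [hy, push_apply (by omega) (by omega) le_rfl, if_pos (by simp; omega)]
      rfl
    have hxy : push k (k + 1) y = x := push_push_adjacent (by omega) le_rfl x
    obtain ⟨L₂, hL₂, hmem₂, hinf⟩ := hcoset y
    have hstep1 : IsPush Set.univ x (push 1 k y) :=
      ⟨k + 1, trivial, by omega, le_rfl, push_push le_rfl (by omega) (by omega) le_rfl x⟩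
    have hstep2 : IsPush Set.univ y (push 1 k x) :=
      ⟨k + 1, trivial, by omega, le_rfl, by
        rw [← push_push le_rfl (by omega : 1 < k) (by omega) le_rfl y, hxy]⟩
    have hpath := hL₁.append hL₂ hstep1 fun z hz hz' => by
      rw [← hrot.mem_iff, hmem] at hz
      rw [hmem₂, hy1, Fin.ext_iff, hx2] at hz'
      omega
    refine ⟨L₁ ++ L₂, ⟨_, _, hpath, hstep2⟩, fun σ => ?_, fun hm' => ?_⟩
    · rw [List.mem_append, ← hrot.mem_iff, hmem, hmem₂, hy1, Fin.ext_iff, hx2]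
      omega
    · obtain ⟨u, hu, hu1, hu2⟩ := hinf ⟨m + 2, by omega⟩
        (by rw [hy1, Ne, Fin.ext_iff, hx2]; simp) (by rw [hy2, Ne, Fin.ext_iff, hx1]; simp)
      exact ⟨u, hasEdge_of_infix (hu.trans (List.suffix_append _ _).isInfix),
        by rw [hu1, hy1, hx2], by rw [hu2]⟩

theorem exists_complete_circuit (k : ℕ) (hk : 2 ≤ k) :
    ∃ H : List (Perm (Fin k)), IsCircuit (IsPush Set.univ) H ∧ ∀ w, w ∈ H := by
  induction k, hk using Nat.le_induction with
  | base =>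
    have hp : pushCycle 2 1 2 = swap 0 1 := by
      ext p
      rw [pushCycle_apply le_rfl (by omega) le_rfl]
      fin_cases p <;> simp
    refine ⟨[1, swap 0 1], ⟨1, swap 0 1, ⟨rfl, rfl, ?_, by decide⟩, ?_⟩, by decide⟩
    · simp only [List.isChain_cons_cons, List.isChain_singleton, and_true]
      exact ⟨2, trivial, by omega, le_rfl, by rw [push, hp, one_mul]⟩
    · exact ⟨2, trivial, by omega, le_rfl, by rw [push, hp, swap_mul_self]⟩
  | succ k hk ih =>
    obtain ⟨H, hH, hall⟩ := ih
    obtain ⟨L, hL, hmem, -⟩ := exists_circuit_last_le hk hH hall k le_rfl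
    exact ⟨L, hL, fun w => (hmem w).2 (by omega)⟩

theorem exists_isCompleteSeq (k : ℕ) (hk : 2 ≤ k) : ∃ js, IsCompleteSeq k js := by
  obtain ⟨H, hH, hall⟩ := exists_complete_circuit k hk
  obtain ⟨y, x, hp, hxy⟩ := hH
  obtain ⟨js, hjs, hend, hmem⟩ := hp.exists_walk hxy
  have hne : js ≠ [] := by
    rintro rfl
    have := hp.head
    rw [hjs] at this
    simp [walk] at this
  have hlen : js.length = k ! := by
    rw [← length_walk 1 y js, ← hjs, ← List.toFinset_card_of_nodup hp.nodup,
      show H.toFinset = Finset.univ from Finset.eq_univ_of_forall fun w => by simp [hall],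
      Finset.card_univ, Fintype.card_perm, Fintype.card_fin]
  refine ⟨js, walk 1 y js, ?_, hmem, y, rfl, hend⟩
  rw [← hlen]
  exact isPushGrayCode_walk hne hmem hend (hjs ▸ hp.nodup)

theorem HasEdge.unique {α : Type*} {L : List α} (hL : L.Nodup) {u v v' : α} (h : HasEdge L u v)
    (h' : HasEdge L u v') : v = v' := by
  obtain ⟨M, hM, h1, h2⟩ := h
  obtain ⟨M', hM', h1', h2'⟩ := h'
  obtain ⟨A, B, rfl, rfl⟩ := isRotated_iff_append.1 (hM.symm.trans hM')
  have hnd := (hM.nodup_iff).1 hL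
  rcases eq_or_ne A [] with rfl | hA
  · simp only [List.nil_append, List.append_nil] at h1 h1'
    rw [h1] at h1'; simpa using h1'
  rcases eq_or_ne B [] with rfl | hB
  · simp only [List.nil_append, List.append_nil] at h1 h1'
    rw [h1] at h1'; simpa using h1'
  rw [List.getLast?_append_of_ne_nil _ hB] at h2
  rw [List.getLast?_append_of_ne_nil _ hA] at h2'
  exact absurd (List.mem_of_getLast? h2) ((List.nodup_append'.1 hnd).2.2 (List.mem_of_getLast? h2'))

/-! ### Hamiltonian circuits of the alternating groups -/

/-- A circuit of pushes from odd indices through all the even permutations of `[m]`, one of whose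
edges is the push `t_{↑m-2}`. -/
structure IsOddCircuit {m : ℕ} (H : List (Perm (Fin m))) : Prop where
  circuit : IsCircuit (IsPush {j | Odd j}) H
  mem_iff : ∀ w, w ∈ H ↔ Perm.sign w = 1
  edge : ∃ w, HasEdge H w (push 1 (m - 2) w)

theorem exists_sign_eq_one_apply_eq {m : ℕ} (hm : 3 ≤ m) {l : Fin m} (hl : (l : ℕ) + 1 = m)
    (p : Fin m) : ∃ σ : Perm (Fin m), Perm.sign σ = 1 ∧ σ l = p := by
  by_cases h : Perm.sign (swap l p) = 1
  · exact ⟨_, h, swap_apply_left _ _⟩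
  · refine ⟨swap l p * swap ⟨0, by omega⟩ ⟨1, by omega⟩, ?_, ?_⟩
    · rw [Perm.sign_mul, (Int.units_eq_one_or _).resolve_left h, Perm.sign_swap (by simp)]
      rfl
    · have h2 : swap (⟨0, by omega⟩ : Fin m) ⟨1, by omega⟩ l = l :=
        swap_apply_of_ne_of_ne (by rw [Ne, Fin.ext_iff]; simp only; omega)
          (by rw [Ne, Fin.ext_iff]; simp only; omega)
      rw [Perm.mul_apply, h2, swap_apply_left]

theorem IsOddCircuit.exists_hasEdge_last {m : ℕ} {H : List (Perm (Fin m))} (hH : IsOddCircuit H)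
    (hm : 3 ≤ m) {l : Fin m} (hl : (l : ℕ) + 1 = m) (p : Fin m) :
    ∃ w, HasEdge H w (push 1 m w) ∧ w l = p := by
  have : Nontrivial (Fin m) := Fin.nontrivial_iff_two_le.2 (by omega)
  obtain ⟨q, hq⟩ := exists_ne p
  obtain ⟨σ, hσ, hσl⟩ := exists_sign_eq_one_apply_eq hm hl p
  obtain ⟨τ, hτ, hτl⟩ := exists_sign_eq_one_apply_eq hm hl q
  obtain ⟨w, hw, hwl⟩ := _root_.exists_hasEdge_last hH.circuit hl ((hH.mem_iff σ).2 hσ)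
    ((hH.mem_iff τ).2 hτ) (by rwa [hσl, hτl])
  exact ⟨w, hw, hwl.trans hσl⟩

/-- The last five positions of a vector of length `o + 5`. -/
abbrev tailPos (o : ℕ) (i : Fin 5) : Fin (o + 5) := windowPos le_rfl i

theorem push_apply_tailPos {o i j : ℕ} (hi : 1 ≤ i) (hij : i < j) (hj : j ≤ 5)
    (σ : Perm (Fin (o + 5))) (p : Fin 5) :
    push (o + i) (o + j) σ (tailPos o p) = σ (tailPos o (pushCycle 5 i j p)) := by
  have := push_mul_window (le_refl (o + 5)) hi hij hj σ 1
  rw [map_one, mul_one, push, push, one_mul] at this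
  rw [push, this, Perm.mul_apply, window_apply]

/-- The coset of the vectors with the last two entries of `y`, cut open at `y`, where it has an edge
`t_{↑j}`. Each entry is pushed by some edge `t_{↑o+3}` that remains, unless this is the
edge that has been cut. -/
theorem IsOddCircuit.exists_coset_path {o j : ℕ} {H : List (Perm (Fin (o + 3)))}
    (hH : IsOddCircuit H) (h1 : 1 < j) (hj : j ≤ o + 3)
    (hw₀ : ∃ w₀, HasEdge H w₀ (push 1 j w₀)) {y : Perm (Fin (o + 5))} (hy : Perm.sign y = 1) :
    ∃ L, IsPath (IsPush {j | Odd j}) L (push 1 j y) y ∧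
      (∀ σ, σ ∈ L ↔ Perm.sign σ = 1 ∧ σ (tailPos o 3) = y (tailPos o 3) ∧
        σ (tailPos o 4) = y (tailPos o 4)) ∧
      ∀ v, v ≠ y (tailPos o 3) → v ≠ y (tailPos o 4) → (j = o + 3 → v ≠ y (tailPos o 2)) →
        ∃ x, [x, push 1 (o + 3) x] <:+: L ∧ x (tailPos o 2) = v ∧
          x (tailPos o 3) = y (tailPos o 3) ∧ x (tailPos o 4) = y (tailPos o 4) := by
  have h : 0 + (o + 3) ≤ o + 5 := by omega
  obtain ⟨w₀, hw₀⟩ := hw₀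
  have hsign : Perm.sign w₀ = 1 := (hH.mem_iff _).1 hw₀.mem_left
  obtain ⟨L, hL, -, hmem, hinf⟩ := _root_.exists_coset_path h hH.circuit h1 hj hw₀ y
  let l : Fin (o + 3) := ⟨o + 2, by omega⟩
  have hl : tailPos o 2 = windowPos h l := by ext; simp [l]
  refine ⟨L, hL, fun σ => ?_, fun v hv3 hv4 hv2 => ?_⟩
  · rw [hmem]
    have h1 : (∃ w ∈ H, σ = y * window h (w₀⁻¹ * w)) ↔
        Perm.sign σ = 1 ∧ ∃ w, σ = y * window h w := by
      constructor
      · rintro ⟨w, hw, rfl⟩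
        refine ⟨?_, _, rfl⟩
        simp [sign_window, hy, hsign, (hH.mem_iff w).1 hw]
      · rintro ⟨hσ, w, rfl⟩
        refine ⟨w₀ * w, (hH.mem_iff _).2 ?_, by simp⟩
        rw [Perm.sign_mul, sign_window, hy, one_mul] at hσ
        rw [Perm.sign_mul, hσ, hsign, one_mul]
    rw [h1, exists_mul_window_eq_iff]
    refine and_congr_right fun _ => ⟨fun h2 => ⟨h2 _ (by simp), h2 _ (by simp)⟩, ?_⟩
    rintro ⟨h3, h4⟩ p hp
    obtain rfl | rfl : p = tailPos o 3 ∨ p = tailPos o 4 := by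
      simp only [Fin.ext_iff, val_windowPos]
      have := p.2
      simp; omega
    exacts [h3, h4]
  · have hpos : ((y⁻¹ v : Fin (o + 5)) : ℕ) < 0 + (o + 3) := by
      have h3 : y⁻¹ v ≠ tailPos o 3 := fun he => hv3 (by rw [← he]; simp)
      have h4 : y⁻¹ v ≠ tailPos o 4 := fun he => hv4 (by rw [← he]; simp)
      have := (y⁻¹ v).2
      simp only [Ne, Fin.ext_iff, val_windowPos] at h3 h4
      simp at h3 h4
      simp only [Perm.inv_def]
      omega
    obtain ⟨p, hp⟩ := exists_windowPos h (Nat.zero_le _) hpos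
    obtain ⟨w, hw, hwl⟩ := hH.exists_hasEdge_last (by omega) (l := l) rfl (w₀ p)
    have hxl : (y * window h (w₀⁻¹ * w)) (tailPos o 2) = v := by
      rw [hl, Perm.mul_apply, window_apply, Perm.mul_apply, hwl, Perm.inv_def, symm_apply_apply,
        ← hp]
      simp
    refine ⟨_, hinf w (o + 3) (by omega) le_rfl ?_ hw, hxl, ?_, ?_⟩
    · rintro rfl
      rw [inv_mul_cancel, map_one, mul_one] at hxl
      refine hv2 ?_ hxl.symm
      have he := hw.unique hH.circuit.nodup hw₀
      by_contra hne
      have := congrArg (fun τ : Perm (Fin (o + 3)) => τ l) he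
      simp only [push_apply_last h1 (lt_of_le_of_ne hj hne) w (p := l) rfl] at this
      rw [push_apply le_rfl (by omega) le_rfl, if_neg (by simp [l]), if_pos (by simp [l])] at this
      have := congrArg Fin.val (w.injective this)
      simp [l] at this
    · rw [Perm.mul_apply, window_apply_of_ge h _ (by simp)]
    · rw [Perm.mul_apply, window_apply_of_ge h _ (by simp)]

/-- A circuit of pushes from odd indices through all the even permutations whose last two entries
are a pair in `P`. If the pair `(q, r)` is in `P`, but one of `(p, q)` and `(r, p)` is not, then the
edge that pushes `p` in some vector `[…, p, q, r]` is left for the addition of these pairs. -/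
structure IsPairCircuit {o : ℕ} (P : ℕ → ℕ → Prop) (L : List (Perm (Fin (o + 5)))) : Prop where
  circuit : IsCircuit (IsPush {j | Odd j}) L
  mem_iff : ∀ σ, σ ∈ L ↔ Perm.sign σ = 1 ∧ P (σ (tailPos o 3)) (σ (tailPos o 4))
  edge : ∀ p q r : Fin (o + 5), p ≠ q → p ≠ r → q ≠ r → P q r → ¬ (P p q ∧ P r p) →
    ∃ x, HasEdge L x (push 1 (o + 3) x) ∧ x (tailPos o 2) = p ∧ x (tailPos o 3) = q ∧
      x (tailPos o 4) = r
  exists_edge : ∃ x, HasEdge L x (push 1 (o + 3) x)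

theorem sign_push {n i j : ℕ} (hi : 1 ≤ i) (hij : i < j) (hj : j ≤ n) (h : Even (j - i))
    (σ : Perm (Fin n)) : Perm.sign (push i j σ) = Perm.sign σ := by
  rw [push, Perm.sign_mul, sign_pushCycle hi hij hj, h.neg_one_pow, mul_one]

theorem IsPairCircuit.congr {o : ℕ} {P P' : ℕ → ℕ → Prop} {L : List (Perm (Fin (o + 5)))}
    (hL : IsPairCircuit P L) (h : ∀ a b, a < o + 5 → b < o + 5 → a ≠ b → (P a b ↔ P' a b)) :
    IsPairCircuit P' L := by
  have h' : ∀ a b : Fin (o + 5), a ≠ b → (P a b ↔ P' a b) := fun a b hab =>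
    h a b a.2 b.2 fun he => hab (Fin.ext he)
  refine ⟨hL.circuit, fun σ => ?_, fun p q r hpq hpr hne hqr hn => ?_, hL.exists_edge⟩
  · rw [hL.mem_iff, h' _ _ fun he => by simpa using windowPos_injective le_rfl (σ.injective he)]
  · rw [← h' q r hne] at hqr
    rw [← h' p q hpq, ← h' r p (Ne.symm hpr)] at hn
    exact hL.edge p q r hpq hpr hne hqr hn

/-- Pushing the last entry two places to the left rotates the last three entries. -/
theorem push_tail_three {o : ℕ} (σ : Perm (Fin (o + 5))) :
    push (o + 3) (o + 5) σ (tailPos o 2) = σ (tailPos o 4) ∧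
      push (o + 3) (o + 5) σ (tailPos o 3) = σ (tailPos o 2) ∧
      push (o + 3) (o + 5) σ (tailPos o 4) = σ (tailPos o 3) := by
  have h5 : pushCycle 5 3 5 2 = 4 ∧ pushCycle 5 3 5 3 = 2 ∧ pushCycle 5 3 5 4 = 3 := by
    simp [Fin.ext_iff, pushCycle_apply]
  refine ⟨?_, ?_, ?_⟩ <;> rw [push_apply_tailPos (by omega) (by omega) le_rfl]
  exacts [by rw [h5.1], by rw [h5.2.1], by rw [h5.2.2]]

/-- The cosets of the pairs `(q, r)`, `(p, q)` and `(r, p)` are joined by replacing the three edges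
`t_{↑o+3}` at `[…, p, q, r]`, `[…, r, p, q]` and `[…, q, r, p]` by `t_{↑o+5}`. -/
theorem IsPairCircuit.add_triangle {o : ℕ} (ho : Even o) {H : List (Perm (Fin (o + 3)))}
    (hH : IsOddCircuit H) {P : ℕ → ℕ → Prop} {L : List (Perm (Fin (o + 5)))}
    (hL : IsPairCircuit P L) {p q r : ℕ} (hp : p < o + 5) (hq : q < o + 5) (hr : r < o + 5)
    (hpq : p ≠ q) (hpr : p ≠ r) (hqr : q ≠ r) (h1 : P q r) (h2 : ¬ P p q) (h3 : ¬ P r p) :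
    ∃ L' : List (Perm (Fin (o + 5))),
      IsPairCircuit (fun a b => P a b ∨ (a = p ∧ b = q) ∨ (a = r ∧ b = p)) L' := by
  lift p to Fin (o + 5) using hp
  lift q to Fin (o + 5) using hq
  lift r to Fin (o + 5) using hr
  have hpq' : p ≠ q := fun he => hpq (by rw [he])
  have hpr' : p ≠ r := fun he => hpr (by rw [he])
  have hqr' : q ≠ r := fun he => hqr (by rw [he])
  obtain ⟨x, hx, hx2, hx3, hx4⟩ := hL.edge p q r hpq' hpr' hqr' h1 fun h => h2 h.1
  have hodd3 : Odd (o + 3) := ho.add_odd (by decide)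
  have hodd5 : Odd (o + 5) := ho.add_odd (by decide)
  have hjJ : ∃ w₀, HasEdge H w₀ (push 1 (o + 3) w₀) := by
    obtain ⟨w, hw, -⟩ := hH.exists_hasEdge_last (by omega) (l := ⟨o + 2, by omega⟩) rfl 0
    exact ⟨w, hw⟩
  have hcyc := push_tail_three (o := o)
  have hsign : ∀ σ : Perm (Fin (o + 5)), Perm.sign (push (o + 3) (o + 5) σ) = Perm.sign σ :=
    sign_push (by omega) (by omega) le_rfl (by rw [show o + 5 - (o + 3) = 2 by omega]; decide)
  set y := push (o + 3) (o + 5) x with hy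
  set z := push (o + 3) (o + 5) y with hz
  have hzx : push (o + 3) (o + 5) z = x := by
    have h5 : push 3 5 (push 3 5 (push 3 5 (1 : Perm (Fin 5)))) = 1 := by
      simp only [push, one_mul]
      ext t
      fin_cases t <;> simp [pushCycle_apply]
    have h6 := push_mul_window (le_refl (o + 5)) (i := 3) (j := 5) (by omega) (by omega) le_rfl x
    have h7 : y = x * window (le_refl (o + 5)) (push 3 5 1) := by
      rw [← h6, map_one, mul_one]
    rw [hz, h7, h6, h6, h5, map_one, mul_one]
  obtain ⟨hy2, hy3, hy4⟩ := hcyc x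
  obtain ⟨hz2, hz3, hz4⟩ := hcyc y
  rw [← hy, hx2] at hy3
  rw [← hy, hx3] at hy4
  rw [← hy, hx4] at hy2
  rw [← hz, hy2] at hz3
  rw [← hz, hy3] at hz4
  rw [← hz, hy4] at hz2
  have hxs : Perm.sign x = 1 := ((hL.mem_iff x).1 hx.mem_left).1
  have hys : Perm.sign y = 1 := (hsign x).trans hxs
  have hzs : Perm.sign z = 1 := (hsign y).trans hys
  have hstep : ∀ σ : Perm (Fin (o + 5)),
      IsPush {j | Odd j} σ (push 1 (o + 3) (push (o + 3) (o + 5) σ)) := fun σ =>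
    ⟨o + 5, hodd5, by omega, le_rfl, push_push le_rfl (by omega) (by omega) le_rfl σ⟩
  obtain ⟨-, L₁, hrot, hL₁⟩ := hL.circuit.exists_isPath hx
  obtain ⟨L₂, hL₂, hmem₂, hinf₂⟩ := hH.exists_coset_path (by omega) le_rfl hjJ hys
  obtain ⟨L₃, hL₃, hmem₃, hinf₃⟩ := hH.exists_coset_path (by omega) le_rfl hjJ hzs
  rw [hy2, hy3, hy4] at hinf₂
  rw [hz2, hz3, hz4] at hinf₃
  have hpath₁ := hL₁.append hL₂ (hstep x) fun σ hσ hσ' => by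
    rw [← hrot.mem_iff, hL.mem_iff] at hσ
    rw [hmem₂, hy3, hy4] at hσ'
    rw [hσ'.2.1, hσ'.2.2] at hσ
    exact h2 hσ.2
  have hpath := hpath₁.append hL₃ (hstep y) fun σ hσ hσ' => by
    rw [hmem₃, hz3, hz4] at hσ'
    rcases List.mem_append.1 hσ with hσ | hσ
    · rw [← hrot.mem_iff, hL.mem_iff] at hσ
      rw [hσ'.2.1, hσ'.2.2] at hσ
      exact h3 hσ.2
    · rw [hmem₂, hy3] at hσ
      exact hpr' (hσ.2.1.symm.trans hσ'.2.1)
  have hclose : IsPush {j | Odd j} z (push 1 (o + 3) x) := by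
    have := hstep z
    rwa [hzx] at this
  have hi₁ : L₁ <:+: (L₁ ++ L₂) ++ L₃ := ⟨[], L₂ ++ L₃, by simp⟩
  have hi₂ : L₂ <:+: (L₁ ++ L₂) ++ L₃ := ⟨L₁, L₃, by simp⟩
  have hi₃ : L₃ <:+: (L₁ ++ L₂) ++ L₃ := ⟨L₁ ++ L₂, [], by simp⟩
  refine ⟨(L₁ ++ L₂) ++ L₃, ⟨_, _, hpath, hclose⟩, fun σ => ?_, ?_, ?_⟩
  · rw [List.mem_append, List.mem_append, ← hrot.mem_iff, hL.mem_iff, hmem₂, hmem₃, hy3, hy4,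
      hz3, hz4, Fin.ext_iff, Fin.ext_iff, Fin.ext_iff, Fin.ext_iff]
    tauto
  · intro p' q' r' hpq₀ hpr₀ hqr₀ h0 hn
    rcases h0 with h0 | ⟨h4, h5⟩ | ⟨h4, h5⟩
    · obtain ⟨u, hu, hu2, hu3, hu4⟩ := hL.edge p' q' r' hpq₀ hpr₀ hqr₀ h0 fun h =>
        hn ⟨Or.inl h.1, Or.inl h.2⟩
      refine ⟨u, hasEdge_of_infix (((hu.isRotated hrot).infix hL₁ ?_).trans hi₁), hu2, hu3, hu4⟩
      rintro rfl
      obtain rfl := hx2.symm.trans hu2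
      obtain rfl := hx3.symm.trans hu3
      obtain rfl := hx4.symm.trans hu4
      exact hn ⟨Or.inr (Or.inl ⟨rfl, rfl⟩), Or.inr (Or.inr ⟨rfl, rfl⟩)⟩
    · obtain rfl := Fin.ext h4
      obtain rfl := Fin.ext h5
      have hne : p' ≠ r := by
        rintro rfl
        exact hn ⟨Or.inr (Or.inr ⟨rfl, rfl⟩), Or.inl h1⟩
      obtain ⟨u, hu, h⟩ := hinf₂ p' hpq₀ hpr₀ fun _ => hne
      exact ⟨u, hasEdge_of_infix (hu.trans hi₂), h⟩
    · obtain rfl := Fin.ext h4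
      obtain rfl := Fin.ext h5
      have hne : p' ≠ q := by
        rintro rfl
        exact hn ⟨Or.inl h1, Or.inr (Or.inl ⟨rfl, rfl⟩)⟩
      obtain ⟨u, hu, h⟩ := hinf₃ p' hpq₀ hpr₀ fun _ => hne
      exact ⟨u, hasEdge_of_infix (hu.trans hi₃), h⟩
  · obtain ⟨v, hv⟩ : ∃ v : Fin (o + 5), v ∉ ({p, q, r} : Finset (Fin (o + 5))) := by
      by_contra hall
      push Not at hall
      have := (Finset.card_le_card (fun v _ => hall v :
        (Finset.univ : Finset (Fin (o + 5))) ⊆ _)).trans Finset.card_le_three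
      simp at this
    simp only [Finset.mem_insert, Finset.mem_singleton, not_or] at hv
    obtain ⟨u, hu, -⟩ := hinf₂ v hv.1 hv.2.1 fun _ => hv.2.2
    exact ⟨u, hasEdge_of_infix (hu.trans hi₂)⟩

/-- The pairs of entries of the last five positions of the identity whose indices are in `S`. -/
def tailPairs (o : ℕ) (S : Finset (Fin 5 × Fin 5)) (a b : ℕ) : Prop :=
  ∃ i j, (i, j) ∈ S ∧ a = o + (i : ℕ) ∧ b = o + (j : ℕ)

theorem tailPairs_insert {o : ℕ} {S : Finset (Fin 5 × Fin 5)} {i j : Fin 5} {a b : ℕ} :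
    tailPairs o (insert (i, j) S) a b ↔ (a = o + i ∧ b = o + j) ∨ tailPairs o S a b := by
  simp only [tailPairs, Finset.mem_insert, Prod.mk.injEq, or_and_right, exists_or]
  refine or_congr_left ⟨?_, fun h => ⟨i, j, ⟨rfl, rfl⟩, h⟩⟩
  rintro ⟨_, _, ⟨rfl, rfl⟩, h⟩
  exact h

theorem tailPairs_empty {o a b : ℕ} : ¬ tailPairs o ∅ a b := by simp [tailPairs]

theorem tailPairs_iff {o : ℕ} {S : Finset (Fin 5 × Fin 5)} {i j : Fin 5} :
    tailPairs o S (o + i) (o + j) ↔ (i, j) ∈ S := by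
  constructor
  · rintro ⟨i', j', h, h1, h2⟩
    obtain rfl : i = i' := Fin.ext (by omega)
    obtain rfl : j = j' := Fin.ext (by omega)
    exact h
  · exact fun h => ⟨i, j, h, rfl, rfl⟩

theorem push_tail_five {o : ℕ} (σ : Perm (Fin (o + 5))) :
    push (o + 1) (o + 5) σ (tailPos o 0) = σ (tailPos o 4) ∧
      push (o + 1) (o + 5) σ (tailPos o 1) = σ (tailPos o 0) ∧
      push (o + 1) (o + 5) σ (tailPos o 2) = σ (tailPos o 1) ∧
      push (o + 1) (o + 5) σ (tailPos o 3) = σ (tailPos o 2) ∧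
      push (o + 1) (o + 5) σ (tailPos o 4) = σ (tailPos o 3) := by
  have h5 : pushCycle 5 1 5 0 = 4 ∧ pushCycle 5 1 5 1 = 0 ∧ pushCycle 5 1 5 2 = 1 ∧
      pushCycle 5 1 5 3 = 2 ∧ pushCycle 5 1 5 4 = 3 := by
    simp [Fin.ext_iff, pushCycle_apply]
  obtain ⟨h0, h1, h2, h3, h4⟩ := h5
  refine ⟨?_, ?_, ?_, ?_, ?_⟩ <;> rw [push_apply_tailPos (by omega) (by omega) le_rfl]
  exacts [by rw [h0], by rw [h1], by rw [h2], by rw [h3], by rw [h4]]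

theorem push_tail_three_fix {o : ℕ} (σ : Perm (Fin (o + 5))) :
    push (o + 3) (o + 5) σ (tailPos o 0) = σ (tailPos o 0) ∧
      push (o + 3) (o + 5) σ (tailPos o 1) = σ (tailPos o 1) := by
  have h5 : pushCycle 5 3 5 0 = 0 ∧ pushCycle 5 3 5 1 = 1 := by
    simp [Fin.ext_iff, pushCycle_apply]
  refine ⟨?_, ?_⟩ <;> rw [push_apply_tailPos (by omega) (by omega) le_rfl]
  exacts [by rw [h5.1], by rw [h5.2]]

/-- Six cosets to begin with. Let `a` and `b` be the rotations of the last three and of the last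
five entries, so that `t_{↑o+5}` is `a` followed by `t_{↑o+3}`, and also `b` followed by `t_{↑o+1}`.
As `(a b b)² = 1`, replacing two edges `t_{↑o+3}` and four edges `t_{↑o+1}` by edges `t_{↑o+5}`
joins six cosets. An even number of cosets has to be joined in one go, since the triangles
add two cosets each and there is an even number of cosets in all. -/
theorem IsOddCircuit.exists_isPairCircuit {o : ℕ} (ho : Even o) (ho2 : 2 ≤ o)
    {H : List (Perm (Fin (o + 3)))} (hH : IsOddCircuit H) :
    ∃ L : List (Perm (Fin (o + 5))),
      IsPairCircuit (tailPairs o {(3, 4), (2, 3), (4, 2), (1, 4), (0, 1), (4, 0)}) L := by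
  have hj3 : ∃ w₀, HasEdge H w₀ (push 1 (o + 3) w₀) := by
    obtain ⟨w, hw, -⟩ := hH.exists_hasEdge_last (by omega) (l := ⟨o + 2, by omega⟩) rfl 0
    exact ⟨w, hw⟩
  have hj1 : ∃ w₀, HasEdge H w₀ (push 1 (o + 1) w₀) := hH.edge
  have hodd5 : Odd (o + 5) := ho.add_odd (by decide)
  have hsign3 : ∀ σ : Perm (Fin (o + 5)), Perm.sign (push (o + 3) (o + 5) σ) = Perm.sign σ :=
    sign_push (by omega) (by omega) le_rfl (by rw [show o + 5 - (o + 3) = 2 by omega]; decide)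
  have hsign1 : ∀ σ : Perm (Fin (o + 5)), Perm.sign (push (o + 1) (o + 5) σ) = Perm.sign σ :=
    sign_push (by omega) (by omega) le_rfl (by rw [show o + 5 - (o + 1) = 4 by omega]; decide)
  have hstep3 : ∀ σ : Perm (Fin (o + 5)),
      IsPush {j | Odd j} σ (push 1 (o + 3) (push (o + 3) (o + 5) σ)) := fun σ =>
    ⟨o + 5, hodd5, by omega, le_rfl, push_push le_rfl (by omega) (by omega) le_rfl σ⟩
  have hstep1 : ∀ σ : Perm (Fin (o + 5)),
      IsPush {j | Odd j} σ (push 1 (o + 1) (push (o + 1) (o + 5) σ)) := fun σ =>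
    ⟨o + 5, hodd5, by omega, le_rfl, push_push le_rfl (by omega) (by omega) le_rfl σ⟩
  have e1 : ∀ i : Fin 5, (1 : Perm (Fin (o + 5))) (tailPos o i) = tailPos o i := fun _ => rfl
  set y₁ : Perm (Fin (o + 5)) := 1 with hy₁
  set y₂ := push (o + 3) (o + 5) y₁ with hy₂
  set y₃ := push (o + 1) (o + 5) y₂ with hy₃
  set y₄ := push (o + 1) (o + 5) y₃ with hy₄
  set y₅ := push (o + 3) (o + 5) y₄ with hy₅
  set y₆ := push (o + 1) (o + 5) y₅ with hy₆
  have hclose : push (o + 1) (o + 5) y₆ = y₁ := by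
    have h5 : push 1 5 (push 1 5 (push 3 5 (push 1 5 (push 1 5
        (push 3 5 (1 : Perm (Fin 5))))))) = 1 := by
      simp only [push, one_mul]
      ext t
      fin_cases t <;> simp [pushCycle_apply]
    have h6 := push_mul_window (le_refl (o + 5)) (i := 3) (j := 5) (by omega) (by omega) le_rfl
      (1 : Perm (Fin (o + 5)))
    have h7 := push_mul_window (le_refl (o + 5)) (i := 1) (j := 5) (by omega) (by omega) le_rfl
      (1 : Perm (Fin (o + 5)))
    have h8 : y₁ = 1 * window (le_refl (o + 5)) 1 := by rw [map_one, mul_one]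
    rw [hy₆, hy₅, hy₄, hy₃, hy₂, h8, h6, h7, h7, h6, h7, h7, h5]
  obtain ⟨e₂2, e₂3, e₂4⟩ := push_tail_three y₁
  obtain ⟨e₂0, e₂1⟩ := push_tail_three_fix y₁
  rw [← hy₂, e1 0] at e₂0
  rw [← hy₂, e1 1] at e₂1
  rw [← hy₂, e1 4] at e₂2
  rw [← hy₂, e1 2] at e₂3
  rw [← hy₂, e1 3] at e₂4
  obtain ⟨e₃0, e₃1, e₃2, e₃3, e₃4⟩ := push_tail_five y₂
  rw [← hy₃, e₂4] at e₃0
  rw [← hy₃, e₂0] at e₃1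
  rw [← hy₃, e₂1] at e₃2
  rw [← hy₃, e₂2] at e₃3
  rw [← hy₃, e₂3] at e₃4
  obtain ⟨e₄0, e₄1, e₄2, e₄3, e₄4⟩ := push_tail_five y₃
  rw [← hy₄, e₃4] at e₄0
  rw [← hy₄, e₃0] at e₄1
  rw [← hy₄, e₃1] at e₄2
  rw [← hy₄, e₃2] at e₄3
  rw [← hy₄, e₃3] at e₄4
  obtain ⟨e₅2, e₅3, e₅4⟩ := push_tail_three y₄
  obtain ⟨e₅0, e₅1⟩ := push_tail_three_fix y₄
  rw [← hy₅, e₄0] at e₅0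
  rw [← hy₅, e₄1] at e₅1
  rw [← hy₅, e₄4] at e₅2
  rw [← hy₅, e₄2] at e₅3
  rw [← hy₅, e₄3] at e₅4
  obtain ⟨e₆0, e₆1, e₆2, e₆3, e₆4⟩ := push_tail_five y₅
  rw [← hy₆, e₅4] at e₆0
  rw [← hy₆, e₅0] at e₆1
  rw [← hy₆, e₅1] at e₆2
  rw [← hy₆, e₅2] at e₆3
  rw [← hy₆, e₅3] at e₆4
  have s₁ : Perm.sign y₁ = 1 := Perm.sign_one
  have s₂ : Perm.sign y₂ = 1 := (hsign3 _).trans s₁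
  have s₃ : Perm.sign y₃ = 1 := (hsign1 _).trans s₂
  have s₄ : Perm.sign y₄ = 1 := (hsign1 _).trans s₃
  have s₅ : Perm.sign y₅ = 1 := (hsign3 _).trans s₄
  have s₆ : Perm.sign y₆ = 1 := (hsign1 _).trans s₅
  obtain ⟨L₁, p₁, m₁, i₁⟩ := hH.exists_coset_path (by omega) (by omega) hj1 s₁
  obtain ⟨L₂, p₂, m₂, i₂⟩ := hH.exists_coset_path (by omega) (by omega) hj3 s₂
  obtain ⟨L₃, p₃, m₃, i₃⟩ := hH.exists_coset_path (by omega) (by omega) hj1 s₃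
  obtain ⟨L₄, p₄, m₄, i₄⟩ := hH.exists_coset_path (by omega) (by omega) hj1 s₄
  obtain ⟨L₅, p₅, m₅, i₅⟩ := hH.exists_coset_path (by omega) (by omega) hj3 s₅
  obtain ⟨L₆, p₆, m₆, i₆⟩ := hH.exists_coset_path (by omega) (by omega) hj1 s₆
  simp only [e1] at m₁ i₁
  simp only [e₂3, e₂4] at m₂
  simp only [e₂2, e₂3, e₂4] at i₂
  simp only [e₃3, e₃4] at m₃
  simp only [e₃2, e₃3, e₃4] at i₃
  simp only [e₄3, e₄4] at m₄
  simp only [e₄2, e₄3, e₄4] at i₄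
  simp only [e₅3, e₅4] at m₅
  simp only [e₅2, e₅3, e₅4] at i₅
  simp only [e₆3, e₆4] at m₆
  simp only [e₆2, e₆3, e₆4] at i₆
  have hinj : ∀ i j : Fin 5, tailPos o i = tailPos o j ↔ i = j := fun i j =>
    (windowPos_injective le_rfl).eq_iff
  have q₂ := p₁.append p₂ (hstep3 y₁) fun z hz hz' => by
    simp only [m₁, m₂] at hz hz'
    simp only [hz'.2.1, hz'.2.2, hinj] at hz
    simp at hz
  have q₃ := q₂.append p₃ (hstep1 y₂) fun z hz hz' => by
    simp only [List.mem_append, m₁, m₂, m₃] at hz hz'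
    simp only [hz'.2.1, hz'.2.2, hinj] at hz
    simp at hz
  have q₄ := q₃.append p₄ (hstep1 y₃) fun z hz hz' => by
    simp only [List.mem_append, m₁, m₂, m₃, m₄] at hz hz'
    simp only [hz'.2.1, hz'.2.2, hinj] at hz
    simp at hz
  have q₅ := q₄.append p₅ (hstep3 y₄) fun z hz hz' => by
    simp only [List.mem_append, m₁, m₂, m₃, m₄, m₅] at hz hz'
    simp only [hz'.2.1, hz'.2.2, hinj] at hz
    simp at hz
  have q₆ := q₅.append p₆ (hstep1 y₅) fun z hz hz' => by
    simp only [List.mem_append, m₁, m₂, m₃, m₄, m₅, m₆] at hz hz'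
    simp only [hz'.2.1, hz'.2.2, hinj] at hz
    simp at hz
  have hclose' : IsPush {j | Odd j} y₆ (push 1 (o + 1) y₁) := by
    have := hstep1 y₆
    rwa [hclose] at this
  have hi₁ : L₁ <:+: L₁ ++ L₂ ++ L₃ ++ L₄ ++ L₅ ++ L₆ := ⟨[], L₂ ++ L₃ ++ L₄ ++ L₅ ++ L₆, by simp⟩
  have hi₂ : L₂ <:+: L₁ ++ L₂ ++ L₃ ++ L₄ ++ L₅ ++ L₆ := ⟨L₁, L₃ ++ L₄ ++ L₅ ++ L₆, by simp⟩
  have hi₃ : L₃ <:+: L₁ ++ L₂ ++ L₃ ++ L₄ ++ L₅ ++ L₆ := ⟨L₁ ++ L₂, L₄ ++ L₅ ++ L₆, by simp⟩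
  have hi₄ : L₄ <:+: L₁ ++ L₂ ++ L₃ ++ L₄ ++ L₅ ++ L₆ := ⟨L₁ ++ L₂ ++ L₃, L₅ ++ L₆, by simp⟩
  have hi₅ : L₅ <:+: L₁ ++ L₂ ++ L₃ ++ L₄ ++ L₅ ++ L₆ := ⟨L₁ ++ L₂ ++ L₃ ++ L₄, L₆, by simp⟩
  have hi₆ : L₆ <:+: L₁ ++ L₂ ++ L₃ ++ L₄ ++ L₅ ++ L₆ := ⟨L₁ ++ L₂ ++ L₃ ++ L₄ ++ L₅, [], by simp⟩
  refine ⟨_, ⟨_, _, q₆, hclose'⟩, fun σ => ?_, ?_, ?_⟩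
  · have hval : ∀ (p : Fin (o + 5)) (i : Fin 5), p = tailPos o i ↔ (p : ℕ) = o + i := fun p i => by
      rw [Fin.ext_iff, val_windowPos]
    simp only [List.mem_append, m₁, m₂, m₃, m₄, m₅, m₆, ← and_or_left, ← Finset.insert_empty,
      tailPairs_insert, tailPairs_empty, hval, or_false, or_assoc]
  · intro p q r hpq hpr hqr h hn
    obtain ⟨a, b, hab, ha, hb⟩ := h
    obtain rfl : q = tailPos o a := Fin.ext ha
    obtain rfl : r = tailPos o b := Fin.ext hb
    simp only [Finset.mem_insert, Finset.mem_singleton, Prod.mk.injEq] at hab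
    rcases hab with ⟨rfl, rfl⟩ | ⟨rfl, rfl⟩ | ⟨rfl, rfl⟩ | ⟨rfl, rfl⟩ | ⟨rfl, rfl⟩ | ⟨rfl, rfl⟩
    · obtain ⟨u, hu, h⟩ := i₁ p hpq hpr (fun he => by omega)
      exact ⟨u, hasEdge_of_infix (hu.trans hi₁), h⟩
    · obtain ⟨u, hu, h⟩ := i₂ p hpq hpr (fun _ he => hn (by
        rw [he]
        exact ⟨tailPairs_iff.2 (by decide), tailPairs_iff.2 (by decide)⟩))
      exact ⟨u, hasEdge_of_infix (hu.trans hi₂), h⟩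
    · obtain ⟨u, hu, h⟩ := i₃ p hpq hpr (fun he => by omega)
      exact ⟨u, hasEdge_of_infix (hu.trans hi₃), h⟩
    · obtain ⟨u, hu, h⟩ := i₄ p hpq hpr (fun he => by omega)
      exact ⟨u, hasEdge_of_infix (hu.trans hi₄), h⟩
    · obtain ⟨u, hu, h⟩ := i₅ p hpq hpr (fun _ he => hn (by
        rw [he]
        exact ⟨tailPairs_iff.2 (by decide), tailPairs_iff.2 (by decide)⟩))
      exact ⟨u, hasEdge_of_infix (hu.trans hi₅), h⟩
    · obtain ⟨u, hu, h⟩ := i₆ p hpq hpr (fun he => by omega)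
      exact ⟨u, hasEdge_of_infix (hu.trans hi₆), h⟩
  · obtain ⟨u, hu, -⟩ := i₁ (tailPos o 2) (by simp [hinj]) (by simp [hinj]) fun he => by omega
    exact ⟨u, hasEdge_of_infix (hu.trans hi₁)⟩

theorem IsPairCircuit.add_tail_triangle {o : ℕ} (ho : Even o) {H : List (Perm (Fin (o + 3)))}
    (hH : IsOddCircuit H) {S : Finset (Fin 5 × Fin 5)}
    (hS : ∃ L : List (Perm (Fin (o + 5))), IsPairCircuit (tailPairs o S) L) (p q r : Fin 5)
    (h : p ≠ q ∧ p ≠ r ∧ q ≠ r ∧ (q, r) ∈ S ∧ (p, q) ∉ S ∧ (r, p) ∉ S) :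
    ∃ L : List (Perm (Fin (o + 5))),
      IsPairCircuit (tailPairs o (insert (p, q) (insert (r, p) S))) L := by
  obtain ⟨L, hL⟩ := hS
  obtain ⟨hpq, hpr, hqr, h1, h2, h3⟩ := h
  have hne : ∀ i j : Fin 5, i ≠ j → o + (i : ℕ) ≠ o + j := fun i j hij he =>
    hij (Fin.ext (by omega))
  obtain ⟨L', hL'⟩ := hL.add_triangle ho hH (p := o + p) (q := o + q) (r := o + r) (by omega)
    (by omega) (by omega) (hne _ _ hpq) (hne _ _ hpr) (hne _ _ hqr) (tailPairs_iff.2 h1)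
    (fun h => h2 (tailPairs_iff.1 h)) (fun h => h3 (tailPairs_iff.1 h))
  refine ⟨L', hL'.congr fun a b _ _ _ => ?_⟩
  rw [tailPairs_insert, tailPairs_insert]
  tauto

/-- The pairs of the last five symbols: seven triangles complete the six pairs of the beginning. -/
theorem IsOddCircuit.exists_isPairCircuit_tail {o : ℕ} (ho : Even o) (ho2 : 2 ≤ o)
    {H : List (Perm (Fin (o + 3)))} (hH : IsOddCircuit H) :
    ∃ L : List (Perm (Fin (o + 5))), IsPairCircuit (fun a b => o ≤ a ∧ o ≤ b) L := by
  have h := hH.exists_isPairCircuit ho ho2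
  have h := IsPairCircuit.add_tail_triangle ho hH h 2 0 1 (by decide)
  have h := IsPairCircuit.add_tail_triangle ho hH h 3 0 1 (by decide)
  have h := IsPairCircuit.add_tail_triangle ho hH h 2 4 0 (by decide)
  have h := IsPairCircuit.add_tail_triangle ho hH h 1 0 2 (by decide)
  have h := IsPairCircuit.add_tail_triangle ho hH h 3 1 0 (by decide)
  have h := IsPairCircuit.add_tail_triangle ho hH h 4 1 0 (by decide)
  have h := IsPairCircuit.add_tail_triangle ho hH h 3 2 4 (by decide)
  obtain ⟨L, hL⟩ := h
  refine ⟨L, hL.congr fun a b ha hb hab => ⟨?_, fun h => ?_⟩⟩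
  · rintro ⟨i, j, -, rfl, rfl⟩
    omega
  · obtain ⟨i, rfl⟩ : ∃ i : Fin 5, a = o + i := ⟨⟨a - o, by omega⟩, by simp; omega⟩
    obtain ⟨j, rfl⟩ : ∃ j : Fin 5, b = o + j := ⟨⟨b - o, by omega⟩, by simp; omega⟩
    rw [tailPairs_iff]
    have hij : i ≠ j := fun he => hab (by rw [he])
    clear h ha hb hab
    revert i j
    decide

/-- One more symbol `c` is added by the triangles of `c` and the edges of a directed cycle through
the symbols that are already there. -/
theorem IsPairCircuit.add_symbol {o c : ℕ} (ho : Even o) {H : List (Perm (Fin (o + 3)))}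
    (hH : IsOddCircuit H) (hc : c + 1 ≤ o)
    (h : ∃ L : List (Perm (Fin (o + 5))), IsPairCircuit (fun a b => c + 1 ≤ a ∧ c + 1 ≤ b) L) :
    ∃ L : List (Perm (Fin (o + 5))), IsPairCircuit (fun a b => c ≤ a ∧ c ≤ b) L := by
  have key : ∀ t, c + 1 ≤ t → t ≤ o + 4 → ∃ L : List (Perm (Fin (o + 5))),
      IsPairCircuit (fun a b => (c + 1 ≤ a ∧ c + 1 ≤ b) ∨ (a = c ∧ c < b ∧ b < t) ∨
        (b = c ∧ c + 1 < a ∧ a < t + 1)) L := by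
    intro t ht
    induction t, ht using Nat.le_induction with
    | base =>
      intro _
      obtain ⟨L, hL⟩ := h
      exact ⟨L, hL.congr fun a b _ _ _ => by omega⟩
    | succ t ht ih =>
      intro hto
      obtain ⟨L, hL⟩ := ih (by omega)
      obtain ⟨L', hL'⟩ := hL.add_triangle ho hH (p := c) (q := t) (r := t + 1) (by omega)
        (by omega) (by omega) (by omega) (by omega) (by omega) (by omega) (by omega) (by omega)
      exact ⟨L', hL'.congr fun a b _ _ _ => by omega⟩
  obtain ⟨L, hL⟩ := key (o + 4) (by omega) le_rfl
  obtain ⟨L', hL'⟩ := hL.add_triangle ho hH (p := c) (q := o + 4) (r := c + 1) (by omega)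
    (by omega) (by omega) (by omega) (by omega) (by omega) (by omega) (by omega) (by omega)
  exact ⟨L', hL'.congr fun a b _ _ _ => by omega⟩

theorem IsOddCircuit.exists_add_two {o : ℕ} (ho : Even o) (ho2 : 2 ≤ o)
    {H : List (Perm (Fin (o + 3)))} (hH : IsOddCircuit H) :
    ∃ L : List (Perm (Fin (o + 5))), IsOddCircuit L := by
  have key : ∀ t, t ≤ o → ∃ L : List (Perm (Fin (o + 5))),
      IsPairCircuit (fun a b => o - t ≤ a ∧ o - t ≤ b) L := by
    intro t
    induction t with
    | zero => exact fun _ => hH.exists_isPairCircuit_tail ho ho2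
    | succ t ih =>
      intro ht
      have h := ih (by omega)
      rw [show o - t = o - (t + 1) + 1 by omega] at h
      exact IsPairCircuit.add_symbol ho hH (by omega) h
  obtain ⟨L, hL⟩ := key o le_rfl
  refine ⟨L, hL.circuit, fun σ => ?_, hL.exists_edge⟩
  rw [hL.mem_iff]
  simp

/-! ### Codes given by explicit words -/

/-- The vector of `σ`, read as the digits of a number to the base `8`. -/
def encode {n : ℕ} (σ : Perm (Fin n)) : ℕ := Nat.ofDigits 8 (List.ofFn fun p => (σ p : ℕ))

/-- The effect of `t_{↑j}` on the number of a vector. -/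
def pushCode (j x : ℕ) : ℕ :=
  x / 8 ^ j * 8 ^ j + (x % 8 ^ (j - 1) * 8 + x / 8 ^ (j - 1) % 8)

theorem encode_injective {n : ℕ} (hn : n ≤ 8) : Function.Injective (encode (n := n)) := by
  intro σ τ h
  have := Nat.ofDigits_inj_of_len_eq (b := 8) (by omega) (by simp)
    (by simp only [List.mem_ofFn]; rintro _ ⟨p, rfl⟩; omega)
    (by simp only [List.mem_ofFn]; rintro _ ⟨p, rfl⟩; omega) h
  rw [List.ofFn_inj] at this
  ext p
  exact congrFun this p

theorem encode_push {n j : ℕ} (hn : n ≤ 8) (h1 : 1 < j) (hj : j ≤ n) (σ : Perm (Fin n)) :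
    encode (push 1 j σ) = pushCode j (encode σ) := by
  obtain ⟨i, rfl⟩ : ∃ i, j = i + 1 := ⟨j - 1, by omega⟩
  set l : List ℕ := List.ofFn fun p => (σ p : ℕ) with hl
  have hlen : l.length = n := by simp [hl]
  have hmem : ∀ x ∈ l, x < 8 := by
    simp only [hl, List.mem_ofFn]
    rintro _ ⟨p, rfl⟩
    omega
  have hi : i < l.length := by omega
  have h2 : (List.ofFn fun p => (push 1 (i + 1) σ p : ℕ)) =
      (l[i] :: l.take i) ++ l.drop (i + 1) := by
    refine List.ext_getElem (by simp [hlen]; omega) fun p hp hp' => ?_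
    rw [List.getElem_ofFn, push_apply le_rfl h1 hj]
    rw [List.length_ofFn] at hp
    rcases p with _ | p
    · simp [hl]
    · rw [if_neg (by simp)]
      split_ifs with h
      · simp only at h
        rw [List.getElem_append_left (by simp; omega)]
        simp [hl]
      · simp only at h
        rw [List.getElem_append_right (by simp; omega)]
        simp only [List.getElem_drop, hl, List.getElem_ofFn]
        congr 2
        ext
        simp
        omega
  have h3 : l = l.take i ++ l[i] :: l.drop (i + 1) := by
    rw [List.cons_getElem_drop_succ, List.take_append_drop]
  have htl : (l.take i).length = i := by rw [List.length_take]; omega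
  have ha : Nat.ofDigits 8 (l.take i) < 8 ^ i := by
    have := Nat.ofDigits_lt_base_pow_length (b := 8) (l := l.take i) (by omega)
      fun x hx => hmem x (List.mem_of_mem_take hx)
    rwa [htl] at this
  have hd := hmem l[i] (List.getElem_mem hi)
  have he : encode σ = Nat.ofDigits 8 (l.take i) +
      8 ^ i * (l[i] + 8 * Nat.ofDigits 8 (l.drop (i + 1))) := by
    rw [encode, ← hl]
    conv_lhs => rw [h3, Nat.ofDigits_append, htl, Nat.ofDigits_cons]
  rw [encode, h2, Nat.ofDigits_append, Nat.ofDigits_cons, List.length_cons, htl, pushCode, he,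
    Nat.add_sub_cancel]
  generalize Nat.ofDigits 8 (l.take i) = a at *
  generalize Nat.ofDigits 8 (l.drop (i + 1)) = b at *
  generalize l[i] = d at *
  have e1 : (a + 8 ^ i * (d + 8 * b)) / 8 ^ i = d + 8 * b := by
    rw [Nat.add_mul_div_left _ _ (by positivity), Nat.div_eq_of_lt ha, zero_add]
  have e2 : (a + 8 ^ i * (d + 8 * b)) % 8 ^ i = a := by
    rw [Nat.add_mul_mod_self_left, Nat.mod_eq_of_lt ha]
  have e3 : (a + 8 ^ i * (d + 8 * b)) / 8 ^ (i + 1) = b := by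
    rw [pow_succ, ← Nat.div_div_eq_div_mul, e1]
    omega
  rw [e1, e2, e3, show (d + 8 * b) % 8 = d by omega]
  ring

/-- The numbers of the vectors in a walk that begins with the number `x`. -/
def codeWalk : ℕ → List ℕ → List ℕ
  | _, [] => []
  | x, j :: js => x :: codeWalk (pushCode j x) js

theorem map_encode_walk {n : ℕ} (hn : n ≤ 8) {js : List ℕ} (hjs : ∀ j ∈ js, 1 < j ∧ j ≤ n)
    (σ : Perm (Fin n)) : (walk 1 σ js).map encode = codeWalk (encode σ) js := by
  induction js generalizing σ with
  | nil => rfl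
  | cons j js ih =>
    have hj := hjs j (by simp)
    rw [walk, List.map_cons, ih fun x hx => hjs x (List.mem_cons_of_mem _ hx),
      encode_push hn hj.1 hj.2, codeWalk]

/-- Checks that a walk which begins with the number `x` ends with the number `y`, and that the
numbers on its way have distinct residues modulo `M`, none of which is a bit of `mask`. -/
def checkWalk (M y : ℕ) : ℕ → ℕ → List ℕ → Bool
  | _, x, [] => x == y
  | mask, x, j :: js => !(mask.testBit (x % M)) &&
      checkWalk M y (mask ||| 1 <<< (x % M)) (pushCode j x) js

theorem nodup_of_checkWalk {M y mask x : ℕ} {js : List ℕ} (h : checkWalk M y mask x js = true) :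
    (codeWalk x js).Nodup ∧ (∀ z ∈ codeWalk x js, mask.testBit (z % M) = false) ∧
      js.foldl (fun z j => pushCode j z) x = y := by
  induction js generalizing mask x with
  | nil => simpa [checkWalk, codeWalk] using h
  | cons j js ih =>
    rw [checkWalk, Bool.and_eq_true, Bool.not_eq_true'] at h
    obtain ⟨h1, h2, h3⟩ := ih h.2
    simp only [Nat.testBit_or, Nat.shiftLeft_eq, one_mul, Nat.testBit_two_pow,
      Bool.or_eq_false_iff, decide_eq_false_iff_not] at h2
    refine ⟨?_, ?_, h3⟩
    · rw [codeWalk, List.nodup_cons]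
      exact ⟨fun hm => (h2 x hm).2 rfl, h1⟩
    · rw [codeWalk]
      simp only [List.mem_cons, forall_eq_or_imp]
      exact ⟨h.1, fun z hz => (h2 z hz).1⟩

theorem encode_walkEnd {n : ℕ} (hn : n ≤ 8) {js : List ℕ} (hjs : ∀ j ∈ js, 1 < j ∧ j ≤ n)
    (σ : Perm (Fin n)) :
    encode (walkEnd 1 σ js) = js.foldl (fun z j => pushCode j z) (encode σ) := by
  induction js generalizing σ with
  | nil => rfl
  | cons j js ih =>
    have hj := hjs j (by simp)
    rw [walkEnd_cons, ih fun x hx => hjs x (List.mem_cons_of_mem _ hx), encode_push hn hj.1 hj.2,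
      List.foldl_cons]

theorem isCircuit_walk {n : ℕ} {J : Set ℕ} {σ : Perm (Fin n)} {js : List ℕ} (hne : js ≠ [])
    (hjs : ∀ j ∈ js, j ∈ J ∧ 1 < j ∧ j ≤ n) (hend : walkEnd 1 σ js = σ)
    (hnd : (walk 1 σ js).Nodup) : IsCircuit (IsPush J) (walk 1 σ js) := by
  cases js with
  | nil => exact absurd rfl hne
  | cons j js =>
    have hw : walk 1 σ (j :: js) ≠ [] := by simp [walk]
    refine ⟨σ, _, ⟨rfl, List.getLast?_eq_some_getLast hw, ?_, hnd⟩, ?_⟩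
    · rw [List.isChain_iff_getElem]
      intro r hr
      have hr' : r < (j :: js).length := by rw [length_walk] at hr; omega
      obtain ⟨h1, h2, h3⟩ := hjs _ (List.getElem_mem hr')
      exact ⟨_, h1, h2, h3, walk_getElem_succ σ _ r hr⟩
    · obtain ⟨h1, h2, h3⟩ := hjs _ (List.getLast_mem (l := j :: js) (by simp))
      refine ⟨_, h1, h2, h3, ?_⟩
      rw [push_getLast_walk, hend]

theorem exists_infix_walk {n : ℕ} (σ : Perm (Fin n)) (A : List ℕ) (j j' : ℕ) (B : List ℕ) :
    ∃ x, [x, push 1 j x] <:+: walk 1 σ (A ++ j :: j' :: B) := by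
  induction A generalizing σ with
  | nil => exact ⟨σ, [], _, rfl⟩
  | cons a A ih =>
    obtain ⟨x, hx⟩ := ih (push 1 a σ)
    exact ⟨x, hx.trans (List.infix_cons List.infix_rfl)⟩

/-- The word of `l` odd indices `3`, `5`, `7` that are the digits `0`, `1`, `2` of `N` to the
base `3`. -/
def oddWord : ℕ → ℕ → List ℕ
  | 0, _ => []
  | l + 1, N => (2 * (N % 3) + 3) :: oddWord l (N / 3)

theorem oddWord_mem {l N : ℕ} : ∀ j ∈ oddWord l N, Odd j ∧ 1 < j ∧ j ≤ 7 := by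
  induction l generalizing N with
  | zero => simp [oddWord]
  | succ l ih =>
    rw [oddWord]
    simp only [List.mem_cons, forall_eq_or_imp]
    exact ⟨⟨⟨N % 3 + 1, by omega⟩, by omega, by omega⟩, ih⟩

theorem exists_circuit_of_checkWalk {n M : ℕ} (hn : n ≤ 8) {js : List ℕ} (hne : js ≠ [])
    (hjs : ∀ j ∈ js, Odd j ∧ 1 < j ∧ j ≤ n)
    (h : checkWalk M (encode (1 : Perm (Fin n))) 0 (encode (1 : Perm (Fin n))) js = true) :
    IsCircuit (IsPush {j | Odd j}) (walk 1 (1 : Perm (Fin n)) js) := by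
  obtain ⟨hnd, -, hend⟩ := nodup_of_checkWalk h
  have hjs' : ∀ j ∈ js, 1 < j ∧ j ≤ n := fun j hj => (hjs j hj).2
  refine isCircuit_walk hne hjs (encode_injective hn ?_) ?_
  · rw [encode_walkEnd hn hjs', hend]
  · rw [← map_encode_walk hn hjs'] at hnd
    exact hnd.of_map _

theorem sign_of_mem_walk {n : ℕ} {js : List ℕ} (hjs : ∀ j ∈ js, Odd j ∧ 1 < j ∧ j ≤ n)
    {σ : Perm (Fin n)} : ∀ τ ∈ walk 1 σ js, Perm.sign τ = Perm.sign σ := by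
  induction js generalizing σ with
  | nil => simp [walk]
  | cons j js ih =>
    obtain ⟨h1, h2, h3⟩ := hjs j (by simp)
    rw [walk]
    simp only [List.mem_cons, forall_eq_or_imp, true_and]
    intro τ hτ
    rw [ih (fun x hx => hjs x (List.mem_cons_of_mem _ hx)) τ hτ,
      sign_push le_rfl h2 h3 (h1.tsub_odd odd_one)]

/-- A fifth of the transition sequence of a Hamiltonian circuit of the alternating group on seven
symbols, which commutes with a cyclic shift of five of the symbols. -/
def word7 : List ℕ := 5 :: oddWord 503
  881493024505401281234110779815634887062642950922482889412413934979089798096396561722876347015506338960068204545169723436749711252003506371625537030721891078520311403522042343821794460240115350216700481625682363284561541824378632536226158062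

/-- The transition sequence of a circuit of `57` even permutations of five symbols. -/
def word5 : List ℕ := 5 :: 3 :: oddWord 55 84343019333256344148243591

theorem card_filter_sign_eq_one {n : ℕ} (hn : 2 ≤ n) :
    (Finset.univ.filter fun w : Perm (Fin n) => Perm.sign w = 1).card = n ! / 2 := by
  have : Nontrivial (Fin n) := Fin.nontrivial_iff_two_le.2 hn
  have h := card_alternatingGroup (α := Fin n)
  rw [Fintype.card_fin] at h
  rw [← h, ← Fintype.card_subtype]
  exact Fintype.card_congr (Equiv.subtypeEquivRight fun w => Perm.mem_alternatingGroup.symm)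

theorem IsOddCircuit.length_eq {n : ℕ} (hn : 2 ≤ n) {H : List (Perm (Fin n))}
    (hH : IsOddCircuit H) : H.length = n ! / 2 := by
  rw [← List.toFinset_card_of_nodup hH.circuit.nodup, ← card_filter_sign_eq_one hn]
  congr 1
  ext w
  simp [hH.mem_iff]

theorem exists_isOddCircuit_seven : ∃ H : List (Perm (Fin 7)), IsOddCircuit H := by
  -- the residue modulo `8 ^ 5` is given by the first five entries, which determine an even vector
  have hcheck : checkWalk (8 ^ 5) (encode (1 : Perm (Fin 7))) 0 (encode (1 : Perm (Fin 7)))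
      (word7 ++ word7 ++ word7 ++ word7 ++ word7) = true := by decide +kernel
  have hmem7 : ∀ j ∈ word7, Odd j ∧ 1 < j ∧ j ≤ 7 := by
    rw [word7]
    simp only [List.mem_cons, forall_eq_or_imp]
    exact ⟨by decide, oddWord_mem⟩
  have hlen7 : word7.length = 504 := by decide +kernel
  have hmem : ∀ j ∈ word7 ++ word7 ++ word7 ++ word7 ++ word7, Odd j ∧ 1 < j ∧ j ≤ 7 := by
    intro j hj
    simp only [List.mem_append, or_self] at hj
    exact hmem7 j hj
  have hc := exists_circuit_of_checkWalk (by omega) (by simp [word7]) hmem hcheck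
  refine ⟨_, hc, fun w => ⟨fun hw => ?_, fun hw => ?_⟩, ?_⟩
  · rw [sign_of_mem_walk hmem w hw, Perm.sign_one]
  · -- the circuit has as many members as the alternating group
    have hsub : (walk 1 (1 : Perm (Fin 7)) (word7 ++ word7 ++ word7 ++ word7 ++ word7)).toFinset ⊆
        Finset.univ.filter fun w : Perm (Fin 7) => Perm.sign w = 1 := fun v hv => by
      rw [List.mem_toFinset] at hv
      simp [sign_of_mem_walk hmem v hv]
    have := Finset.eq_of_subset_of_card_le hsub (by
      rw [card_filter_sign_eq_one (by omega), List.toFinset_card_of_nodup hc.nodup, length_walk]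
      simp only [List.length_append, hlen7]
      decide)
    rw [← List.mem_toFinset, this]
    simpa using hw
  · obtain ⟨j, B, hB⟩ : ∃ j B, word7 = 5 :: j :: B := ⟨_, _, rfl⟩
    obtain ⟨x, hx⟩ := exists_infix_walk (1 : Perm (Fin 7)) [] 5 j
      (B ++ (word7 ++ word7 ++ word7 ++ word7))
    refine ⟨x, hasEdge_of_infix ?_⟩
    convert hx using 2
    rw [List.append_assoc, List.append_assoc, List.append_assoc]
    conv_lhs => rw [hB]
    simp [hB]

/-- A circuit of `57` even permutations of five symbols which has edges `t_{↑3}` and `t_{↑5}`. -/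
theorem exists_circuit_five : ∃ H : List (Perm (Fin 5)), IsCircuit (IsPush {j | Odd j}) H ∧
    H.length = 57 ∧ (∀ w ∈ H, Perm.sign w = 1) ∧ (∃ w, HasEdge H w (push 1 3 w)) ∧
    HasEdge H 1 (push 1 5 1) := by
  -- the first three entries determine an even vector
  have hcheck : checkWalk (8 ^ 3) (encode (1 : Perm (Fin 5))) 0 (encode (1 : Perm (Fin 5)))
      word5 = true := by decide +kernel
  have hmem : ∀ j ∈ word5, Odd j ∧ 1 < j ∧ j ≤ 5 := by decide +kernel
  have hc := exists_circuit_of_checkWalk (by omega) (by simp [word5]) hmem hcheck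
  have hlen : word5.length = 57 := by decide +kernel
  refine ⟨_, hc, by rw [length_walk, hlen], fun w hw => by
    rw [sign_of_mem_walk hmem w hw, Perm.sign_one], ?_, ?_⟩
  · obtain ⟨x, hx⟩ := exists_infix_walk (1 : Perm (Fin 5)) [5] 3
      (2 * (84343019333256344148243591 % 3) + 3) _
    exact ⟨x, hasEdge_of_infix hx⟩
  · exact hasEdge_of_infix ⟨[], _, rfl⟩

theorem exists_isOddCircuit {m : ℕ} (hm : Odd m) (h7 : 7 ≤ m) :
    ∃ H : List (Perm (Fin m)), IsOddCircuit H := by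
  obtain ⟨t, rfl⟩ : ∃ t, m = 2 * t + 7 := by
    obtain ⟨t, rfl⟩ := hm
    exact ⟨t - 3, by omega⟩
  clear hm h7
  induction t with
  | zero => exact exists_isOddCircuit_seven
  | succ t ih =>
    obtain ⟨H, hH⟩ := ih
    exact IsOddCircuit.exists_add_two (o := 2 * t + 4) ⟨t + 2, by omega⟩ (by omega) hH

/-! ### Auxiliary codes -/

/-- A circuit of the right size which has the defining property of auxiliary codes, and in which
`t_{↑k}` pushes the symbol `k`, gives an auxiliary sequence. The relabelling that takes its start to
the identity fixes the symbol `k`, hence keeps that property. -/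
theorem exists_isAuxSeq_of_circuit {k : ℕ} {J : Set ℕ} {L : List (Perm (Fin k))}
    (hL : IsCircuit (IsPush J) L) (hk : 1 < k) (hlen : L.length = auxSize k)
    (haux : ∀ σ ∈ L, ∀ q l : Fin k, (l : ℕ) + 1 = k → q < l → swap q l * σ ∉ L)
    {x : Perm (Fin k)} (hx : HasEdge L x (push 1 k x))
    (hxk : ∀ l : Fin k, (l : ℕ) + 1 = k → x l = l) :
    ∃ js, IsAuxSeq k js := by
  obtain ⟨js, hjs, hhead, hmem, hend, hnd, hsub⟩ := hL.exists_generates hk le_rfl hx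
  have hne : js ≠ [] := by rintro rfl; simp at hhead
  refine ⟨js, hhead, walk 1 1 js, ?_, ⟨?_, ?_⟩, hmem, 1, rfl, hend⟩
  · cases js with
    | nil => exact absurd rfl hne
    | cons j js => rfl
  · rw [← hlen, ← hjs]
    exact isPushGrayCode_walk hne hmem hend hnd
  · intro w hw q l hl hq hw'
    have h1 := hsub _ hw'
    have h2 : x * (swap q l * w) = swap (x q) l * (x * w) := by
      rw [← mul_assoc, ← mul_assoc, Equiv.mul_swap_eq_swap_mul, hxk l hl]
    rw [h2] at h1
    refine haux _ (hsub _ hw) (x q) l hl ?_ h1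
    have hne' : x q ≠ l := fun he => hq.ne (x.injective (he.trans (hxk l hl).symm))
    have h3 := (x q).2
    have h4 : ((x q : Fin k) : ℕ) ≠ l := fun he => hne' (Fin.ext he)
    rw [Fin.lt_def]
    omega

/-- A code of even permutations is an auxiliary code. -/
theorem swap_mul_notMem {k : ℕ} {L : List (Perm (Fin k))} (hL : ∀ σ ∈ L, Perm.sign σ = 1) :
    ∀ σ ∈ L, ∀ q l : Fin k, (l : ℕ) + 1 = k → q < l → swap q l * σ ∉ L := by
  intro σ hσ q l _ hq h
  have := hL _ h
  rw [Perm.sign_mul, Perm.sign_swap hq.ne, hL σ hσ] at this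
  exact absurd this (by decide)

theorem exists_isAuxSeq_odd {k : ℕ} (hk : Odd k) (h7 : 7 ≤ k) : ∃ js, IsAuxSeq k js := by
  obtain ⟨H, hH⟩ := exists_isOddCircuit hk h7
  obtain ⟨w, hw, hwl⟩ := hH.exists_hasEdge_last (by omega) (l := ⟨k - 1, by omega⟩)
    (by simp only; omega) ⟨k - 1, by omega⟩
  refine exists_isAuxSeq_of_circuit hH.circuit (by omega) ?_
    (swap_mul_notMem fun σ hσ => (hH.mem_iff σ).1 hσ) hw fun l hl => ?_
  · rw [hH.length_eq (by omega), auxSize, if_neg (by omega), if_neg (by omega), if_neg (by omega),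
      if_pos (Nat.odd_iff.1 hk)]
  · have hl' : l = ⟨k - 1, by omega⟩ := Fin.ext (by simp only; omega)
    rw [hl']
    exact hwl

theorem exists_isAuxSeq_five : ∃ js, IsAuxSeq 5 js := by
  obtain ⟨H, hH, hlen, hsign, -, hx⟩ := exists_circuit_five
  exact exists_isAuxSeq_of_circuit hH (by omega) hlen (swap_mul_notMem hsign) hx fun _ _ => rfl

/-! ### Auxiliary codes for an even number of symbols -/

/-- The push `t_{↑m+1}` followed by `t_{m-2↑m+1}`; two pushes `t_{↑m+1}` are this permutation
followed by `t_{↑m-2}`. It exchanges the entries with the indices `m - 2` and `m`, and it permutes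
the others cyclically. -/
def shift (m : ℕ) : Perm (Fin (m + 1)) :=
  pushCycle (m + 1) 1 (m + 1) * pushCycle (m + 1) (m - 2) (m + 1)

theorem shift_apply {m : ℕ} (hm : 5 ≤ m) (p : Fin (m + 1)) :
    (shift m p : ℕ) =
      if (p : ℕ) = m - 3 then m - 1 else if (p : ℕ) = m - 2 then m - 4
      else if (p : ℕ) = m - 1 then m - 3 else if (p : ℕ) = m then m - 2
      else if (p : ℕ) = 0 then m else (p : ℕ) - 1 := by
  rw [shift, Perm.mul_apply, pushCycle_apply le_rfl (by omega) le_rfl,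
    pushCycle_apply (by omega) (by omega) le_rfl]
  have := p.2
  split_ifs <;> omega

/-- The symbol in the last position after `t` shifts of the identity. -/
def shiftLast (m t : ℕ) : ℕ := if t = 0 then m else if t = 1 then m - 2 else m - 2 - t

theorem shift_pow_last {m : ℕ} (hm : 5 ≤ m) {t : ℕ} (ht : t ≤ m - 2) :
    ((shift m ^ t) (Fin.last m) : ℕ) = shiftLast m t := by
  induction t with
  | zero => simp [shiftLast]
  | succ t ih =>
    rw [pow_succ', Perm.mul_apply, shift_apply hm, ih (by omega)]
    have h2 : ∀ t, shiftLast m (t + 2) = m - 4 - t := fun t => by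
      rw [shiftLast, if_neg (by omega), if_neg (by omega)]; omega
    rcases t with - | - | t
    · rw [show shiftLast m 0 = m from rfl, show shiftLast m (0 + 1) = m - 2 from rfl,
        if_neg (by omega), if_neg (by omega), if_neg (by omega), if_pos rfl]
    · rw [show shiftLast m (0 + 1) = m - 2 from rfl, h2, if_neg (by omega), if_pos rfl]
      omega
    · rw [h2, show t + 1 + 1 + 1 = t + 1 + 2 from rfl, h2]
      split_ifs <;> omega

theorem shift_pow_pair {m : ℕ} (hm : 5 ≤ m) (t : ℕ) {p : Fin (m + 1)}
    (hp : (p : ℕ) = m - 3 ∨ (p : ℕ) = m - 1) :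
    ((shift m ^ t) p : ℕ) = m - 3 ∨ ((shift m ^ t) p : ℕ) = m - 1 := by
  induction t with
  | zero => simpa using hp
  | succ t ih =>
    rw [pow_succ', Perm.mul_apply, shift_apply hm]
    split_ifs <;> omega

theorem shift_pow_eq_one {m : ℕ} (hm : 5 ≤ m) (hodd : Odd m) : shift m ^ (m - 1) = 1 := by
  have hlast : (shift m ^ (m - 1)) (Fin.last m) = Fin.last m := by
    rw [show m - 1 = m - 2 + 1 by omega, pow_succ', Perm.mul_apply]
    ext
    rw [shift_apply hm, shift_pow_last hm le_rfl, shiftLast]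
    simp only [Fin.val_last]
    split_ifs <;> omega
  ext p
  rw [Perm.one_apply]
  by_cases hp : (p : ℕ) = m - 3 ∨ (p : ℕ) = m - 1
  · obtain ⟨s, hs⟩ : Even (m - 1) := hodd.tsub_odd odd_one
    have h2 : (shift m ^ 2) p = p := by
      ext
      rw [pow_two, Perm.mul_apply]
      rcases hp with h | h
      · have h1 : (shift m p : ℕ) = m - 1 := by rw [shift_apply hm, if_pos h]
        rw [shift_apply hm, h1, if_neg (by omega), if_neg (by omega), if_pos rfl, h]
      · have h1 : (shift m p : ℕ) = m - 3 := by
          rw [shift_apply hm, if_neg (by omega), if_neg (by omega), if_pos h]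
        rw [shift_apply hm, h1, if_pos rfl, h]
    rw [show m - 1 = 2 * s by omega, pow_mul]
    clear hs
    induction s with
    | zero => simp
    | succ s ih => rw [pow_succ, Perm.mul_apply, h2, ih]
  · obtain ⟨s, hs, hps⟩ : ∃ s, s ≤ m - 2 ∧ (p : ℕ) = shiftLast m s := by
      have := p.2
      rcases eq_or_ne (p : ℕ) m with h | h
      · exact ⟨0, by omega, by simp [shiftLast, h]⟩
      rcases eq_or_ne (p : ℕ) (m - 2) with h' | h'
      · exact ⟨1, by omega, by simp [shiftLast, h']⟩
      · exact ⟨m - 2 - p, by omega, by unfold shiftLast; split_ifs <;> omega⟩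
    obtain rfl : p = (shift m ^ s) (Fin.last m) := Fin.ext (by rw [hps, shift_pow_last hm hs])
    rw [← Perm.mul_apply, ← pow_add, add_comm (m - 1) s, pow_add, Perm.mul_apply, hlast]

theorem shiftLast_injOn {m s t : ℕ} (hm : 5 ≤ m) (hs : s ≤ m - 2) (ht : t ≤ m - 2)
    (h : shiftLast m s = shiftLast m t) : s = t := by
  unfold shiftLast at h
  split_ifs at h <;> omega

theorem shiftLast_ne {m : ℕ} (hm : 5 ≤ m) (t : ℕ) :
    shiftLast m t ≠ m - 3 ∧ shiftLast m t ≠ m - 1 := by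
  unfold shiftLast
  split_ifs <;> omega

theorem sign_shift {m : ℕ} (hm : 5 ≤ m) (hodd : Odd m) : Perm.sign (shift m) = 1 := by
  rw [shift, Perm.sign_mul, sign_pushCycle le_rfl (by omega) le_rfl,
    sign_pushCycle (by omega) (by omega) le_rfl, show m + 1 - 1 = m by omega,
    show m + 1 - (m - 2) = 3 by omega, hodd.neg_one_pow]
  decide

theorem pushCycle_pow_apply {n j : ℕ} (h1 : 1 < j) (hj : j ≤ n) (i : ℕ) {p : Fin n}
    (hp : (p : ℕ) < j) : ((pushCycle n 1 j ^ i) p : ℕ) = (p + (j - 1) * i) % j := by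
  induction i with
  | zero => simp [Nat.mod_eq_of_lt hp]
  | succ i ih =>
    rw [pow_succ', Perm.mul_apply, pushCycle_apply le_rfl h1 hj, ih, mul_add, mul_one, ← add_assoc,
      Nat.add_mod (p + (j - 1) * i) (j - 1)]
    have hlt := Nat.mod_lt (p + (j - 1) * i) (by omega : 0 < j)
    generalize (p + (j - 1) * i) % j = a at *
    rw [Nat.mod_eq_of_lt (by omega : j - 1 < j)]
    split_ifs with h2 h3
    · rw [Nat.mod_eq_of_lt (by omega)]; omega
    · rw [show a + (j - 1) = a - 1 + j by omega, Nat.add_mod_right, Nat.mod_eq_of_lt (by omega)]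
    · omega

theorem pushCycle_pow_apply_of_ge {n j : ℕ} (h1 : 1 < j) (hj : j ≤ n) (i : ℕ) {p : Fin n}
    (hp : j ≤ (p : ℕ)) : (pushCycle n 1 j ^ i) p = p := by
  induction i with
  | zero => rfl
  | succ i ih =>
    rw [pow_succ', Perm.mul_apply, ih]
    ext
    rw [pushCycle_apply le_rfl h1 hj, if_neg (by omega), if_neg (by omega)]

/-- The orbit of a single push, cut open at the identity. -/
theorem exists_orbit_path {n j : ℕ} (h1 : 1 < j) (hj : j ≤ n) :
    ∃ L : List (Perm (Fin n)), IsPath (IsPush Set.univ) L (push 1 j 1) 1 ∧ L.length = j ∧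
      ∀ σ ∈ L, ∃ i : ℕ, σ = pushCycle n 1 j ^ i := by
  have hone : pushCycle n 1 j ^ j = 1 := by
    ext p
    rcases Nat.lt_or_ge (p : ℕ) j with hp | hp
    · rw [pushCycle_pow_apply h1 hj _ hp, Nat.add_mul_mod_self_right, Nat.mod_eq_of_lt hp,
        Perm.one_apply]
    · rw [pushCycle_pow_apply_of_ge h1 hj _ hp, Perm.one_apply]
  have hinj : ∀ a b, a < j → b < j → pushCycle n 1 j ^ (a + 1) = pushCycle n 1 j ^ (b + 1) →
      a = b := by
    intro a b ha hb hab
    have h2 := congrArg (fun σ : Perm (Fin n) => ((σ ⟨0, by omega⟩ : Fin n) : ℕ)) hab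
    simp only [pushCycle_pow_apply h1 hj _ (p := ⟨0, by omega⟩) (by simp only; omega)] at h2
    have h3 : (j - 1) * (a + 1) ≡ (j - 1) * (b + 1) [MOD j] := by
      simpa [Nat.ModEq] using h2
    have h4 : Nat.Coprime j (j - 1) := by
      obtain ⟨i, rfl⟩ : ∃ i, j = i + 1 := ⟨j - 1, by omega⟩
      simp
    have h5 := Nat.ModEq.add_right_cancel' 1 (Nat.ModEq.cancel_left_of_coprime h4 h3)
    rwa [Nat.ModEq, Nat.mod_eq_of_lt ha, Nat.mod_eq_of_lt hb] at h5
  obtain ⟨i, rfl⟩ : ∃ i, j = i + 1 := ⟨j - 1, by omega⟩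
  refine ⟨(List.range (i + 1)).map fun a => pushCycle n 1 (i + 1) ^ (a + 1), ⟨?_, ?_, ?_, ?_⟩,
    by simp, ?_⟩
  · rw [List.range_succ_eq_map]
    simp [push]
  · rw [List.range_succ]
    simp [hone]
  · rw [List.isChain_map, List.isChain_iff_getElem]
    intro a ha
    simp only [List.getElem_range]
    exact ⟨i + 1, trivial, h1, hj, by rw [push, ← pow_succ]⟩
  · refine List.Nodup.map_on (fun a ha b hb hab => ?_) List.nodup_range
    rw [List.mem_range] at ha hb
    exact hinj a b ha hb hab
  · intro σ hσ
    obtain ⟨a, -, rfl⟩ := List.mem_map.1 hσ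
    exact ⟨_, rfl⟩

/-- The push `t_{↑m+1}` of the shifted vectors. -/
def pushShift (m t : ℕ) : Perm (Fin (m + 1)) := push 1 (m + 1) (shift m ^ t)

theorem push_pushShift {m : ℕ} (hm : 5 ≤ m) (t : ℕ) :
    push 1 (m + 1) (pushShift m t) = push 1 (m - 2) (shift m ^ (t + 1)) := by
  have h := push_push le_rfl (by omega : 1 < m - 2) (by omega : m - 2 < m + 1) le_rfl
    (pushShift m t)
  rw [← h, pushShift, pow_succ, shift]
  simp only [push, mul_assoc]

theorem sign_pushShift {m : ℕ} (hm : 5 ≤ m) (hodd : Odd m) (t : ℕ) :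
    Perm.sign (pushShift m t) = -1 := by
  rw [pushShift, push, Perm.sign_mul, map_pow, sign_shift hm hodd, one_pow, one_mul,
    sign_pushCycle le_rfl (by omega) le_rfl, Nat.add_sub_cancel, hodd.neg_one_pow]

theorem pushShift_zero {m : ℕ} (hm : 5 ≤ m) {t : ℕ} (ht : t ≤ m - 2) :
    (pushShift m t 0 : ℕ) = shiftLast m t := by
  rw [pushShift, push_apply le_rfl (by omega) le_rfl, if_pos (by simp), ← shift_pow_last hm ht]
  rfl

theorem pushShift_pair {m : ℕ} (hm : 5 ≤ m) (t : ℕ) {p : Fin (m + 1)}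
    (hp : (p : ℕ) = m - 2 ∨ (p : ℕ) = m) :
    (pushShift m t p : ℕ) = m - 3 ∨ (pushShift m t p : ℕ) = m - 1 := by
  rw [pushShift, push_apply le_rfl (by omega) le_rfl, if_neg (by omega), if_pos (by omega)]
  exact shift_pow_pair hm t (by simp only; omega)

/-- The members of the auxiliary code for `m + 1` symbols up to the `t`th shift: even permutations
with the last entry `m`, in which the third last entry is in its place, even permutations with the
last entry of one of the shifted vectors, and the odd permutations that lead from one shifted vector
to the next one. -/
def IsShiftMember (m t : ℕ) (hm : 5 ≤ m) (σ : Perm (Fin (m + 1))) : Prop :=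
  (Perm.sign σ = 1 ∧ σ (Fin.last m) = Fin.last m ∧ (σ ⟨m - 2, by omega⟩ : ℕ) = m - 2) ∨
    (∃ s, 1 ≤ s ∧ s ≤ t ∧ Perm.sign σ = 1 ∧ (σ (Fin.last m) : ℕ) = shiftLast m s) ∨
    ∃ s, s ≤ t ∧ σ = pushShift m s

theorem IsShiftMember.mono {m t t' : ℕ} {hm : 5 ≤ m} {σ : Perm (Fin (m + 1))}
    (h : IsShiftMember m t hm σ) (ht : t ≤ t') : IsShiftMember m t' hm σ := by
  rcases h with h | ⟨s, h1, h2, h3⟩ | ⟨s, h1, h2⟩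
  · exact Or.inl h
  · exact Or.inr (Or.inl ⟨s, h1, h2.trans ht, h3⟩)
  · exact Or.inr (Or.inr ⟨s, h1.trans ht, h2⟩)

/-- The odd members have the symbols `m - 3` and `m - 1` in the last and the third last position,
whereas each even member has in one of these two places a symbol that is neither one of them nor the
largest symbol. Hence an exchange of the largest symbol with another one does not turn an odd member
into an even one. -/
theorem not_isShiftMember_swap_mul {m t : ℕ} (hm : 5 ≤ m) (hodd : Odd m) {q l : Fin (m + 1)}
    (hl : l = Fin.last m) (hq : q < l) (s : ℕ) :
    ¬ IsShiftMember m t hm (swap q l * pushShift m s) := by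
  have key : ∀ p : Fin (m + 1), (p : ℕ) = m - 2 ∨ (p : ℕ) = m →
      ((swap q l * pushShift m s) p : ℕ) = m - 3 ∨ ((swap q l * pushShift m s) p : ℕ) = m - 1 ∨
      ((swap q l * pushShift m s) p : ℕ) = m := by
    intro p hp
    have h := pushShift_pair hm s hp
    rw [Perm.mul_apply, swap_apply_def]
    split_ifs with h1 h2
    · right; right; rw [hl]; rfl
    · rw [h2, hl, Fin.val_last] at h; omega
    · tauto
  rintro (⟨-, -, h⟩ | ⟨r, h1, h2, -, h⟩ | ⟨r, -, h⟩)
  · have := key ⟨m - 2, by omega⟩ (Or.inl rfl)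
    omega
  · have h3 := key (Fin.last m) (Or.inr rfl)
    have h4 := shiftLast_ne hm r
    have h5 : shiftLast m r ≠ m := by
      unfold shiftLast
      split_ifs <;> omega
    omega
  · have := congrArg Perm.sign h
    rw [Perm.sign_mul, sign_pushShift hm hodd, sign_pushShift hm hodd, Perm.sign_swap hq.ne] at this
    exact absurd this (by decide)

theorem IsShiftMember.swap_mul {m t : ℕ} {hm : 5 ≤ m} (hodd : Odd m) {q l : Fin (m + 1)}
    (hl : l = Fin.last m) (hq : q < l) {σ : Perm (Fin (m + 1))} (h : IsShiftMember m t hm σ) :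
    ¬ IsShiftMember m t hm (swap q l * σ) := by
  intro h'
  have hsign : ∀ τ, IsShiftMember m t hm τ → Perm.sign τ = 1 ∨ ∃ s, τ = pushShift m s := by
    rintro τ (h | ⟨s, -, -, h, -⟩ | ⟨s, -, h⟩)
    · exact Or.inl h.1
    · exact Or.inl h
    · exact Or.inr ⟨s, h⟩
  rcases hsign _ h with h1 | ⟨s, rfl⟩
  · rcases hsign _ h' with h2 | ⟨s, h2⟩
    · rw [Perm.sign_mul, Perm.sign_swap hq.ne, h1] at h2
      exact absurd h2 (by decide)
    · refine not_isShiftMember_swap_mul hm hodd hl hq s (t := t) ?_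
      rw [← h2, swap_mul_self_mul]
      exact h
  · exact not_isShiftMember_swap_mul hm hodd hl hq s h'

/-- A path through the cosets of the shifted vectors. Each coset is traversed by a copy of the
circuit `H` of even permutations, cut open at an edge `t_{↑m-2}`; in the coset of the identity
only the orbit of `t_{↑m-2}` is used, because that coset also contains vectors that arise from
the odd members by an exchange with the largest symbol. Two pushes `t_{↑m+1}` lead from one coset
to the next, by way of an odd member. -/
theorem exists_shift_path {m : ℕ} (hm : 5 ≤ m) (hodd : Odd m) {H : List (Perm (Fin m))}
    (hH : IsCircuit (IsPush {j | Odd j}) H) (hsign : ∀ w ∈ H, Perm.sign w = 1) {w₀ : Perm (Fin m)}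
    (hw₀ : HasEdge H w₀ (push 1 (m - 2) w₀)) {t : ℕ} (ht : t ≤ m - 2) :
    ∃ L, IsPath (IsPush Set.univ) L (push 1 (m - 2) 1) (pushShift m t) ∧
      L.length = m - 2 + 1 + t * (H.length + 1) ∧ [1, push 1 (m + 1) 1] <:+: L ∧
      ∀ σ ∈ L, IsShiftMember m t hm σ := by
  have hsingle : ∀ t, IsPath (IsPush Set.univ) [pushShift m t] (pushShift m t) (pushShift m t) :=
    fun t => ⟨rfl, rfl, List.isChain_singleton _, List.nodup_singleton _⟩
  have hsub : Even (m - 2 - 1) := by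
    obtain ⟨a, rfl⟩ := hodd
    exact ⟨a - 1, by omega⟩
  induction t with
  | zero =>
    obtain ⟨L, hL, hlen, hmem⟩ := exists_orbit_path (n := m + 1) (j := m - 2) (by omega) (by omega)
    have hA : ∀ σ ∈ L, Perm.sign σ = 1 ∧ σ (Fin.last m) = Fin.last m ∧
        (σ ⟨m - 2, by omega⟩ : ℕ) = m - 2 := by
      intro σ hσ
      obtain ⟨i, rfl⟩ := hmem σ hσ
      refine ⟨?_, ?_, ?_⟩
      · rw [map_pow, sign_pushCycle le_rfl (by omega) (by omega), hsub.neg_one_pow, one_pow]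
      · exact pushCycle_pow_apply_of_ge (by omega) (by omega) i (by rw [Fin.val_last]; omega)
      · rw [pushCycle_pow_apply_of_ge (by omega) (by omega) i (by simp)]
    have hpush : pushShift m 0 = push 1 (m + 1) 1 := by rw [pushShift, pow_zero]
    refine ⟨L ++ [pushShift m 0], hL.append (hsingle 0) ?_ ?_, by simp [hlen], ?_, ?_⟩
    · rw [hpush]
      exact isPush_push (Set.mem_univ _) (by omega) le_rfl _
    · intro σ hσ h
      rw [List.mem_singleton] at h
      have := (hA σ hσ).1
      rw [h, sign_pushShift hm hodd] at this
      exact absurd this (by decide)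
    · obtain ⟨A, hA'⟩ := List.getLast?_eq_some_iff.1 hL.last
      exact ⟨A, [], by rw [hA', hpush]; simp⟩
    · intro σ hσ
      rcases List.mem_append.1 hσ with h | h
      · exact Or.inl (hA σ h)
      · exact Or.inr (Or.inr ⟨0, le_rfl, List.mem_singleton.1 h⟩)
  | succ t ih =>
    obtain ⟨L, hL, hlen, hinf, hmem⟩ := ih (by omega)
    obtain ⟨B, hB, hBlen, hBmem, -⟩ := exists_coset_path (n := m + 1) (by omega) hH (by omega)
      (by omega) hw₀ (shift m ^ (t + 1))
    have hB' : ∀ σ ∈ B, Perm.sign σ = 1 ∧ (σ (Fin.last m) : ℕ) = shiftLast m (t + 1) := by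
      intro σ hσ
      obtain ⟨w, hw, rfl⟩ := (hBmem σ).1 hσ
      refine ⟨?_, ?_⟩
      · rw [Perm.sign_mul, map_pow, sign_shift hm hodd, one_pow, one_mul, sign_window,
          Perm.sign_mul, Perm.sign_inv, hsign w hw, hsign w₀ hw₀.mem_left, mul_one]
      · rw [Perm.mul_apply, window_apply_of_ge _ _ (by simp), shift_pow_last hm ht]
    have hnot : ∀ σ, Perm.sign σ = 1 → ∀ s, σ ≠ pushShift m s := by
      rintro σ h s rfl
      rw [sign_pushShift hm hodd] at h
      exact absurd h (by decide)
    refine ⟨L ++ (B ++ [pushShift m (t + 1)]), hL.append ((hB.mono fun _ _ => IsPush.mono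
      (Set.subset_univ _)).append (hsingle _) ?_ ?_) ?_ ?_, ?_, ?_, ?_⟩
    · exact isPush_push (Set.mem_univ _) (by omega) le_rfl _
    · intro σ hσ h
      exact hnot σ (hB' σ hσ).1 _ (List.mem_singleton.1 h)
    · rw [← push_pushShift hm]
      exact isPush_push (Set.mem_univ _) (by omega) le_rfl _
    · intro σ hσ h
      rcases List.mem_append.1 h with h | h
      · obtain ⟨h1, h2⟩ := hB' σ h
        rcases hmem σ hσ with ⟨-, h3, -⟩ | ⟨s, -, h3, -, h4⟩ | ⟨s, -, h3⟩
        · have h5 := shiftLast_injOn hm (Nat.zero_le _) ht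
            (h2 ▸ by rw [h3, Fin.val_last]; rfl)
          omega
        · have h5 := shiftLast_injOn hm (by omega) ht (h4.symm.trans h2)
          omega
        · exact hnot σ h1 s h3
      · rw [List.mem_singleton] at h
        subst h
        rcases hmem _ hσ with ⟨h3, -⟩ | ⟨s, -, -, h3, -⟩ | ⟨s, h4, h3⟩
        · exact hnot _ h3 _ rfl
        · exact hnot _ h3 _ rfl
        · have h5 := congrArg (fun σ : Perm (Fin (m + 1)) => (σ 0 : ℕ)) h3
          simp only [pushShift_zero hm ht, pushShift_zero hm (h4.trans (by omega))] at h5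
          have := shiftLast_injOn hm ht (by omega) h5
          omega
    · simp only [List.length_append, hlen, hBlen, List.length_singleton]
      ring
    · exact hinf.trans ⟨[], B ++ [pushShift m (t + 1)], by simp⟩
    · intro σ hσ
      rcases List.mem_append.1 hσ with h | h
      · exact (hmem σ h).mono (by omega)
      rcases List.mem_append.1 h with h | h
      · exact Or.inr (Or.inl ⟨t + 1, by omega, le_rfl, hB' σ h⟩)
      · exact Or.inr (Or.inr ⟨t + 1, le_rfl, List.mem_singleton.1 h⟩)

/-- The path through all the cosets closes up, since the shift has order `m - 1`. -/
theorem exists_isAuxSeq_succ {m : ℕ} (hm : 5 ≤ m) (hodd : Odd m) {H : List (Perm (Fin m))}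
    (hH : IsCircuit (IsPush {j | Odd j}) H) (hsign : ∀ w ∈ H, Perm.sign w = 1) {w₀ : Perm (Fin m)}
    (hw₀ : HasEdge H w₀ (push 1 (m - 2) w₀))
    (hlen : (m - 2) * (H.length + 2) + 1 = auxSize (m + 1)) : ∃ js, IsAuxSeq (m + 1) js := by
  obtain ⟨L, hL, hLlen, hinf, hmem⟩ := exists_shift_path hm hodd hH hsign hw₀ le_rfl
  have hclose : push 1 (m + 1) (pushShift m (m - 2)) = push 1 (m - 2) 1 := by
    rw [push_pushShift hm, show m - 2 + 1 = m - 1 by omega, shift_pow_eq_one hm hodd]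
  refine exists_isAuxSeq_of_circuit (L := L) ⟨_, _, hL, ?_⟩ (by omega) ?_ ?_ (hasEdge_of_infix hinf)
    fun l _ => rfl
  · rw [← hclose]
    exact isPush_push (Set.mem_univ _) (by omega) le_rfl _
  · rw [hLlen, ← hlen]
    ring
  · intro σ hσ q l hl hq h
    exact (hmem σ hσ).swap_mul hodd (Fin.ext (by rw [Fin.val_last]; omega)) hq (hmem _ h)

theorem exists_isAuxSeq_three : ∃ js, IsAuxSeq 3 js := by
  have hmem : ∀ j ∈ [3, 3, 3], Odd j ∧ 1 < j ∧ j ≤ 3 := by decide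
  have hc := exists_circuit_of_checkWalk (n := 3) (M := 8 ^ 3) (by omega) (by simp) hmem
    (by decide +kernel)
  refine exists_isAuxSeq_of_circuit hc (by omega) rfl (swap_mul_notMem fun w hw => ?_)
    (hasEdge_of_infix ⟨[], _, rfl⟩) fun _ _ => rfl
  rw [sign_of_mem_walk hmem w hw, Perm.sign_one]

theorem exists_isAuxSeq_four : ∃ js, IsAuxSeq 4 js := by
  have hmem : ∀ j ∈ [4, 4, 3, 4, 4, 4, 3, 4], 1 < j ∧ j ≤ 4 := by decide
  have hmem' : ∀ j ∈ [4, 4, 3, 4, 4, 4, 3, 4], j ∈ Set.univ ∧ 1 < j ∧ j ≤ 4 :=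
    fun j hj => ⟨Set.mem_univ j, hmem j hj⟩
  have h1 : walkEnd 1 (1 : Perm (Fin 4)) [4, 4, 3, 4, 4, 4, 3, 4] = 1 := by decide +kernel
  have h2 : (walk 1 (1 : Perm (Fin 4)) [4, 4, 3, 4, 4, 4, 3, 4]).Nodup := by decide +kernel
  have h3 : ∀ σ ∈ walk 1 (1 : Perm (Fin 4)) [4, 4, 3, 4, 4, 4, 3, 4], ∀ q l : Fin 4,
      (l : ℕ) + 1 = 4 → q < l →
        swap q l * σ ∉ walk 1 (1 : Perm (Fin 4)) [4, 4, 3, 4, 4, 4, 3, 4] := by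
    decide +kernel
  exact exists_isAuxSeq_of_circuit (isCircuit_walk (by simp) hmem' h1 h2) (by omega) rfl h3
    (hasEdge_of_infix ⟨[], _, rfl⟩) fun _ _ => rfl

theorem exists_isAuxSeq {k : ℕ} (hk : 3 ≤ k) : ∃ js, IsAuxSeq k js := by
  rcases Nat.even_or_odd k with he | ho
  · rcases eq_or_ne k 4 with rfl | h4
    · exact exists_isAuxSeq_four
    obtain ⟨m, rfl⟩ : ∃ m, k = m + 1 := ⟨k - 1, by omega⟩
    have hodd : Odd m := by
      rcases Nat.even_or_odd m with h | h
      · exact absurd he (Nat.not_even_iff_odd.2 h.add_one)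
      · exact h
    rcases eq_or_ne m 5 with rfl | h5
    · obtain ⟨H, hH, hlen, hsign, ⟨w, hw⟩, -⟩ := exists_circuit_five
      exact exists_isAuxSeq_succ le_rfl hodd hH hsign hw (by rw [hlen]; rfl)
    · have h7 : 7 ≤ m := by obtain ⟨a, rfl⟩ := hodd; omega
      obtain ⟨H, hH⟩ := exists_isOddCircuit hodd h7
      obtain ⟨w, hw⟩ := hH.edge
      refine exists_isAuxSeq_succ (by omega) hodd hH.circuit (fun w hw => (hH.mem_iff w).1 hw) hw ?_
      rw [hH.length_eq (by omega), auxSize, if_neg (by omega), if_neg (by omega), if_neg (by omega),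
        if_neg (by have := Nat.even_iff.1 he; omega)]
      rfl
  · rcases eq_or_ne k 3 with rfl | h3
    · exact exists_isAuxSeq_three
    rcases eq_or_ne k 5 with rfl | h5
    · exact exists_isAuxSeq_five
    · exact exists_isAuxSeq_odd ho (by obtain ⟨a, rfl⟩ := ho; omega)

/-! ### The recursive codes -/

theorem Stage.ne_nil {s : ℕ → ℕ} {b m : ℕ} {T₀ T : List ℕ} (hT : Stage s b T₀ m T) (h₀ : T₀ ≠ []) :
    T ≠ [] := by
  induction hT with
  | base => exact h₀
  | step m T aux _ _ _ ih =>
    cases T with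
    | nil => exact absurd rfl ih
    | cons j T => simp

theorem exists_stage {s : ℕ → ℕ} {b : ℕ} (hb : 1 ≤ b) (hs : ∀ m, 1 ≤ m → m < b → 2 ≤ s m)
    (T₀ : List ℕ) : ∃ T, Stage s b T₀ 1 T := by
  refine Nat.decreasingInduction' (P := fun m => ∃ T, Stage s b T₀ m T) ?_ hb ⟨T₀, Stage.base⟩
  rintro m hmb hm ⟨T, hT⟩
  obtain ⟨aux, haux⟩ := exists_isAuxSeq (k := s m + 1) (by have := hs m hm hmb; omega)
  exact ⟨_, Stage.step m T aux hm hT haux⟩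

/-- The recursion that begins with the transition sequence of a complete code for the last block. -/
theorem isRecursiveCode_isPushGrayLMRM {n d : ℕ} {s : ℕ → ℕ} {σ₀ : Perm (Fin n)} (hd : 1 ≤ d)
    (hs : 1 ≤ s d) (hn : offset s (d + 1) ≤ n)
    (hmod : ∀ m, 1 ≤ m → m ≤ d → ∀ p q : Fin n, offset s m ≤ (p : ℕ) →
      (p : ℕ) < offset s (m + 1) → offset s m ≤ (q : ℕ) → (q : ℕ) < offset s (m + 1) →
      (σ₀ p : ℕ) ≡ σ₀ q [MOD d]) {C : List (Perm (Fin n))} (hC : IsRecursiveCode s d σ₀ C) :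
    IsPushGrayLMRM 1 n ((s d)! * ∏ i ∈ Finset.Ico 1 d, auxSize (s i + 1)) d C := by
  obtain ⟨r, T, hr, hT, rfl⟩ := hC
  have hmodd := hmod d hd le_rfl
  rw [offset_succ s hd] at hn hmodd
  obtain ⟨h₀, hlen⟩ := hr.isSpreadWalk hn hmodd
  have hne : r ≠ [] := List.ne_nil_of_length_pos (hlen ▸ Nat.factorial_pos _)
  rw [← hlen, ← List.length_map (f := fun x => offset s d + x)]
  exact hT.isPushGrayLMRM hd (by omega) (fun m h1 h2 => hmod m h1 h2.le) h₀
    (List.length_pos_of_ne_nil (hT.ne_nil (by simpa using hne)))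

theorem exists_isRecursiveCode {n d : ℕ} {s : ℕ → ℕ} (σ₀ : Perm (Fin n)) (hd : 1 ≤ d)
    (hs : ∀ m, 1 ≤ m → m ≤ d → 2 ≤ s m) : ∃ C, IsRecursiveCode s d σ₀ C := by
  obtain ⟨r, hr⟩ := exists_isCompleteSeq (s d) (hs d hd le_rfl)
  obtain ⟨T, hT⟩ := exists_stage hd (fun m h1 h2 => hs m h1 h2.le) (r.map fun x => offset s d + x)
  exact ⟨_, r, T, hr, hT, rfl⟩

/-! ### Blocks of equal length -/

theorem offset_const (k : ℕ) (m : ℕ) : offset (fun _ => k) m = (m - 1) * k := by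
  simp [offset]

theorem exists_isStartPerm {k d : ℕ} (hk : 1 ≤ k) : ∃ σ₀, IsStartPerm k d σ₀ := by
  have hdiv : ∀ p : Fin (k * d), (p : ℕ) / k < d := fun p => Nat.div_lt_of_lt_mul p.2
  have hlt : ∀ p : Fin (k * d), d * (((p : ℕ) + 1) % k) + (p : ℕ) / k < k * d := by
    intro p
    have h1 := Nat.mod_lt ((p : ℕ) + 1) hk
    calc d * (((p : ℕ) + 1) % k) + (p : ℕ) / k < d * (((p : ℕ) + 1) % k) + d := by
          have := hdiv p; omega
      _ = d * (((p : ℕ) + 1) % k + 1) := by ring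
      _ ≤ d * k := Nat.mul_le_mul_left _ h1
      _ = k * d := mul_comm _ _
  let f : Fin (k * d) → Fin (k * d) := fun p => ⟨_, hlt p⟩
  have hf : Function.Injective f := by
    intro p q h
    have h := congrArg Fin.val h
    simp only [f] at h
    have hd : 0 < d := (Nat.zero_le _).trans_lt (hdiv p)
    have h1 := congrArg (· / d) h
    have h2 := congrArg (· % d) h
    simp only [Nat.mul_add_div hd, Nat.div_eq_of_lt (hdiv _), Nat.mul_add_mod,
      Nat.mod_eq_of_lt (hdiv _), add_zero] at h1 h2
    have h3 : (p : ℕ) % k = q % k := Nat.ModEq.add_right_cancel' 1 h1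
    ext
    rw [← Nat.div_add_mod (p : ℕ) k, ← Nat.div_add_mod (q : ℕ) k, h2, h3]
  refine ⟨Equiv.ofBijective f (Finite.injective_iff_bijective.1 hf), fun p => ?_⟩
  have hceil : ((p : ℕ) + 1) ⌈/⌉ k = p / k + 1 := by
    rw [Nat.ceilDiv_eq_add_pred_div, show (p : ℕ) + 1 + k - 1 = p + k by omega,
      Nat.add_div_right _ hk]
  rw [hceil]
  rfl

theorem IsStartPerm.modEq {k d : ℕ} {σ₀ : Perm (Fin (k * d))} (h : IsStartPerm k d σ₀) {m : ℕ}
    (hm : 1 ≤ m) {p : Fin (k * d)} (hp : (m - 1) * k ≤ (p : ℕ)) (hp' : (p : ℕ) < m * k) :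
    (σ₀ p : ℕ) ≡ m - 1 [MOD d] := by
  have hk : 0 < k := Nat.pos_of_ne_zero (by rintro rfl; simp at hp')
  have hdiv : (p : ℕ) / k = m - 1 := Nat.div_eq_of_lt_le hp (by rwa [Nat.sub_add_cancel hm])
  have hceil : ((p : ℕ) + 1) ⌈/⌉ k = m := by
    rw [Nat.ceilDiv_eq_add_pred_div, show (p : ℕ) + 1 + k - 1 = p + k by omega,
      Nat.add_div_right _ hk, hdiv]
    omega
  have h1 := h p
  rw [hceil] at h1
  have h2 : (σ₀ p : ℕ) = d * (((p : ℕ) + 1) % k) + (m - 1) := by omega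
  rw [h2, Nat.ModEq, Nat.mul_add_mod]

/-! ### Congruence classes -/

theorem classSize_eq {n d m : ℕ} (hm : 1 ≤ m) (hmd : m ≤ d) :
    classSize n d m = n / d + if m ≤ n % d then 1 else 0 := by
  have h := Nat.count_modEq_card n (by omega : 0 < d) (m - 1)
  rw [Nat.mod_eq_of_lt (by omega : m - 1 < d)] at h
  have hiff : m - 1 < n % d ↔ m ≤ n % d := by omega
  simp only [hiff] at h
  rw [← h, Nat.count_eq_card_filter_range, classSize, congClass]
  symm
  refine Finset.card_bij (fun x _ => x + 1) ?_ (fun _ _ _ _ h => by omega) ?_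
  · intro x hx
    simp only [Finset.mem_filter, Finset.mem_range, Finset.mem_Icc] at hx ⊢
    refine ⟨by omega, ?_⟩
    have := hx.2.add_right 1
    rwa [Nat.sub_add_cancel hm] at this
  · intro y hy
    simp only [Finset.mem_filter, Finset.mem_range, Finset.mem_Icc] at hy ⊢
    refine ⟨y - 1, ⟨by omega, Nat.ModEq.add_right_cancel' 1 ?_⟩, by omega⟩
    rw [Nat.sub_add_cancel hm, Nat.sub_add_cancel hy.1.1]
    exact hy.2

theorem offset_classSize {n d m : ℕ} (hm : m ≤ d) :
    offset (classSize n d) (m + 1) = m * (n / d) + min m (n % d) := by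
  induction m with
  | zero => simp [offset_one]
  | succ m ih =>
    rw [offset_succ _ (by omega), ih (by omega), classSize_eq (by omega) hm, add_mul, one_mul]
    split_ifs <;> omega

theorem offset_classSize_last {n d : ℕ} (hd : 1 ≤ d) : offset (classSize n d) (d + 1) = n := by
  rw [offset_classSize le_rfl, min_eq_right (Nat.mod_lt _ hd).le, Nat.div_add_mod]

/-- The number `v` with the quotient `v / d` goes to the place `v / d` of the block of its class. -/
theorem exists_isConcatPerm {n d : ℕ} (hd : 1 ≤ d) : ∃ σ₀, IsConcatPerm n d σ₀ := by
  have hblock : ∀ v : Fin n, (v : ℕ) / d < classSize n d ((v : ℕ) % d + 1) := by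
    intro v
    have hmod := Nat.mod_lt (v : ℕ) hd
    rw [classSize_eq (by omega) hmod]
    have h1 : (v : ℕ) / d ≤ n / d := Nat.div_le_div_right v.2.le
    rcases h1.lt_or_eq with h1 | h1
    · omega
    · have h2 := Nat.div_add_mod (v : ℕ) d
      have h3 := Nat.div_add_mod n d
      have h4 := v.2
      rw [h1] at h2
      rw [if_pos (by omega)]
      omega
  have hlt : ∀ v : Fin n,
      offset (classSize n d) ((v : ℕ) % d + 1) + (v : ℕ) / d <
        offset (classSize n d) ((v : ℕ) % d + 1 + 1) := by
    intro v
    rw [offset_succ _ (by omega : 1 ≤ (v : ℕ) % d + 1)]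
    have := hblock v
    omega
  have hn : ∀ v : Fin n, offset (classSize n d) ((v : ℕ) % d + 1 + 1) ≤ n := by
    intro v
    have h1 := Nat.mod_lt (v : ℕ) hd
    exact (offset_mono _ (by omega)).trans (offset_classSize_last hd).le
  -- the blocks are disjoint
  have hdisj : ∀ {m m' p : ℕ}, offset (classSize n d) m ≤ p → p < offset (classSize n d) (m + 1) →
      offset (classSize n d) m' ≤ p → p < offset (classSize n d) (m' + 1) → m = m' := by
    intro m m' p h1 h2 h3 h4
    rcases lt_trichotomy m m' with h | h | h
    · have := offset_mono (classSize n d) (by omega : m + 1 ≤ m'); omega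
    · exact h
    · have := offset_mono (classSize n d) (by omega : m' + 1 ≤ m); omega
  let f : Fin n → Fin n := fun v => ⟨_, (hlt v).trans_le (hn v)⟩
  have hf : Function.Injective f := by
    intro v w h
    have h := congrArg Fin.val h
    simp only [f] at h
    have h1 : (v : ℕ) % d + 1 = (w : ℕ) % d + 1 :=
      hdisj (Nat.le_add_right _ _) (hlt v) (h ▸ Nat.le_add_right _ _) (h ▸ hlt w)
    rw [h1] at h
    have h2 : (v : ℕ) / d = w / d := by omega
    have h3 : (v : ℕ) % d = w % d := by omega
    ext
    rw [← Nat.div_add_mod (v : ℕ) d, ← Nat.div_add_mod (w : ℕ) d, h2, h3]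
  let e := Equiv.ofBijective f (Finite.injective_iff_bijective.1 hf)
  refine ⟨e.symm, fun m hm p hp hp' => ?_⟩
  obtain ⟨v, rfl⟩ := e.surjective p
  rw [symm_apply_apply]
  have hv : (e v : ℕ) = offset (classSize n d) ((v : ℕ) % d + 1) + (v : ℕ) / d := rfl
  have h1 : (v : ℕ) % d + 1 = m := by
    refine hdisj (p := e v) ?_ ?_ (by omega) (by omega)
    · rw [hv]; exact Nat.le_add_right _ _
    · rw [hv]; exact hlt v
  rw [congClass, Finset.mem_filter, Finset.mem_Icc]
  refine ⟨by omega, ?_⟩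
  rw [← h1]
  exact (Nat.mod_modEq _ _).symm.add_right 1

theorem IsConcatPerm.modEq {n d : ℕ} {σ₀ : Perm (Fin n)} (h : IsConcatPerm n d σ₀) {m : ℕ}
    (hm : 1 ≤ m) (hmd : m ≤ d) (p q : Fin n) (hp : offset (classSize n d) m ≤ (p : ℕ))
    (hp' : (p : ℕ) < offset (classSize n d) (m + 1)) (hq : offset (classSize n d) m ≤ (q : ℕ))
    (hq' : (q : ℕ) < offset (classSize n d) (m + 1)) : (σ₀ p : ℕ) ≡ σ₀ q [MOD d] := by
  have h1 := h m (Finset.mem_Icc.2 ⟨hm, hmd⟩) p (by omega) (by omega)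
  have h2 := h m (Finset.mem_Icc.2 ⟨hm, hmd⟩) q (by omega) (by omega)
  rw [congClass, Finset.mem_filter] at h1 h2
  exact Nat.ModEq.add_right_cancel' 1 (h1.2.trans h2.2.symm)

theorem prod_auxSize_classSize {n d : ℕ} (hd : 1 ≤ d) :
    (classSize n d d)! * ∏ i ∈ Finset.Ico 1 d, auxSize (classSize n d i + 1) =
      auxSize (n ⌈/⌉ d + 1) ^ (n % d) * auxSize (n / d + 1) ^ (d - n % d - 1) * (n / d)! := by
  have hmod := Nat.mod_lt n hd
  have h1 : ∏ i ∈ Finset.Ico 1 (n % d + 1), auxSize (classSize n d i + 1) =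
      auxSize (n ⌈/⌉ d + 1) ^ (n % d) := by
    rw [Finset.prod_eq_pow_card (b := auxSize (n ⌈/⌉ d + 1)), Nat.card_Ico, Nat.add_sub_cancel]
    intro i hi
    rw [Finset.mem_Ico] at hi
    rw [classSize_eq hi.1 (by omega), if_pos (by omega)]
    congr 2
    rw [Nat.ceilDiv_eq_add_pred_div]
    symm
    have h2 := Nat.div_add_mod n d
    refine Nat.div_eq_of_lt_le ?_ ?_
    · rw [add_mul, one_mul, mul_comm]; omega
    · rw [add_mul, add_mul, one_mul, mul_comm]; omega
  have h2 : ∏ i ∈ Finset.Ico (n % d + 1) d, auxSize (classSize n d i + 1) =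
      auxSize (n / d + 1) ^ (d - n % d - 1) := by
    rw [Finset.prod_eq_pow_card (b := auxSize (n / d + 1)), Nat.card_Ico, Nat.sub_sub]
    intro i hi
    rw [Finset.mem_Ico] at hi
    rw [classSize_eq (by omega) hi.2.le, if_neg (by omega), add_zero]
  rw [← Finset.prod_Ico_consecutive _ (by omega : 1 ≤ n % d + 1) hmod, h1, h2,
    classSize_eq hd le_rfl, if_neg (by omega), add_zero, mul_comm]

/-! ### Classes of at most two numbers -/

/-- Three rotations of the vector `a b x` with `a ≡ b`: any two of them have `a` and `b` in the same
place. -/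
theorem isSpreadWalk_three {n d o : ℕ} {σ₀ : Perm (Fin n)} (h : o + 3 ≤ n)
    (hmod : (σ₀ ⟨o, by omega⟩ : ℕ) ≡ σ₀ ⟨o + 1, by omega⟩ [MOD d]) :
    IsSpreadWalk d o σ₀ [o + 3, o + 3, o + 3] := by
  have hc : ∀ p : Fin n, (pushCycle n (o + 1) (o + 3) p : ℕ) =
      if (p : ℕ) = o then o + 2 else if (p : ℕ) = o + 1 then o else if (p : ℕ) = o + 2 then o + 1
        else p := by
    intro p
    rw [pushCycle_apply (by omega) (by omega) h]
    split_ifs <;> omega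
  have h3 : pushCycle n (o + 1) (o + 3) * (pushCycle n (o + 1) (o + 3) *
      pushCycle n (o + 1) (o + 3)) = 1 := by
    ext p
    rw [Perm.mul_apply, Perm.mul_apply, hc, hc, hc, Perm.one_apply]
    split_ifs <;> omega
  have hpush : push (o + 1) (o + 3) (push (o + 1) (o + 3) (push (o + 1) (o + 3) σ₀)) = σ₀ := by
    rw [push, push, push, mul_assoc, mul_assoc, h3, mul_one]
  have hne : σ₀ ⟨o, by omega⟩ ≠ σ₀ ⟨o + 1, by omega⟩ := by
    rw [Ne, σ₀.injective.eq_iff, Fin.mk.injEq]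
    omega
  have e0 : ∀ (σ : Perm (Fin n)) (a : ℕ) (ha : a < n), a = o →
      push (o + 1) (o + 3) σ ⟨a, ha⟩ = σ ⟨o + 2, by omega⟩ := by
    rintro σ _ ha rfl
    exact congrArg σ (Fin.ext (by rw [hc]; simp))
  have e1 : ∀ (σ : Perm (Fin n)),
      push (o + 1) (o + 3) σ ⟨o + 1, by omega⟩ = σ ⟨o, by omega⟩ := fun σ =>
    congrArg σ (Fin.ext (by rw [hc]; simp))
  have e2 : ∀ (σ : Perm (Fin n)),
      push (o + 1) (o + 3) σ ⟨o + 2, by omega⟩ = σ ⟨o + 1, by omega⟩ := fun σ =>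
    congrArg σ (Fin.ext (by rw [hc]; simp))
  refine ⟨by simp; omega, hpush, ?_⟩
  rw [trail, trail, trail, trail, hpush]
  simp only [List.pairwise_cons, List.mem_cons, List.not_mem_nil, or_false, forall_eq_or_imp,
    forall_eq, List.Pairwise.nil, and_true, IsEmpty.forall_iff, implies_true]
  refine ⟨⟨?_, ?_⟩, ?_⟩
  · refine le_distInf (p := ⟨o + 2, by omega⟩) ?_ ?_
    · rw [e2, e2, e1]; exact hmod.symm
    · rw [e2, e2, e1]; exact hne.symm
  · refine le_distInf (p := ⟨o + 1, by omega⟩) ?_ ?_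
    · rw [e1]; exact hmod
    · rw [e1]; exact hne
  · refine le_distInf (p := ⟨o, by omega⟩) ?_ ?_
    · rw [e0 _ _ _ rfl, e2]; exact hmod.symm
    · rw [e0 _ _ _ rfl, e2]; exact hne.symm

theorem mainTheorem1 :
    (∀ k d : ℕ, 2 ≤ k → 1 ≤ d →
      (∃ C, IsMainCode k d C) ∧
      ∀ C, IsMainCode k d C →
        IsPushGrayLMRM 1 (k * d) (auxSize (k + 1) ^ (d - 1) * k !) d C) ∧
    (∀ n d : ℕ, 1 ≤ d → 2 * d ≤ n →
      (∃ C, IsGeneralCode n d C) ∧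
      ∀ C, IsGeneralCode n d C →
        IsPushGrayLMRM 1 n
          (auxSize (n ⌈/⌉ d + 1) ^ (n % d) * auxSize (n / d + 1) ^ (d - n % d - 1) * (n / d)!)
          d C) ∧
    (∀ n d : ℕ, d < n → n < 2 * d →
      (∃ C, IsSmallCode n d C) ∧
      ∀ C, IsSmallCode n d C → IsPushGrayLMRM 1 n (3 ^ (n % d)) d C) := by
  refine ⟨fun k d hk hd => ⟨?_, ?_⟩, fun n d hd hn => ⟨?_, ?_⟩, fun n d hdn hn => ?_⟩
  · obtain ⟨σ₀, hσ₀⟩ := exists_isStartPerm (d := d) (by omega : 1 ≤ k)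
    obtain ⟨C, hC⟩ := exists_isRecursiveCode σ₀ hd (s := fun _ => k) fun _ _ _ => hk
    exact ⟨C, σ₀, hσ₀, hC⟩
  · rintro C ⟨σ₀, hσ₀, hC⟩
    have h := isRecursiveCode_isPushGrayLMRM hd (by omega)
      (by rw [offset_const, Nat.add_sub_cancel, mul_comm]) (fun m hm _ p q hp hp' hq hq' => ?_) hC
    · rwa [Finset.prod_const, Nat.card_Ico, mul_comm (k !)] at h
    · rw [offset_const] at hp hp' hq hq'
      exact (hσ₀.modEq hm hp hp').trans (hσ₀.modEq hm hq hq').symm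
  · obtain ⟨σ₀, hσ₀⟩ := exists_isConcatPerm (n := n) hd
    obtain ⟨C, hC⟩ := exists_isRecursiveCode σ₀ hd (s := classSize n d) fun m hm hmd => by
      rw [classSize_eq hm hmd]
      exact ((Nat.le_div_iff_mul_le hd).2 hn).trans (Nat.le_add_right _ _)
    exact ⟨C, σ₀, hσ₀, hC⟩
  · rintro C ⟨σ₀, hσ₀, hC⟩
    rw [← prod_auxSize_classSize hd]
    refine isRecursiveCode_isPushGrayLMRM hd ?_ (offset_classSize_last hd).le
      (fun m hm hmd => hσ₀.modEq hm hmd) hC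
    rw [classSize_eq hd le_rfl]
    exact ((Nat.le_div_iff_mul_le hd).2 (by omega)).trans (Nat.le_add_right _ _)
  · have hdiv : n / d = 1 := Nat.div_eq_of_lt_le (by omega) (by omega)
    have hm : n % d = n - d := by rw [Nat.mod_eq_sub_mod hdn.le, Nat.mod_eq_of_lt (by omega)]
    set m := n % d with hmdef
    have hsize : ∀ i, 1 ≤ i → i ≤ m → classSize n d i = 2 := fun i h1 h2 => by
      rw [classSize_eq h1 (by omega), hdiv, if_pos (by omega)]
    have hoff : offset (classSize n d) m = 2 * m - 2 := by
      have := offset_classSize (n := n) (d := d) (m := m - 1) (by omega)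
      rw [Nat.sub_add_cancel (by omega), hdiv, min_eq_left (by omega)] at this
      omega
    have hoff' : offset (classSize n d) (m + 1) = 2 * m := by
      rw [offset_succ _ (by omega), hoff, hsize m (by omega) le_rfl]
      omega
    refine ⟨?_, ?_⟩
    · obtain ⟨σ₀, hσ₀⟩ := exists_isConcatPerm (n := n) (d := d) (by omega)
      obtain ⟨T, hT⟩ := exists_stage (b := m) (by omega) (s := classSize n d)
        (fun i h1 h2 => (hsize i h1 h2.le).ge) [2 * m + 1, 2 * m + 1, 2 * m + 1]
      exact ⟨_, σ₀, hσ₀, T, hT, rfl⟩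
    · rintro C ⟨σ₀, hσ₀, T, hT, rfl⟩
      have h₀ : IsSpreadWalk d (offset (classSize n d) m) σ₀ [2 * m + 1, 2 * m + 1, 2 * m + 1] := by
        have := isSpreadWalk_three (n := n) (d := d) (o := offset (classSize n d) m) (σ₀ := σ₀)
          (by omega) (hσ₀.modEq (m := m) (by omega) (by omega) _ _ (by simp) (by simp; omega)
            (by simp) (by simp; omega))
        rwa [show offset (classSize n d) m + 3 = 2 * m + 1 by omega] at this
      have h := hT.isPushGrayLMRM (by omega) (by omega)
        (fun i h1 h2 => hσ₀.modEq h1 (by omega)) h₀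
        (List.length_pos_of_ne_nil (hT.ne_nil (by simp)))
      rw [Finset.prod_eq_pow_card (b := 3), Nat.card_Ico] at h
      · have h3 : [2 * m + 1, 2 * m + 1, 2 * m + 1].length * 3 ^ (m - 1) = 3 ^ m := by
          rw [← Nat.sub_add_cancel (by omega : 1 ≤ m), pow_succ', Nat.add_sub_cancel]
          rfl
        rwa [h3] at h
      · intro i hi
        rw [Finset.mem_Ico] at hi
        rw [hsize i hi.1 (by omega)]
        rfl
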